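/- **Soundness of the tableau for $\mathrm{POTL}_f$.** *Let $\Sigma$ (structural propositions) and $AP$ (other propositions) be disjoint, let $M:\Sigma^2\rightharpoonup\{\lessdot,\doteq,\gtrdot\}$ be an operator precedence matrix, extended by $\#\lessdot a$, $a\gtrdot\#$ for $a\in\Sigma$ and $\#\doteq\#$, and let $\varphi$ be a $\mathrm{POTL}_f$ formula over $\Sigma\cup AP$. If the tableau for $\varphi$ has an accepted branch, then $\varphi$ is satisfiable, i.e. $(w,1)\models\varphi$ for some finite word $w$ compatible with $M$.* The notions are as follows. **Words.** A finite word $w$ has letters in $\Sigma\times 2^{AP}$; the positions of $\#w\#$ are $0,\dots,n$ with $n=|w|+1$; positions $0$ and $n$ carry only $\#$. For positions, $i\sim j$ means that the relation $\sim$ holds between their symbols in $\Sigma\cup\{\#\}$. Chains: ${}^{c_0}[s_0c_1s_1\dots c_\ell s_\ell]^{c_{\ell+1}}$ ($\ell\ge1$) with $c_0\lessdot c_1\doteq\dots\doteq c_\ell\gtrdot c_{\ell+1}$, each $s_p$ being empty or the body of a chain with contexts $c_p,c_{p+1}$. $\chi(i,j)$ holds iff $i,j$ are the positions of the left and right context of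 a chain in $\#w\#$. $w$ is compatible with $M$ if the precedence relation is defined for all adjacent positions and for all $i,j$ with $\chi(i,j)$. **Logic.** With $t\in\{d,u\}$, formulas are built from propositions by $\neg,\wedge,\vee$, next $\bigcirc^t$, weak next $\tilde\bigcirc^t$, chain next $\chi_F^t$, weak chain next $\tilde\chi_F^t$, until and release $U_\chi^t,R_\chi^t$, hierarchical next $\bigcirc_H^t$, weak hierarchical next $\tilde\bigcirc_H^t$, and $U_H^t,R_H^t$. Let $\sim^d$ be $\lessdot$ and $\sim^u$ be $\gtrdot$; write $i\to^t j$ for "$i\sim^t j$ or $i\doteq j$". Propositions and Boolean connectives are as usual. - $(w,i)\models\bigcirc^t\psi$ iff $i<n$, $i\to^t i+1$ and $(w,i+1)\models\psi$; $\tilde\bigcirc^t\psi$: if $i<n$ and $i\to^t i+1$ then $(w,i+1)\models\psi$. - $\chi_F^t\psi$ (resp. $\tilde\chi_F^t\psi$): $(w,j)\models\psi$ for some (resp. every) $j>i$ with $\chi(i,j)$ and $i\to^tj$. - The summary path $\pi^t_\chi(i,j)$ is $i=i_1<\dots<i_r=j$ where $i_{p+1}$ is the greatest $h\le j$ with $\chi(i_p,h)$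 and $i_p\to^t h$ if one exists, and otherwise $i_{p+1}=i_p+1$, provided that $i_p\to^t i_p+1$. - The downward hierarchical path $\pi^d_H(i,j)$ is $i=i_1<\dots<i_r=j$ such that for some $h>j$ all $p$ satisfy $\chi(i_p,h)$ and $i_p\gtrdot h$, and no $k$ strictly between consecutive elements has $\chi(k,h)$. The upward one has $h<j$, $\chi(h,i_p)$, $h\lessdot i_p$, and no $k$ strictly between with $\chi(h,k)$. - $\alpha\,U^t_\bullet\,\beta$ ($\bullet\in\{\chi,H\}$) holds at $i$ iff for some $j\ge i$ the path $\pi^t_\bullet(i,j)$ exists, $\beta$ holds at $j$ and $\alpha$ at all its positions before $j$. $\alpha\,R^t_\bullet\,\beta$ holds at $i$ iff for every $j\ge i$ for which $\pi^t_\bullet(i,j)$ exists, either $\beta$ holds at all its positions, or $\alpha$ holds at some position $k$ of it and $\beta$ at all its positions $\le k$. - $\bigcirc_H^t\psi$ (resp. $\tilde\bigcirc^t_H\psi$) holds at $i$ iff $i$ has a $t$-hierarchical successor $j$ and (resp. if $i$ has one, $j$, then) $(w,j)\models\psi$. For $t=u$: $j=\min\{k>i:\chi(h,k),h\lessdot k\}$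 where $h<i$, $\chi(h,i)$, $h\lessdot i$. For $t=d$: $j=\min\{k>i:\chi(k,h),k\gtrdot h\}$ where $h>i$, $\chi(i,h)$, $i\gtrdot h$. **Tableau.** A tree whose nodes $u$ carry a set $\Gamma(u)$ of formulas and possibly $\#$, a symbol $\mathrm{smb}(u)\in\Sigma\cup\{\#\}$, and pointers $\mathrm{stack}(u),\mathrm{ctx}(u)$ to ancestors or $\bot$. The root has $\Gamma=\{\varphi\}$ (with $\varphi$ in negation normal form; otherwise its negation normal form is taken), $\mathrm{smb}=\#$, $\mathrm{stack}=\mathrm{ctx}=\bot$. If $\Gamma(u)\cap(\Sigma\cup\{\#\})=\{a\}$, $\Gamma(u)$ is compared through $a$; $\Gamma(\bot)$ is compared through $\#$ and contains no formulas. $u$ is of type push, shift, pop if $\mathrm{smb}(u)\lessdot,\doteq,\gtrdot\Gamma(u)$, respectively. $u_s$ is the closest step ancestor of $u$; a node without step ancestor is treated as if $u_s$ were the push/shift node $\bot$. As expansion replaces formulas, let $\Gamma^*(u)$ be the set of all formulas in the labels of $u$ and of those ancestors of $u$ that are descendants of its closest proper push/shift step ancestor (of all ancestors if there is none); $\Gamma^*(\bot)=\emptyset$.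 *Expansion rules.* If $\psi\in\Gamma(u)$, add a child for each listed set, with $\psi$ replaced by it (any order of rules): $\alpha\wedge\beta$: $\{\alpha,\beta\}$. $\alpha\vee\beta$: $\{\alpha\}$, $\{\beta\}$. $\psi=\alpha U_\chi^t\beta$: $\{\beta\}$, $\{\alpha,\bigcirc^t\psi\}$, $\{\alpha,\chi_F^t\psi\}$. $\psi=\alpha R_\chi^t\beta$: $\{\alpha,\beta\}$, $\{\beta,\tilde\bigcirc^t\psi,\tilde\chi_F^t\psi\}$. $\psi=\alpha U_H^u\beta$: $\{\alpha,\bigcirc_H^u\psi\}$, and $\{\beta\}$ if $u_s$ is a pop node with $\Gamma(\mathrm{ctx}(u_s))\lessdot\Gamma(u_s)$. $\psi=\alpha U_H^d\beta$: $\{\alpha,\bigcirc_H^d\psi\}$, and $\{\beta\}$ if $u_s$ is push/shift. $\psi=\alpha R_H^u\beta$: $\{\alpha,\beta\}$, $\{\beta,\tilde\bigcirc_H^u\psi\}$. $\psi=\alpha R_H^d\beta$, only if $u_s$ is push/shift: $\emptyset$, $\{\alpha,\beta\}$, $\{\beta,\tilde\bigcirc_H^d\psi\}$. If none applies and $\Gamma(u)\cap(\Sigma\cup\{\#\})=\emptyset$,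 add a child with $\Gamma(u)\cup\{a\}$ for each $a\in\Sigma\cup\{\#\}$. If none applies and $\Gamma(u)\cap(\Sigma\cup\{\#\})\neq\emptyset$ (and no guess rule is due), $u$ is a step node. *Acceptance.* A step node $u$ is accepted if $\Gamma(u)=\{\#\}$ and $\mathrm{stack}(u)=\bot$. *Rejection.* A step node $u$ is rejected in each of these cases (types of $u$ and $u_s$ in brackets, $*$ = any; in cases 4, 5 and in the cases below that refer to $\Gamma(u_s)$ or $\Gamma^*(u_s)$, $u_s\neq\bot$): 1. $\{\psi,\neg\psi\}\subseteq\Gamma(u)$. 2. $|\Gamma(u)\cap\Sigma|>1$. 3. $\#\in\Gamma(u)$ and $\Gamma(u)$ contains a proposition or some $\bigcirc^t\alpha$, or $\Gamma^*(u)$ contains some $\alpha U_H^d\beta$. 4. [$*$ | push/shift] $\Gamma(u_s)\gtrdot\Gamma(u)$ and some $\bigcirc^d\alpha\in\Gamma(u_s)$; or $\Gamma(u_s)\lessdot\Gamma(u)$ and some $\bigcirc^u\alpha\in\Gamma(u_s)$. 5. [$*$ | push/shift] $\Gamma(u_s)\sim^t\Gamma(u)$ or $\Gamma(u_s)\doteq\Gamma(u)$,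 and $\tilde\bigcirc^t\alpha\in\Gamma(u_s)$, $\alpha\notin\Gamma^*(u)$. 6. [pop | $*$] some $\chi_F^t\alpha\in\Gamma(u')$ is not fulfilled in $u'$, where $u'=\mathrm{stack}(u)$ or $u'$ is an earlier shift step node with $\mathrm{stack}(u')=\mathrm{stack}(u)$. Fulfilled means: on the branch there is a pop step descendant $u_p$ of $u'$ with $\mathrm{ctx}(u_p)=u'$, $\Gamma(u')\sim^t\Gamma(u_p)$ or $\Gamma(u')\doteq\Gamma(u_p)$, and $\alpha\in\Gamma^*(u'')$ for the closest push/shift step node $u''$ descending from $u_p$. 7. $\tilde\chi_F^t\alpha\in\Gamma(\mathrm{ctx}(u_s))$ and $\alpha\notin\Gamma^*(u)$, with [push | pop] and $t=d$, or [shift | pop] and any $t$, or [pop | pop] and $t=u$. 8. [pop | $*$] $\bigcirc_H^u\alpha\in\Gamma(\mathrm{stack}(u))$ and not $\Gamma(\mathrm{ctx}(u))\lessdot\Gamma(u)$; [push | pop] $\bigcirc_H^u\alpha\in\Gamma(\mathrm{stack}(u_s))$ and $\alpha\notin\Gamma^*(u)$; [push | push/shift] or [shift | $*$] $\bigcirc_H^u\alpha\in\Gamma(u)$.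 9. [push | pop] $\tilde\bigcirc_H^u\alpha\in\Gamma(\mathrm{stack}(u_s))$, $\mathrm{stack}(u_s)$ is a push node whose closest step ancestor is a pop node, and $\alpha\notin\Gamma^*(u)$. 10. $\bigcirc_H^d\alpha\in\Gamma(\mathrm{ctx}(u))$ and: [pop | $*$] $\mathrm{smb}(\mathrm{stack}(u))\doteq\Gamma(u)$, or [pop | push/shift], or [pop | pop] $\alpha\notin\Gamma^*(\mathrm{ctx}(u_s))$. Also [pop/shift | push/shift] $\bigcirc_H^d\alpha\in\Gamma(u_s)$. 11. [pop | pop] $\tilde\bigcirc_H^d\alpha\in\Gamma(\mathrm{ctx}(u))$, $\mathrm{smb}(\mathrm{stack}(u))\gtrdot\Gamma(u)$, $\alpha\notin\Gamma^*(\mathrm{ctx}(u_s))$. 12. [pop/shift | push/shift] $\alpha U_H^d\beta\in\Gamma^*(u_s)$; [push/shift | pop] $\alpha U_H^d\beta\in\Gamma^*(\mathrm{ctx}(u_s))$; [pop | pop] $\psi=\alpha R_H^d\beta\in\Gamma^*(\mathrm{ctx}(u_s))$ and neither $\{\beta,\tilde\bigcirc_H^d\psi\}$ nor $\{\alpha,\beta\}$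 is a subset of $\Gamma^*(\mathrm{ctx}(u_s))$. 13. [push/shift | $*$] some proper ancestor step node $u'$ has the same $\Gamma$, $\mathrm{smb}$, $\Gamma(\mathrm{stack})$ and $\Gamma(\mathrm{ctx})$ as $u$ and is pending: it is a push (shift) node and no pop step node $u_p$ before $u$ has $\mathrm{stack}(u_p)=u'$ ($\mathrm{stack}(u_p)=\mathrm{stack}(u')$). *Temporal step.* A step node $u$ that is neither accepted nor rejected gets one child $u'$. If $u$ is push or shift, $\Gamma(u')=\{\alpha:\bigcirc^t\alpha\in\Gamma(u)\text{ for some }t\}$ and $\mathrm{smb}(u')$ is the symbol of $\Gamma(u)$. For push: $\mathrm{stack}(u')=u$, and $\mathrm{ctx}(u')$ is $\bot$ if $\mathrm{stack}(u)=\bot$, otherwise $u_s$ if $u_s$ is push/shift and $\mathrm{ctx}(u_s)$ if $u_s$ is pop. For shift (only if $\mathrm{stack}(u)\ne\bot$): $\mathrm{stack}(u')=\mathrm{stack}(u)$, $\mathrm{ctx}(u')=\mathrm{ctx}(u)$. For pop, with $v=\mathrm{stack}(u)$: $\Gamma(u')=\Gamma(u)$, $\mathrm{smb}(u')=\mathrm{smb}(v)$,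 $\mathrm{stack}(u')=\mathrm{stack}(v)$, $\mathrm{ctx}(u')=\mathrm{ctx}(v)$. *Guess rules:* then $u'$ gets a child with label $\Gamma(u')\cup G$ for each $G\subseteq\mathcal G$. If $u$ is push/shift, $\mathcal G$ is the set of arguments of formulas $\tilde\bigcirc^t\alpha,\bigcirc_H^d\alpha,\tilde\bigcirc_H^d\alpha$ in $\Gamma(u)$. If $u$ is pop and $\mathrm{ctx}(u)\neq\bot$, it is the set of arguments of formulas $\chi_F^t\alpha,\tilde\chi_F^t\alpha,\bigcirc_H^d\alpha,\tilde\bigcirc_H^d\alpha$ in $\Gamma(\mathrm{ctx}(u))$ and of $\bigcirc_H^u\alpha,\tilde\bigcirc_H^u\alpha$ in $\Gamma(\mathrm{stack}(u))$. If $u$ is pop and $\mathrm{ctx}(u)=\bot$, no guess rule applies. An accepted branch is a branch from the root to an accepted leaf on which no step node is rejected. -/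

import Mathlib

/-! Operator precedence alphabets, the temporal logic POTL_f on finite operator precedence words,
and the tree-shaped tableau for POTL_f.

`S` is the set of structural propositions, `AP` the set of the other atomic propositions.
The end marker `#` is represented by `none : Option S`. -/

/-- The three precedence relations `⋖`, `≐`, `⋗`. -/
inductive PrecRel : Type
  | yields
  | equal
  | takes

/-- An operator precedence matrix: a partial function on pairs of letters. -/
abbrev OPM (S : Type*) := S → S → Option PrecRel

/-- The matrix extended to `#`: the initial `#` yields precedence to every letter, every letter
takes precedence on the ending `#`, and `# ≐ #`. -/
def OPM.rel {S : Type*} (M : OPM S) : Option S → Option S → Option PrecRel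
  | some a, some b => M a b
  | none, some _ => some .yields
  | some _, none => some .takes
  | none, none => some .equal

/-- The directions `d` and `u`. -/
inductive Dir : Type
  | down
  | up

/-- `∼^d` is `⋖` and `∼^u` is `⋗`. -/
def Dir.prec : Dir → PrecRel
  | .down => .yields
  | .up => .takes

/-- A precedence relation that is defined and is `∼^t` or `≐`. -/
def Dir.Allows (t : Dir) (r : Option PrecRel) : Prop :=
  r = some t.prec ∨ r = some .equal

/-- POTL_f formulas. -/
inductive Formula (S AP : Type*) : Type _
  | struct (a : S)
  | prop (p : AP)
  | neg (φ : Formula S AP)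
  | and (φ ψ : Formula S AP)
  | or (φ ψ : Formula S AP)
  /-- strong next `◯^t` -/
  | next (t : Dir) (φ : Formula S AP)
  /-- weak next -/
  | wnext (t : Dir) (φ : Formula S AP)
  /-- strong chain next `χ_F^t` -/
  | cnext (t : Dir) (φ : Formula S AP)
  /-- weak chain next -/
  | wcnext (t : Dir) (φ : Formula S AP)
  /-- summary until `φ U_χ^t ψ` -/
  | cuntil (t : Dir) (φ ψ : Formula S AP)
  /-- summary release `φ R_χ^t ψ` -/
  | crelease (t : Dir) (φ ψ : Formula S AP)
  /-- strong hierarchical next `◯_H^t` -/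
  | hnext (t : Dir) (φ : Formula S AP)
  /-- weak hierarchical next -/
  | whnext (t : Dir) (φ : Formula S AP)
  /-- hierarchical until `φ U_H^t ψ` -/
  | huntil (t : Dir) (φ ψ : Formula S AP)
  /-- hierarchical release `φ R_H^t ψ` -/
  | hrelease (t : Dir) (φ ψ : Formula S AP)

/-- `nnfAux true φ` is the negation normal form of `φ`, and `nnfAux false φ` that of `¬ φ`. -/
def Formula.nnfAux {S AP : Type*} : Bool → Formula S AP → Formula S AP
  | true, .struct a => .struct a
  | false, .struct a => .neg (.struct a)
  | true, .prop p => .prop p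
  | false, .prop p => .neg (.prop p)
  | true, .neg φ => nnfAux false φ
  | false, .neg φ => nnfAux true φ
  | true, .and φ ψ => .and (nnfAux true φ) (nnfAux true ψ)
  | false, .and φ ψ => .or (nnfAux false φ) (nnfAux false ψ)
  | true, .or φ ψ => .or (nnfAux true φ) (nnfAux true ψ)
  | false, .or φ ψ => .and (nnfAux false φ) (nnfAux false ψ)
  | true, .next t φ => .next t (nnfAux true φ)
  | false, .next t φ => .wnext t (nnfAux false φ)
  | true, .wnext t φ => .wnext t (nnfAux true φ)
  | false, .wnext t φ => .next t (nnfAux false φ)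
  | true, .cnext t φ => .cnext t (nnfAux true φ)
  | false, .cnext t φ => .wcnext t (nnfAux false φ)
  | true, .wcnext t φ => .wcnext t (nnfAux true φ)
  | false, .wcnext t φ => .cnext t (nnfAux false φ)
  | true, .cuntil t φ ψ => .cuntil t (nnfAux true φ) (nnfAux true ψ)
  | false, .cuntil t φ ψ => .crelease t (nnfAux false φ) (nnfAux false ψ)
  | true, .crelease t φ ψ => .crelease t (nnfAux true φ) (nnfAux true ψ)
  | false, .crelease t φ ψ => .cuntil t (nnfAux false φ) (nnfAux false ψ)
  | true, .hnext t φ => .hnext t (nnfAux true φ)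
  | false, .hnext t φ => .whnext t (nnfAux false φ)
  | true, .whnext t φ => .whnext t (nnfAux true φ)
  | false, .whnext t φ => .hnext t (nnfAux false φ)
  | true, .huntil t φ ψ => .huntil t (nnfAux true φ) (nnfAux true ψ)
  | false, .huntil t φ ψ => .hrelease t (nnfAux false φ) (nnfAux false ψ)
  | true, .hrelease t φ ψ => .hrelease t (nnfAux true φ) (nnfAux true ψ)
  | false, .hrelease t φ ψ => .huntil t (nnfAux false φ) (nnfAux false ψ)

/-- The negation normal form of a formula; a formula in which `¬` stands only in front of atomic
propositions is its own negation normal form. -/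
def Formula.nnf {S AP : Type*} (φ : Formula S AP) : Formula S AP := Formula.nnfAux true φ

/-! ### Finite words and their chains -/

/-- A finite word: every letter has exactly one structural proposition and a set of other atomic
propositions. The positions of `# w #` are `0, …, w.length + 1`; the first and the last of them
carry `#` and nothing else, and position `i + 1` carries the `i`-th letter. -/
abbrev OPWord (S AP : Type*) := List (S × Set AP)

/-- The last position of `# w #`. -/
def OPWord.last {S AP : Type*} (w : OPWord S AP) : ℕ := w.length + 1

/-- The letter at a position, `none` at the two positions of `#`. -/
def OPWord.letter {S AP : Type*} (w : OPWord S AP) : ℕ → Option (S × Set AP)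
  | 0 => none
  | i + 1 => w[i]?

/-- The structural symbol at a position. -/
def OPWord.sym {S AP : Type*} (w : OPWord S AP) (i : ℕ) : Option S := (w.letter i).map Prod.fst

/-- The precedence relation between two positions, if defined. -/
def OPWord.rel {S AP : Type*} (M : OPM S) (w : OPWord S AP) (i j : ℕ) : Option PrecRel :=
  M.rel (w.sym i) (w.sym j)

/-- Parts of the word that are derived as chains. `ChainPart M w true i j`: positions `i` and `j` are
the left and the right context of a chain `^{c₀}[s₀ c₁ s₁ c₂ … c_ℓ s_ℓ]^{c_{ℓ+1}}`.
`ChainPart M w false i k`: `i` is the position of `c₀` and `k` the position of some `c_p`, `p ≥ 1`,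
in an unfinished chain `c₀ s₀ c₁ s₁ … c_p` with `c₀ ⋖ c₁ ≐ c₂ ≐ … ≐ c_p`. Consecutive `c_q` and
`c_{q+1}` are adjacent (`s_q` is empty) or are the contexts of a chain with body `s_q`. -/
inductive ChainPart {S AP : Type*} (M : OPM S) (w : OPWord S AP) : Bool → ℕ → ℕ → Prop
  | open_adj (i : ℕ) : w.rel M i (i + 1) = some .yields → ChainPart M w false i (i + 1)
  | open_sub (i k : ℕ) : ChainPart M w true i k → w.rel M i k = some .yields →
      ChainPart M w false i k
  | shift_adj (i k : ℕ) : ChainPart M w false i k → w.rel M k (k + 1) = some .equal →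
      ChainPart M w false i (k + 1)
  | shift_sub (i k l : ℕ) : ChainPart M w false i k → ChainPart M w true k l →
      w.rel M k l = some .equal → ChainPart M w false i l
  | close_adj (i k : ℕ) : ChainPart M w false i k → w.rel M k (k + 1) = some .takes →
      ChainPart M w true i (k + 1)
  | close_sub (i k l : ℕ) : ChainPart M w false i k → ChainPart M w true k l →
      w.rel M k l = some .takes → ChainPart M w true i l

/-- The chain relation `χ` on the positions of `# w #`. -/
def Chi {S AP : Type*} (M : OPM S) (w : OPWord S AP) (i j : ℕ) : Prop :=
  j ≤ w.last ∧ ChainPart M w true i j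

/-- Compatibility of a word with the precedence matrix. -/
def Compatible {S AP : Type*} (M : OPM S) (w : OPWord S AP) : Prop :=
  (∀ i < w.last, (w.rel M i (i + 1)).isSome) ∧ ∀ i j, Chi M w i j → (w.rel M i j).isSome

/-! ### Semantics of POTL_f -/

/-- In a summary path that ends in `j`, position `b` follows position `a`. -/
def SummaryNext {S AP : Type*} (M : OPM S) (w : OPWord S AP) (t : Dir) (j a b : ℕ) : Prop :=
  IsGreatest {h | h ≤ j ∧ Chi M w a h ∧ t.Allows (w.rel M a h)} b ∨
    ({h | h ≤ j ∧ Chi M w a h ∧ t.Allows (w.rel M a h)} = ∅ ∧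
      b = a + 1 ∧ t.Allows (w.rel M a (a + 1)))

/-- `l` lists the positions of the downward or upward summary path between `i` and `j`. -/
def IsSummaryPath {S AP : Type*} (M : OPM S) (w : OPWord S AP) (t : Dir) (i j : ℕ)
    (l : List ℕ) : Prop :=
  j ≤ w.last ∧ l.head? = some i ∧ l.getLast? = some j ∧ l.IsChain (SummaryNext M w t j)

/-- `l` lists the positions of the downward or upward hierarchical path between `i` and `j`. -/
def IsHierPath {S AP : Type*} (M : OPM S) (w : OPWord S AP) (t : Dir) (i j : ℕ)
    (l : List ℕ) : Prop :=
  j ≤ w.last ∧ l.head? = some i ∧ l.getLast? = some j ∧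
    match t with
    | .down => ∃ h, j < h ∧ (∀ p ∈ l, Chi M w p h ∧ w.rel M p h = some .takes) ∧
        l.IsChain (fun a b => a < b ∧ ∀ k, a < k → k < b → ¬ Chi M w k h)
    | .up => ∃ h, h < j ∧ (∀ p ∈ l, Chi M w h p ∧ w.rel M h p = some .yields) ∧
        l.IsChain (fun a b => a < b ∧ ∀ k, a < k → k < b → ¬ Chi M w h k)

/-- Position `j` is the hierarchical successor of position `i`. -/
def HierNext {S AP : Type*} (M : OPM S) (w : OPWord S AP) (t : Dir) (i j : ℕ) : Prop :=
  match t with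
  | .up => ∃ h, h < i ∧ Chi M w h i ∧ w.rel M h i = some .yields ∧
      IsLeast {k | i < k ∧ Chi M w h k ∧ w.rel M h k = some .yields} j
  | .down => ∃ h, i < h ∧ Chi M w i h ∧ w.rel M i h = some .takes ∧
      IsLeast {k | i < k ∧ Chi M w k h ∧ w.rel M k h = some .takes} j

/-- Truth of a formula at a position of `# w #`. -/
def Sat {S AP : Type*} (M : OPM S) (w : OPWord S AP) : ℕ → Formula S AP → Prop
  | i, .struct a => w.sym i = some a
  | i, .prop p => ∃ c, w.letter i = some c ∧ p ∈ c.2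
  | i, .neg φ => ¬ Sat M w i φ
  | i, .and φ ψ => Sat M w i φ ∧ Sat M w i ψ
  | i, .or φ ψ => Sat M w i φ ∨ Sat M w i ψ
  | i, .next t φ => i < w.last ∧ t.Allows (w.rel M i (i + 1)) ∧ Sat M w (i + 1) φ
  | i, .wnext t φ => i < w.last → t.Allows (w.rel M i (i + 1)) → Sat M w (i + 1) φ
  | i, .cnext t φ => ∃ j, i < j ∧ Chi M w i j ∧ t.Allows (w.rel M i j) ∧ Sat M w j φ
  | i, .wcnext t φ => ∀ j, i < j → Chi M w i j → t.Allows (w.rel M i j) → Sat M w j φ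
  | i, .cuntil t φ ψ => ∃ j l, IsSummaryPath M w t i j l ∧ Sat M w j ψ ∧
      ∀ k ∈ l, k < j → Sat M w k φ
  | i, .crelease t φ ψ => ∀ j l, IsSummaryPath M w t i j l →
      (∀ k ∈ l, Sat M w k ψ) ∨ ∃ k ∈ l, Sat M w k φ ∧ ∀ k' ∈ l, k' ≤ k → Sat M w k' ψ
  | i, .hnext t φ => ∃ j, HierNext M w t i j ∧ Sat M w j φ
  | i, .whnext t φ => ∀ j, HierNext M w t i j → Sat M w j φ
  | i, .huntil t φ ψ => ∃ j l, IsHierPath M w t i j l ∧ Sat M w j ψ ∧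
      ∀ k ∈ l, k < j → Sat M w k φ
  | i, .hrelease t φ ψ => ∀ j l, IsHierPath M w t i j l →
      (∀ k ∈ l, Sat M w k ψ) ∨ ∃ k ∈ l, Sat M w k φ ∧ ∀ k' ∈ l, k' ≤ k → Sat M w k' ψ

/-- `φ` is satisfiable: it holds in the first position after the initial `#` of some finite word
compatible with `M`. -/
def Satisfiable {S AP : Type*} (M : OPM S) (φ : Formula S AP) : Prop :=
  ∃ w : OPWord S AP, Compatible M w ∧ Sat M w 1 φ

/-! ### The tableau -/

/-- A tableau node. The label `Γ` is `label`, together with `#` if `hash` is `true`. The pointers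
`stack` and `ctx` are the indices of ancestors on the branch, and `none` stands for `⊥`. The last
three fields are bookkeeping: `prev` is the closest step ancestor (`none` if there is no such
ancestor), `waiting` says that the node was added by a step rule and that a guess rule applies to
it next, and `pos` is the word position described by the node, namely one plus the number of
push and shift step nodes among its proper ancestors. -/
structure TabNode (S AP : Type*) where
  label : Set (Formula S AP)
  hash : Bool
  smb : Option S
  stack : Option ℕ
  ctx : Option ℕ
  prev : Option ℕ
  waiting : Bool
  pos : ℕ

/-- A branch: its nodes are `B 0, B 1, …`. -/
abbrev TabBranch (S AP : Type*) := ℕ → TabNode S AP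

/-- `Γ(u) ∩ (Σ ∪ {#})`. -/
def TabNode.syms {S AP : Type*} (u : TabNode S AP) : Set (Option S) :=
  {x | match x with
    | some a => Formula.struct a ∈ u.label
    | none => u.hash = true}

/-- `smb(u) r Γ(u)`; for `r = ⋖, ≐, ⋗` a step node `u` is then a push, shift, pop node. -/
def TabNode.HasType {S AP : Type*} (M : OPM S) (u : TabNode S AP) (r : PrecRel) : Prop :=
  ∃ x, u.syms = {x} ∧ M.rel u.smb x = some r

/-- `u` is of type push or of type shift. -/
def TabNode.IsPushShift {S AP : Type*} (M : OPM S) (u : TabNode S AP) : Prop :=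
  u.HasType M .yields ∨ u.HasType M .equal

section
variable {S AP : Type*}

/-- `Γ(o) ∩ (Σ ∪ {#})` for a pointer `o`; the pointer `⊥` stands for the initial `#`. -/
def symsAt (B : TabBranch S AP) : Option ℕ → Set (Option S)
  | none => {none}
  | some i => (B i).syms

/-- `Γ(o) r Γ(u)` for a pointer `o`. -/
def RelAt (M : OPM S) (B : TabBranch S AP) (o : Option ℕ) (r : PrecRel) (u : TabNode S AP) :
    Prop :=
  ∃ x y, symsAt B o = {x} ∧ u.syms = {y} ∧ M.rel x y = some r

/-- `Γ(o) ∼^t Γ(u)` or `Γ(o) ≐ Γ(u)`. -/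
def DirRelAt (M : OPM S) (B : TabBranch S AP) (o : Option ℕ) (t : Dir) (u : TabNode S AP) :
    Prop :=
  RelAt M B o t.prec u ∨ RelAt M B o .equal u

/-- The formulas in `Γ(o)` for a pointer `o`. -/
def labelAt (B : TabBranch S AP) : Option ℕ → Set (Formula S AP)
  | none => ∅
  | some i => (B i).label

/-- `Γ*(B k)`: the formulas that appear in the label of `B k` or of an earlier node for the same
word position, before their replacement by the expansion rules. -/
def Appearing (B : TabBranch S AP) (k : ℕ) : Set (Formula S AP) :=
  {ψ | ∃ l ≤ k, (B l).pos = (B k).pos ∧ ψ ∈ (B l).label}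

/-- `Γ*(o)` for a pointer `o`. -/
def AppearingAt (B : TabBranch S AP) : Option ℕ → Set (Formula S AP)
  | none => ∅
  | some i => Appearing B i

/-- The closest step ancestor of `u` is a pop node. -/
def PrevPop (M : OPM S) (B : TabBranch S AP) (u : TabNode S AP) : Prop :=
  ∃ s, u.prev = some s ∧ (B s).HasType M .takes

/-- The closest step ancestor of `u` is a push or shift node; nodes without step ancestor come
directly after the initial `#` and count here as well. -/
def PrevPushShift (M : OPM S) (B : TabBranch S AP) (u : TabNode S AP) : Prop :=
  u.prev = none ∨ ∃ s, u.prev = some s ∧ (B s).IsPushShift M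

/-- Expansion rules: `Expands M B u ψ Δ` if `Δ` is one of the sets that may replace `ψ` in the label
of `u`. -/
inductive Expands (M : OPM S) (B : TabBranch S AP) (u : TabNode S AP) :
    Formula S AP → Set (Formula S AP) → Prop
  | and (α β) : Expands M B u (.and α β) {α, β}
  | or_left (α β) : Expands M B u (.or α β) {α}
  | or_right (α β) : Expands M B u (.or α β) {β}
  | huntil_next (t α β) : Expands M B u (.huntil t α β) {α, .hnext t (.huntil t α β)}
  | hu_until_now (α β s) : u.prev = some s → (B s).HasType M .takes →
      RelAt M B (B s).ctx .yields (B s) → Expands M B u (.huntil .up α β) {β}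
  | hd_until_now (α β) : PrevPushShift M B u → Expands M B u (.huntil .down α β) {β}
  | crelease_now (t α β) : Expands M B u (.crelease t α β) {α, β}
  | crelease_next (t α β) : Expands M B u (.crelease t α β)
      {β, .wnext t (.crelease t α β), .wcnext t (.crelease t α β)}
  | hu_release_now (α β) : Expands M B u (.hrelease .up α β) {α, β}
  | hu_release_next (α β) : Expands M B u (.hrelease .up α β)
      {β, .whnext .up (.hrelease .up α β)}
  | cuntil_now (t α β) : Expands M B u (.cuntil t α β) {β}
  | cuntil_next (t α β) : Expands M B u (.cuntil t α β) {α, .next t (.cuntil t α β)}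
  | cuntil_chain (t α β) : Expands M B u (.cuntil t α β) {α, .cnext t (.cuntil t α β)}
  | hd_release_none (α β) : PrevPushShift M B u → Expands M B u (.hrelease .down α β) ∅
  | hd_release_now (α β) : PrevPushShift M B u → Expands M B u (.hrelease .down α β) {α, β}
  | hd_release_next (α β) : PrevPushShift M B u → Expands M B u (.hrelease .down α β)
      {β, .whnext .down (.hrelease .down α β)}

/-- No expansion rule applies to `u`. -/
def Saturated (M : OPM S) (B : TabBranch S AP) (u : TabNode S AP) : Prop :=
  ∀ ψ ∈ u.label, ∀ Δ, ¬ Expands M B u ψ Δ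

/-- `B k` is a step node. -/
def IsStep (M : OPM S) (B : TabBranch S AP) (k : ℕ) : Prop :=
  (B k).waiting = false ∧ Saturated M B (B k) ∧ (B k).syms.Nonempty

/-- The step node `B i`, which contains the chain next formula `cnext t α`, fulfils it on the branch
`B 0, …, B m`: there is a pop node `B p` whose context is `B i`, and `α` appears at the closest
push or shift node `B q` after it. -/
def Fulfilled (M : OPM S) (B : TabBranch S AP) (m : ℕ) (t : Dir) (α : Formula S AP) (i : ℕ) :
    Prop :=
  ∃ p q, i < p ∧ p < q ∧ q ≤ m ∧
    IsStep M B p ∧ (B p).HasType M .takes ∧ (B p).ctx = some i ∧ DirRelAt M B (some i) t (B p) ∧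
    IsStep M B q ∧ (B q).IsPushShift M ∧
    (∀ l, p < l → l < q → IsStep M B l → ¬ (B l).IsPushShift M) ∧ α ∈ Appearing B q

/-- The step node `B i` is pending, as seen from its descendant `B k`. -/
def PendingAt (M : OPM S) (B : TabBranch S AP) (k i : ℕ) : Prop :=
  IsStep M B i ∧
    (((B i).HasType M .yields ∧
        ¬ ∃ p < k, IsStep M B p ∧ (B p).HasType M .takes ∧ (B p).stack = some i) ∨
      ((B i).HasType M .equal ∧
        ¬ ∃ p < k, IsStep M B p ∧ (B p).HasType M .takes ∧ (B p).stack = (B i).stack))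

/-- The whole label `Γ`, including `#`. -/
def TabNode.fullLabel (u : TabNode S AP) : Set (Formula S AP) × Bool := (u.label, u.hash)

/-- Equivalence of two nodes of a branch. -/
def EquivNodes (B : TabBranch S AP) (i k : ℕ) : Prop :=
  (B i).fullLabel = (B k).fullLabel ∧ (B i).smb = (B k).smb ∧
    (B i).stack.map (fun j => (B j).fullLabel) = (B k).stack.map (fun j => (B j).fullLabel) ∧
    (B i).ctx.map (fun j => (B j).fullLabel) = (B k).ctx.map (fun j => (B j).fullLabel)

/-- Rejecting rules, for the step node `B k` of the branch `B 0, …, B m`. In each of them `s` is the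
closest step ancestor of `B k`. -/
inductive Rejected (M : OPM S) (B : TabBranch S AP) (m k : ℕ) : Prop
  /- contradictory literals -/
  | contradiction (ψ) : ψ ∈ (B k).label → .neg ψ ∈ (B k).label → Rejected M B m k
  /- two structural symbols -/
  | conflict (a b : S) : a ≠ b → .struct a ∈ (B k).label → .struct b ∈ (B k).label →
      Rejected M B m k
  /- strong formulas at the end of the word -/
  | end_struct (a) : (B k).hash = true → .struct a ∈ (B k).label → Rejected M B m k
  | end_prop (p) : (B k).hash = true → .prop p ∈ (B k).label → Rejected M B m k
  | end_next (t α) : (B k).hash = true → .next t α ∈ (B k).label → Rejected M B m k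
  | end_hd_until (α β) : (B k).hash = true → .huntil .down α β ∈ Appearing B k →
      Rejected M B m k
  /- next -/
  | next_down (s α) : (B k).prev = some s → (B s).IsPushShift M →
      RelAt M B (some s) .takes (B k) → .next .down α ∈ (B s).label → Rejected M B m k
  | next_up (s α) : (B k).prev = some s → (B s).IsPushShift M →
      RelAt M B (some s) .yields (B k) → .next .up α ∈ (B s).label → Rejected M B m k
  /- weak next -/
  | wnext (s t α) : (B k).prev = some s → (B s).IsPushShift M →
      DirRelAt M B (some s) t (B k) → .wnext t α ∈ (B s).label → α ∉ Appearing B k →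
      Rejected M B m k
  /- chain next -/
  | cnext (i t α) : (B k).HasType M .takes → i < k → IsStep M B i →
      ((B k).stack = some i ∨ ((B i).HasType M .equal ∧ (B i).stack = (B k).stack)) →
      .cnext t α ∈ (B i).label → ¬ Fulfilled M B m t α i → Rejected M B m k
  /- weak chain next -/
  | wcnext_push (s α) : (B k).HasType M .yields → (B k).prev = some s → (B s).HasType M .takes →
      .wcnext .down α ∈ labelAt B (B s).ctx → α ∉ Appearing B k → Rejected M B m k
  | wcnext_shift (s t α) : (B k).HasType M .equal → (B k).prev = some s →
      (B s).HasType M .takes →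
      .wcnext t α ∈ labelAt B (B s).ctx → α ∉ Appearing B k → Rejected M B m k
  | wcnext_pop (s α) : (B k).HasType M .takes → (B k).prev = some s → (B s).HasType M .takes →
      .wcnext .up α ∈ labelAt B (B s).ctx → α ∉ Appearing B k → Rejected M B m k
  /- upward hierarchical next -/
  | hu_next_pop (α) : (B k).HasType M .takes → .hnext .up α ∈ labelAt B (B k).stack →
      ¬ RelAt M B (B k).ctx .yields (B k) → Rejected M B m k
  | hu_next_push (s α) : (B k).HasType M .yields → (B k).prev = some s →
      (B s).HasType M .takes → .hnext .up α ∈ labelAt B (B s).stack → α ∉ Appearing B k →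
      Rejected M B m k
  | hu_next_adj (α) : (B k).HasType M .yields → PrevPushShift M B (B k) →
      .hnext .up α ∈ (B k).label → Rejected M B m k
  | hu_next_shift (α) : (B k).HasType M .equal → .hnext .up α ∈ (B k).label → Rejected M B m k
  /- weak upward hierarchical next -/
  | hu_wnext (s v α) : (B k).HasType M .yields → (B k).prev = some s → (B s).HasType M .takes →
      (B s).stack = some v → (B v).HasType M .yields → PrevPop M B (B v) →
      .whnext .up α ∈ (B v).label → α ∉ Appearing B k → Rejected M B m k
  /- downward hierarchical next -/
  | hd_next_equal (v x α) : (B k).HasType M .takes → .hnext .down α ∈ labelAt B (B k).ctx →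
      (B k).stack = some v → (B k).syms = {x} → M.rel (B v).smb x = some .equal →
      Rejected M B m k
  | hd_next_first (α) : (B k).HasType M .takes → PrevPushShift M B (B k) →
      .hnext .down α ∈ labelAt B (B k).ctx → Rejected M B m k
  | hd_next_pop (s α) : (B k).HasType M .takes → (B k).prev = some s → (B s).HasType M .takes →
      .hnext .down α ∈ labelAt B (B k).ctx → α ∉ AppearingAt B (B s).ctx → Rejected M B m k
  | hd_next_adj (s α) : (B k).HasType M .takes ∨ (B k).HasType M .equal →
      (B k).prev = some s → (B s).IsPushShift M → .hnext .down α ∈ (B s).label →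
      Rejected M B m k
  /- weak downward hierarchical next -/
  | hd_wnext (s v x α) : (B k).HasType M .takes → (B k).prev = some s → (B s).HasType M .takes →
      .whnext .down α ∈ labelAt B (B k).ctx →
      (B k).stack = some v → (B k).syms = {x} → M.rel (B v).smb x = some .takes →
      α ∉ AppearingAt B (B s).ctx → Rejected M B m k
  /- downward hierarchical until and release -/
  | hd_until_adj (s α β) : (B k).HasType M .takes ∨ (B k).HasType M .equal →
      (B k).prev = some s → (B s).IsPushShift M → .huntil .down α β ∈ Appearing B s →
      Rejected M B m k
  | hd_until_chain (s α β) : (B k).IsPushShift M → (B k).prev = some s →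
      (B s).HasType M .takes → .huntil .down α β ∈ AppearingAt B (B s).ctx → Rejected M B m k
  | hd_release (s α β) : (B k).HasType M .takes → (B k).prev = some s → (B s).HasType M .takes →
      .hrelease .down α β ∈ AppearingAt B (B s).ctx →
      ¬ (β ∈ AppearingAt B (B s).ctx ∧
        .whnext .down (.hrelease .down α β) ∈ AppearingAt B (B s).ctx) →
      ¬ (α ∈ AppearingAt B (B s).ctx ∧ β ∈ AppearingAt B (B s).ctx) → Rejected M B m k
  /- pruning of repetitions -/
  | prune (i) : (B k).IsPushShift M → i < k → PendingAt M B k i → EquivNodes B i k →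
      Rejected M B m k

/-- The accepting rule: `Γ(u) = {#}` and `stack(u) = ⊥`. -/
def Accepting (M : OPM S) (B : TabBranch S AP) (k : ℕ) : Prop :=
  IsStep M B k ∧ (B k).label = ∅ ∧ (B k).hash = true ∧ (B k).stack = none

/-- The arguments of the strong next operators in the label of `u`. -/
def nextArgs (u : TabNode S AP) : Set (Formula S AP) := {α | ∃ t, .next t α ∈ u.label}

/-- The formulas that may be guessed after the step node `u`. -/
def guessArgs (M : OPM S) (B : TabBranch S AP) (u : TabNode S AP) : Set (Formula S AP) :=
  {α | (u.IsPushShift M ∧ ((∃ t, .wnext t α ∈ u.label) ∨ .hnext .down α ∈ u.label ∨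
          .whnext .down α ∈ u.label)) ∨
       (u.HasType M .takes ∧
          ((∃ t, .cnext t α ∈ labelAt B u.ctx ∨ .wcnext t α ∈ labelAt B u.ctx) ∨
            .hnext .down α ∈ labelAt B u.ctx ∨ .whnext .down α ∈ labelAt B u.ctx ∨
            .whnext .up α ∈ labelAt B u.stack ∨ .hnext .up α ∈ labelAt B u.stack))}

/-- The tableau rules that add children: `Child M B k v` if `v` is a possible child of `B k`. -/
inductive Child (M : OPM S) (B : TabBranch S AP) (k : ℕ) : TabNode S AP → Prop
  /- expansion rules -/
  | expand (ψ Δ) : (B k).waiting = false → ψ ∈ (B k).label → Expands M B (B k) ψ Δ →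
      Child M B k { B k with label := ((B k).label \ {ψ}) ∪ Δ }
  /- choice of the symbol of the position -/
  | add_struct (a : S) : (B k).waiting = false → Saturated M B (B k) → (B k).syms = ∅ →
      Child M B k { B k with label := (B k).label ∪ {.struct a} }
  | add_hash : (B k).waiting = false → Saturated M B (B k) → (B k).syms = ∅ →
      Child M B k { B k with hash := true }
  /- step rules -/
  | push_adj (x) : IsStep M B k → (B k).HasType M .yields → (B k).syms = {x} →
      PrevPushShift M B (B k) →
      Child M B k
        { label := nextArgs (B k), hash := false, smb := x, stack := some k,
          ctx := if (B k).stack = none then none else (B k).prev,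
          prev := some k, waiting := true, pos := (B k).pos + 1 }
  | push_pop (x s) : IsStep M B k → (B k).HasType M .yields → (B k).syms = {x} →
      (B k).prev = some s → (B s).HasType M .takes →
      Child M B k
        { label := nextArgs (B k), hash := false, smb := x, stack := some k,
          ctx := if (B k).stack = none then none else (B s).ctx,
          prev := some k, waiting := true, pos := (B k).pos + 1 }
  /- the last clause excludes steps beyond the final `#`: no shift is performed when the stack
     is empty -/
  | shift (x) : IsStep M B k → (B k).HasType M .equal → (B k).syms = {x} → (B k).stack ≠ none →
      Child M B k
        { label := nextArgs (B k), hash := false, smb := x, stack := (B k).stack,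
          ctx := (B k).ctx, prev := some k, waiting := true, pos := (B k).pos + 1 }
  | pop (v) : IsStep M B k → (B k).HasType M .takes → (B k).stack = some v →
      Child M B k
        { label := (B k).label, hash := (B k).hash, smb := (B v).smb, stack := (B v).stack,
          ctx := (B v).ctx, prev := some k, waiting := (B k).ctx.isSome, pos := (B k).pos }
  /- guess rules -/
  | guess (s G) : (B k).waiting = true → (B k).prev = some s → G ⊆ guessArgs M B (B s) →
      Child M B k { B k with label := (B k).label ∪ G, waiting := false }

/-- The root of the tableau for `φ`. -/
def rootNode (φ : Formula S AP) : TabNode S AP :=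
  { label := {φ.nnf}, hash := false, smb := none, stack := none, ctx := none, prev := none,
    waiting := false, pos := 1 }

/-- `B 0, …, B m` is an accepted branch of the tableau for `φ`: it starts in the root, each node is
a child of the previous one by one of the rules, no step node is rejected, and the leaf `B m` is
accepted. -/
structure IsAcceptedBranch (M : OPM S) (φ : Formula S AP) (B : TabBranch S AP) (m : ℕ) : Prop where
  root : B 0 = rootNode φ
  child : ∀ k < m, Child M B k (B (k + 1))
  not_rejected : ∀ k ≤ m, IsStep M B k → ¬ Rejected M B m k
  accepting : Accepting M B m

/-- The tableau for `φ` has an accepted branch. -/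
def HasAcceptedBranch (M : OPM S) (φ : Formula S AP) : Prop :=
  ∃ B m, IsAcceptedBranch M φ B m

end

/-! # Soundness of the tableau for POTL_f

An accepted branch simulates an operator precedence automaton that reads a word: every push or
shift node reads one position, and pop nodes close chains. The word `w` consists of the symbols and
propositions in the labels of the read nodes (`IsWordOf`), and `branchLabelling` assigns to each
position all formulas that appear in the labels of its nodes. These formulas are true there, and
the root puts the negation normal form of the given formula into the label of position `1`.

The proof separates the tableau from the logic.

*Chains.* `conf` is the stack of the simulated automaton, which determines the pointers and the type
of every node (`IsAcceptedBranch.nodeInv`, `IsWordOf.hasType_iff`). Stack entries are unfinished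
chains, so that every pop closes a chain of `w` (`IsWordOf.chi_of_takes`); as the type of a step is
determined by the precedence relation, every chain of `w` is conversely closed by a pop
(`Chi.exists_closes`). Since an entry lives on the stack exactly from its push to its pop
(`IsAcceptedBranch.exists_mem_conf`, `IsAcceptedBranch.not_mem_conf`), chains do not cross, and of
the chains with a common left (right) context all but the longest have the relation `⋖` (`⋗`)
between their contexts (`IsWordOf.wellNested`).

*Local consistency.* As no node of the branch is rejected, each next-like formula at a position
hands its argument over to the positions required by the semantics, and each until or release has
been expanded (`IsWordOf.hintikka`). For the downward hierarchical operators the decisive step is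
the last one at which a position is on top of the stack (`IsWordOf.exists_last_visit`): it shows
whether the position takes precedence on the right context of its longest chain.

*Truth.* In a well-nested word every such Hintikka labelling is truthful (`Hintikka.sat`), by
induction on the formula and, for until and release, backwards on the position. For the summary until
a step to the next position, or along a chain that is not the longest, is not itself a step of the
summary path; but as chains do not cross, the remaining path meets the end of the longer chain and
can be shortened (`IsSummaryPath.exists_cons`). -/

/-! ### Negation normal form -/

section
variable {S AP : Type*}

/-- Negation occurs only in front of atomic propositions. -/
def Formula.IsNNF : Formula S AP → Prop
  | .struct _ => True
  | .prop _ => True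
  | .neg φ => (∃ a, φ = .struct a) ∨ ∃ p, φ = .prop p
  | .and φ ψ => φ.IsNNF ∧ ψ.IsNNF
  | .or φ ψ => φ.IsNNF ∧ ψ.IsNNF
  | .next _ φ => φ.IsNNF
  | .wnext _ φ => φ.IsNNF
  | .cnext _ φ => φ.IsNNF
  | .wcnext _ φ => φ.IsNNF
  | .cuntil _ φ ψ => φ.IsNNF ∧ ψ.IsNNF
  | .crelease _ φ ψ => φ.IsNNF ∧ ψ.IsNNF
  | .hnext _ φ => φ.IsNNF
  | .whnext _ φ => φ.IsNNF
  | .huntil _ φ ψ => φ.IsNNF ∧ ψ.IsNNF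
  | .hrelease _ φ ψ => φ.IsNNF ∧ ψ.IsNNF

theorem Formula.isNNF_nnfAux (φ : Formula S AP) : ∀ b, (nnfAux b φ).IsNNF := by
  induction φ <;> intro b <;> cases b <;> simp_all [nnfAux, IsNNF]

theorem Formula.isNNF_nnf (φ : Formula S AP) : φ.nnf.IsNNF := φ.isNNF_nnfAux true

/-! ### Paths -/

theorem bounds_of_isChain {R : ℕ → ℕ → Prop} (hR : ∀ a b, R a b → a < b) {l : List ℕ} {i j : ℕ}
    (hi : l.head? = some i) (hj : l.getLast? = some j) (hl : l.IsChain R) :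
    ∀ k ∈ l, i ≤ k ∧ k ≤ j := by
  induction l generalizing i with
  | nil => simp at hi
  | cons a r ih =>
    simp only [List.head?_cons, Option.some.injEq] at hi
    subst hi
    cases r with
    | nil => simp_all
    | cons b r =>
      rw [List.isChain_cons_cons] at hl
      have hb := ih (i := b) rfl (by simpa using hj) hl.2
      have hab := hR _ _ hl.1
      intro k hk
      rcases List.mem_cons.1 hk with rfl | hk
      · exact ⟨le_rfl, hab.le.trans (hb b (by simp)).2⟩
      · have := hb k hk
        omega

variable {M : OPM S} {w : OPWord S AP}

theorem ChainPart.lt {b : Bool} {i j : ℕ} (h : ChainPart M w b i j) : i < j := by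
  induction h <;> omega

theorem Chi.lt {i j : ℕ} (h : Chi M w i j) : i < j := h.2.lt

theorem SummaryNext.lt {t : Dir} {j a b : ℕ} (h : SummaryNext M w t j a b) : a < b := by
  rcases h with h | h
  · exact h.1.2.1.lt
  · omega

theorem IsSummaryPath.bounds {t : Dir} {i j : ℕ} {l : List ℕ} (h : IsSummaryPath M w t i j l) :
    ∀ k ∈ l, i ≤ k ∧ k ≤ j :=
  bounds_of_isChain (fun _ _ => SummaryNext.lt) h.2.1 h.2.2.1 h.2.2.2

theorem IsHierPath.bounds {t : Dir} {i j : ℕ} {l : List ℕ} (h : IsHierPath M w t i j l) :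
    ∀ k ∈ l, i ≤ k ∧ k ≤ j := by
  obtain ⟨-, hi, hj, h⟩ := h
  cases t with
  | down =>
    obtain ⟨x, -, -, h⟩ := h
    exact bounds_of_isChain (fun _ _ hab => hab.1) hi hj h
  | up =>
    obtain ⟨x, -, -, h⟩ := h
    exact bounds_of_isChain (fun _ _ hab => hab.1) hi hj h

theorem IsSummaryPath.cons {t : Dir} {i b j : ℕ} {l : List ℕ} (h : IsSummaryPath M w t b j l)
    (hi : SummaryNext M w t j i b) : IsSummaryPath M w t i j (i :: l) := by
  obtain ⟨hj, h1, h2, h3⟩ := h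
  cases l with
  | nil => simp at h1
  | cons c r =>
    simp only [List.head?_cons, Option.some.injEq] at h1
    subst h1
    exact ⟨hj, rfl, by simpa using h2, by simpa using ⟨hi, h3⟩⟩

theorem IsSummaryPath.singleton {t : Dir} {i : ℕ} (h : i ≤ w.last) :
    IsSummaryPath M w t i i [i] := ⟨h, rfl, rfl, by simp⟩

/-- A path either is trivial or continues after its first position. -/
theorem IsSummaryPath.cases {t : Dir} {i j : ℕ} {l : List ℕ} (h : IsSummaryPath M w t i j l) :
    l = [i] ∨ ∃ b r, l = i :: r ∧ SummaryNext M w t j i b ∧ IsSummaryPath M w t b j r := by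
  obtain ⟨hj, h1, h2, h3⟩ := h
  match l with
  | [] => simp at h1
  | [a] => simp_all
  | a :: b :: r =>
    simp only [List.head?_cons, Option.some.injEq] at h1
    subst h1
    rw [List.isChain_cons_cons] at h3
    exact .inr ⟨b, b :: r, rfl, h3.1, hj, rfl, by simpa using h2, h3.2⟩

theorem isHierPath_up_cons {i b j h : ℕ} {l : List ℕ} (hj : j ≤ w.last) (hhj : h < j)
    (h1 : l.head? = some b) (h2 : l.getLast? = some j)
    (hl : ∀ p ∈ l, Chi M w h p ∧ w.rel M h p = some .yields)
    (hc : l.IsChain (fun a b => a < b ∧ ∀ k, a < k → k < b → ¬ Chi M w h k))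
    (hi : Chi M w h i ∧ w.rel M h i = some .yields) (hib : i < b)
    (hk : ∀ k, i < k → k < b → ¬ Chi M w h k) : IsHierPath M w .up i j (i :: l) := by
  cases l with
  | nil => simp at h1
  | cons c r =>
    simp only [List.head?_cons, Option.some.injEq] at h1
    subst h1
    exact ⟨hj, rfl, by simpa using h2, h, hhj, by simpa [hi] using hl, by simpa using ⟨⟨hib, hk⟩, hc⟩⟩

theorem isHierPath_down_cons {i b j h : ℕ} {l : List ℕ} (hj : j ≤ w.last) (hhj : j < h)
    (h1 : l.head? = some b) (h2 : l.getLast? = some j)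
    (hl : ∀ p ∈ l, Chi M w p h ∧ w.rel M p h = some .takes)
    (hc : l.IsChain (fun a b => a < b ∧ ∀ k, a < k → k < b → ¬ Chi M w k h))
    (hi : Chi M w i h ∧ w.rel M i h = some .takes) (hib : i < b)
    (hk : ∀ k, i < k → k < b → ¬ Chi M w k h) : IsHierPath M w .down i j (i :: l) := by
  cases l with
  | nil => simp at h1
  | cons c r =>
    simp only [List.head?_cons, Option.some.injEq] at h1
    subst h1
    exact ⟨hj, rfl, by simpa using h2, h, hhj, by simpa [hi] using hl, by simpa using ⟨⟨hib, hk⟩, hc⟩⟩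

/-- A hierarchical path either is trivial or goes on to the hierarchical successor. -/
theorem IsHierPath.cases {t : Dir} {i j : ℕ} {l : List ℕ} (h : IsHierPath M w t i j l) :
    l = [i] ∨ ∃ b r, l = i :: r ∧ HierNext M w t i b ∧ IsHierPath M w t b j r := by
  have hb := h.bounds
  obtain ⟨hj, h1, h2, h3⟩ := h
  match l with
  | [] => simp at h1
  | [a] => simp_all
  | a :: b :: r =>
    simp only [List.head?_cons, Option.some.injEq] at h1
    subst h1
    refine .inr ⟨b, b :: r, rfl, ?_⟩
    cases t with
    | down =>
      obtain ⟨h, hjh, hl, hc⟩ := h3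
      rw [List.isChain_cons_cons] at hc
      refine ⟨⟨h, (hl a (by simp)).1.lt, (hl a (by simp)).1, (hl a (by simp)).2,
        ⟨hc.1.1, hl b (by simp)⟩, fun k hk => ?_⟩, hj, rfl, by simpa using h2, h, hjh,
        fun p hp => hl p (by simp_all), hc.2⟩
      by_contra hlt
      exact hc.1.2 k hk.1 (by omega) hk.2.1
    | up =>
      obtain ⟨h, hjh, hl, hc⟩ := h3
      rw [List.isChain_cons_cons] at hc
      refine ⟨⟨h, (hl a (by simp)).1.lt, (hl a (by simp)).1, (hl a (by simp)).2,
        ⟨hc.1.1, hl b (by simp)⟩, fun k hk => ?_⟩, hj, rfl, by simpa using h2, h, hjh,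
        fun p hp => hl p (by simp_all), hc.2⟩
      by_contra hlt
      exact hc.1.2 k hk.1 (by omega) hk.2.1

/-- The truth of an until along a path contradicts the release of the negated arguments. -/
theorem until_release_absurd {l : List ℕ} {j : ℕ} {P Q : ℕ → Prop} (hj : j ∈ l)
    (hle : ∀ k ∈ l, k ≤ j) (hQ : Q j) (hP : ∀ k ∈ l, k < j → P k)
    (h : (∀ k ∈ l, ¬ Q k) ∨ ∃ k ∈ l, ¬ P k ∧ ∀ k' ∈ l, k' ≤ k → ¬ Q k') : False := by
  rcases h with h | ⟨k, hk, hPk, h⟩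
  · exact h j hj hQ
  · rcases (hle k hk).lt_or_eq with hlt | rfl
    · exact hPk (hP k hk hlt)
    · exact h k hk le_rfl hQ

/-- Only this direction is needed: a formula follows from its negation normal form. As both the
formula and its negation are treated at once, the induction uses that the operators are monotone
and that a modality contradicts the dual modality of the negated argument. -/
theorem sat_of_nnfAux (φ : Formula S AP) : ∀ i,
    (Sat M w i (φ.nnfAux true) → Sat M w i φ) ∧ (Sat M w i (φ.nnfAux false) → ¬ Sat M w i φ) := by
  induction φ with
  | struct a => intro i; simp [Formula.nnfAux, Sat]
  | prop p => intro i; simp [Formula.nnfAux, Sat]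
  | neg φ ih =>
    intro i
    have := ih i
    simp only [Formula.nnfAux, Sat, not_not]
    tauto
  | and φ ψ ih1 ih2 =>
    intro i
    have := ih1 i
    have := ih2 i
    simp only [Formula.nnfAux, Sat]
    tauto
  | or φ ψ ih1 ih2 =>
    intro i
    have := ih1 i
    have := ih2 i
    simp only [Formula.nnfAux, Sat]
    tauto
  | next t φ ih =>
    intro i
    have := ih (i + 1)
    simp only [Formula.nnfAux, Sat]
    tauto
  | wnext t φ ih =>
    intro i
    have := ih (i + 1)
    simp only [Formula.nnfAux, Sat]
    tauto
  | cnext t φ ih =>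
    intro i
    simp only [Formula.nnfAux, Sat]
    exact ⟨fun ⟨j, h1, h2, h3, h4⟩ => ⟨j, h1, h2, h3, (ih j).1 h4⟩,
      fun h ⟨j, h1, h2, h3, h4⟩ => (ih j).2 (h j h1 h2 h3) h4⟩
  | wcnext t φ ih =>
    intro i
    simp only [Formula.nnfAux, Sat]
    exact ⟨fun h j h1 h2 h3 => (ih j).1 (h j h1 h2 h3),
      fun ⟨j, h1, h2, h3, h4⟩ h => (ih j).2 h4 (h j h1 h2 h3)⟩
  | hnext t φ ih =>
    intro i
    simp only [Formula.nnfAux, Sat]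
    exact ⟨fun ⟨j, h1, h4⟩ => ⟨j, h1, (ih j).1 h4⟩,
      fun h ⟨j, h1, h4⟩ => (ih j).2 (h j h1) h4⟩
  | whnext t φ ih =>
    intro i
    simp only [Formula.nnfAux, Sat]
    exact ⟨fun h j h1 => (ih j).1 (h j h1), fun ⟨j, h1, h4⟩ h => (ih j).2 h4 (h j h1)⟩
  | cuntil t φ ψ ih1 ih2 =>
    intro i
    simp only [Formula.nnfAux, Sat]
    refine ⟨fun ⟨j, l, h1, h2, h3⟩ =>
      ⟨j, l, h1, (ih2 j).1 h2, fun k hk hkj => (ih1 k).1 (h3 k hk hkj)⟩, ?_⟩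
    rintro h ⟨j, l, h1, h2, h3⟩
    refine until_release_absurd (List.mem_of_getLast? h1.2.2.1) (fun k hk => (h1.bounds k hk).2)
      h2 h3 ((h j l h1).imp (fun h k hk => (ih2 k).2 (h k hk)) ?_)
    rintro ⟨k, hk, hk1, hk2⟩
    exact ⟨k, hk, (ih1 k).2 hk1, fun k' h' h'' => (ih2 k').2 (hk2 k' h' h'')⟩
  | crelease t φ ψ ih1 ih2 =>
    intro i
    simp only [Formula.nnfAux, Sat]
    refine ⟨fun h j l h1 => (h j l h1).imp (fun h k hk => (ih2 k).1 (h k hk))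
      fun ⟨k, hk, hk1, hk2⟩ => ⟨k, hk, (ih1 k).1 hk1, fun k' h' h'' => (ih2 k').1 (hk2 k' h' h'')⟩, ?_⟩
    rintro ⟨j, l, h1, h2, h3⟩ h
    refine until_release_absurd (P := fun k => ¬ Sat M w k φ) (Q := fun k => ¬ Sat M w k ψ)
      (List.mem_of_getLast? h1.2.2.1) (fun k hk => (h1.bounds k hk).2)
      ((ih2 j).2 h2) (fun k hk hkj => (ih1 k).2 (h3 k hk hkj)) ?_
    simpa only [not_not] using h j l h1
  | huntil t φ ψ ih1 ih2 =>
    intro i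
    simp only [Formula.nnfAux, Sat]
    refine ⟨fun ⟨j, l, h1, h2, h3⟩ =>
      ⟨j, l, h1, (ih2 j).1 h2, fun k hk hkj => (ih1 k).1 (h3 k hk hkj)⟩, ?_⟩
    rintro h ⟨j, l, h1, h2, h3⟩
    refine until_release_absurd (List.mem_of_getLast? h1.2.2.1) (fun k hk => (h1.bounds k hk).2)
      h2 h3 ((h j l h1).imp (fun h k hk => (ih2 k).2 (h k hk)) ?_)
    rintro ⟨k, hk, hk1, hk2⟩
    exact ⟨k, hk, (ih1 k).2 hk1, fun k' h' h'' => (ih2 k').2 (hk2 k' h' h'')⟩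
  | hrelease t φ ψ ih1 ih2 =>
    intro i
    simp only [Formula.nnfAux, Sat]
    refine ⟨fun h j l h1 => (h j l h1).imp (fun h k hk => (ih2 k).1 (h k hk))
      fun ⟨k, hk, hk1, hk2⟩ => ⟨k, hk, (ih1 k).1 hk1, fun k' h' h'' => (ih2 k').1 (hk2 k' h' h'')⟩, ?_⟩
    rintro ⟨j, l, h1, h2, h3⟩ h
    refine until_release_absurd (P := fun k => ¬ Sat M w k φ) (Q := fun k => ¬ Sat M w k ψ)
      (List.mem_of_getLast? h1.2.2.1) (fun k hk => (h1.bounds k hk).2)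
      ((ih2 j).2 h2) (fun k hk hkj => (ih1 k).2 (h3 k hk hkj)) ?_
    simpa only [not_not] using h j l h1

/-! ### Hintikka labellings of a word -/

/-- Chains of `# w #` do not cross, and precedence along chains with a common context is as in an
operator precedence word: a left context yields to the right contexts of all its chains but the
last, and the left contexts of all chains with a given right context but the outermost take
precedence on it. -/
structure WellNested (M : OPM S) (w : OPWord S AP) : Prop where
  no_crossing {p a h h' : ℕ} : Chi M w p h → p < a → a < h → Chi M w a h' → h' ≤ h
  yields_of_lt {h k j : ℕ} : Chi M w h k → Chi M w h j → k < j → w.rel M h k = some .yields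
  takes_of_lt {p k h : ℕ} : Chi M w p h → Chi M w k h → p < k → w.rel M k h = some .takes

/-- An assignment of sets of formulas to the positions of `# w #` in which every formula is backed by
simpler formulas, or by the same formula at later positions. In such an assignment every formula in
negation normal form is true where it occurs. -/
structure Hintikka (M : OPM S) (w : OPWord S AP) (App : ℕ → Set (Formula S AP)) : Prop where
  le_last {p ψ} : ψ ∈ App p → p ≤ w.last
  struct {p a} : .struct a ∈ App p → w.sym p = some a
  prop {p q} : .prop q ∈ App p → ∃ c, w.letter p = some c ∧ q ∈ c.2
  neg_struct {p a} : .neg (.struct a) ∈ App p → w.sym p ≠ some a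
  neg_prop {p q} : .neg (.prop q) ∈ App p → ¬ ∃ c, w.letter p = some c ∧ q ∈ c.2
  and {p α β} : .and α β ∈ App p → α ∈ App p ∧ β ∈ App p
  or {p α β} : .or α β ∈ App p → α ∈ App p ∨ β ∈ App p
  next {p t α} : .next t α ∈ App p →
    p < w.last ∧ t.Allows (w.rel M p (p + 1)) ∧ α ∈ App (p + 1)
  wnext {p t α} : .wnext t α ∈ App p → p < w.last → t.Allows (w.rel M p (p + 1)) → α ∈ App (p + 1)
  cnext {p t α} : .cnext t α ∈ App p → ∃ j, Chi M w p j ∧ t.Allows (w.rel M p j) ∧ α ∈ App j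
  wcnext {p t α j} : .wcnext t α ∈ App p → Chi M w p j → t.Allows (w.rel M p j) → α ∈ App j
  hnext {p t α} : .hnext t α ∈ App p → ∃ j, HierNext M w t p j ∧ α ∈ App j
  whnext {p t α j} : .whnext t α ∈ App p → HierNext M w t p j → α ∈ App j
  cuntil {p t α β} : .cuntil t α β ∈ App p → β ∈ App p ∨
    (α ∈ App p ∧ .next t (.cuntil t α β) ∈ App p) ∨ (α ∈ App p ∧ .cnext t (.cuntil t α β) ∈ App p)
  crelease {p t α β} : .crelease t α β ∈ App p → (α ∈ App p ∧ β ∈ App p) ∨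
    (β ∈ App p ∧ .wnext t (.crelease t α β) ∈ App p ∧ .wcnext t (.crelease t α β) ∈ App p)
  huntil_up {p α β} : .huntil .up α β ∈ App p →
    (α ∈ App p ∧ .hnext .up (.huntil .up α β) ∈ App p) ∨
      (β ∈ App p ∧ ∃ h, Chi M w h p ∧ w.rel M h p = some .yields)
  huntil_down {p α β} : .huntil .down α β ∈ App p →
    (α ∈ App p ∧ .hnext .down (.huntil .down α β) ∈ App p) ∨
      (β ∈ App p ∧ ∃ h, Chi M w p h ∧ w.rel M p h = some .takes)
  hrelease_up {p α β} : .hrelease .up α β ∈ App p → (α ∈ App p ∧ β ∈ App p) ∨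
    (β ∈ App p ∧ .whnext .up (.hrelease .up α β) ∈ App p)
  hrelease_down {p α β h} : .hrelease .down α β ∈ App p → Chi M w p h →
    w.rel M p h = some .takes → (α ∈ App p ∧ β ∈ App p) ∨
    (β ∈ App p ∧ .whnext .down (.hrelease .down α β) ∈ App p)

/-- A summary path to `j` that starts inside a chain with right context `h ≤ j` passes through `h`,
as chains do not cross. -/
theorem IsSummaryPath.suffix_from (hN : WellNested M w) {t : Dir} {p h j : ℕ} (hph : Chi M w p h)
    (hhj : h ≤ j) {l : List ℕ} : ∀ {a}, IsSummaryPath M w t a j l → p < a → a ≤ h →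
    ∃ l', IsSummaryPath M w t h j l' ∧ ∀ k ∈ l', k ∈ l := by
  induction l with
  | nil => intro a ha; simp [IsSummaryPath] at ha
  | cons c r ih =>
    intro a ha hpa hah
    rcases hah.lt_or_eq with hlt | rfl
    · rcases ha.cases with hl | ⟨b, r', hl, hab, hr⟩
      · have := ha.2.2.1
        rw [hl] at this
        simp at this
        omega
      · obtain ⟨rfl, rfl⟩ := List.cons.inj hl
        have hbh : b ≤ h := by
          rcases hab with hb | hb
          · exact hN.no_crossing hph hpa hlt hb.1.2.1
          · omega
        obtain ⟨l', h1, h2⟩ := ih hr (hpa.trans hab.lt) hbh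
        exact ⟨l', h1, fun k hk => List.mem_cons_of_mem _ (h2 k hk)⟩
    · exact ⟨_, ha, fun k hk => hk⟩

/-- Prolongation of a summary path to the left, by an adjacent position or by a chain. If position
`p` is the left context of a longer chain, then the new path takes that chain and omits a part of
the old path. -/
theorem IsSummaryPath.exists_cons (hN : WellNested M w) {t : Dir} {p b j : ℕ} {l : List ℕ}
    (h : IsSummaryPath M w t b j l)
    (hb : (Chi M w p b ∧ t.Allows (w.rel M p b)) ∨ (b = p + 1 ∧ t.Allows (w.rel M p (p + 1)))) :
    ∃ l', IsSummaryPath M w t p j (p :: l') ∧ ∀ k ∈ l', k ∈ l := by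
  have hbj : b ≤ j := (h.bounds b (List.mem_of_head? h.2.1)).2
  have hpb : p < b := by
    rcases hb with hb | hb
    · exact hb.1.lt
    · omega
  set X := {h | h ≤ j ∧ Chi M w p h ∧ t.Allows (w.rel M p h)} with hX
  rcases X.eq_empty_or_nonempty with hE | hne
  · rcases hb with hb | ⟨rfl, hb⟩
    · exact absurd (show b ∈ X from ⟨hbj, hb⟩) (by simp [hE])
    · exact ⟨l, h.cons (.inr ⟨hE, rfl, hb⟩), fun k hk => hk⟩
  · have hbdd : BddAbove X := ⟨j, fun x hx => hx.1⟩
    have hmem : sSup X ∈ X := Nat.sSup_mem hne hbdd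
    have hgr : IsGreatest X (sSup X) := ⟨hmem, fun x hx => le_csSup hbdd hx⟩
    have hble : b ≤ sSup X := by
      rcases hb with hb | ⟨rfl, hb⟩
      · exact hgr.2 ⟨hbj, hb⟩
      · exact hmem.2.1.lt
    obtain ⟨l', h1, h2⟩ := h.suffix_from hN hmem.2.1 hmem.1 hpb hble
    exact ⟨l', h1.cons (.inl hgr), h2⟩

theorem WellNested.left_unique (hN : WellNested M w) {h h' p : ℕ} (h1 : Chi M w h p)
    (h2 : w.rel M h p = some .yields) (h1' : Chi M w h' p) (h2' : w.rel M h' p = some .yields) :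
    h = h' := by
  rcases lt_trichotomy h h' with hlt | rfl | hlt
  · rw [hN.takes_of_lt h1 h1' hlt] at h2'; simp at h2'
  · rfl
  · rw [hN.takes_of_lt h1' h1 hlt] at h2; simp at h2

theorem WellNested.right_unique (hN : WellNested M w) {h h' p : ℕ} (h1 : Chi M w p h)
    (h2 : w.rel M p h = some .takes) (h1' : Chi M w p h') (h2' : w.rel M p h' = some .takes) :
    h = h' := by
  rcases lt_trichotomy h h' with hlt | rfl | hlt
  · rw [hN.yields_of_lt h1 h1' hlt] at h2; simp at h2
  · rfl
  · rw [hN.yields_of_lt h1' h1 hlt] at h2'; simp at h2'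

theorem HierNext.lt {t : Dir} {i j : ℕ} (h : HierNext M w t i j) : i < j := by
  cases t <;> obtain ⟨h, -, -, -, h1, -⟩ := h <;> exact h1.1

/-- Prolongation of a hierarchical path to the left by a hierarchical successor step. -/
theorem IsHierPath.cons (hN : WellNested M w) {t : Dir} {p b j : ℕ} {l : List ℕ}
    (h : IsHierPath M w t b j l) (hb : HierNext M w t p b) : IsHierPath M w t p j (p :: l) := by
  obtain ⟨hj, h1, h2, h3⟩ := h
  have hbl : b ∈ l := List.mem_of_head? h1
  cases t with
  | down =>
    obtain ⟨h, hjh, hl, hc⟩ := h3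
    obtain ⟨h', -, hp1, hp2, ⟨hpb, hb1, hb2⟩, hmin⟩ := hb
    obtain rfl := hN.right_unique hb1 hb2 (hl b hbl).1 (hl b hbl).2
    refine isHierPath_down_cons hj hjh h1 h2 hl hc ⟨hp1, hp2⟩ hpb fun k hpk hkb hk => ?_
    exact absurd (hmin ⟨hpk, hk, hN.takes_of_lt hp1 hk hpk⟩) (by omega)
  | up =>
    obtain ⟨h, hjh, hl, hc⟩ := h3
    obtain ⟨h', -, hp1, hp2, ⟨hpb, hb1, hb2⟩, hmin⟩ := hb
    obtain rfl := hN.left_unique hb1 hb2 (hl b hbl).1 (hl b hbl).2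
    refine isHierPath_up_cons hj hjh h1 h2 hl hc ⟨hp1, hp2⟩ hpb fun k hpk hkb hk => ?_
    exact absurd (hmin ⟨hpk, hk, hN.yields_of_lt hk hb1 hkb⟩) (by omega)

/-- The semantic content of a release that is verified at the head of a path or handed over to the
rest of the path. -/
theorem release_cons {p : ℕ} {r : List ℕ} {P Q : ℕ → Prop} (hQ : Q p)
    (h : (∀ k ∈ r, Q k) ∨ ∃ k ∈ r, P k ∧ ∀ k' ∈ r, k' ≤ k → Q k') :
    (∀ k ∈ p :: r, Q k) ∨ ∃ k ∈ p :: r, P k ∧ ∀ k' ∈ p :: r, k' ≤ k → Q k' := by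
  refine h.imp (fun h => by simpa [hQ] using h) ?_
  rintro ⟨k, hk, hP, h⟩
  exact ⟨k, by simp [hk], hP, by simpa [hQ] using h⟩

theorem release_now {p : ℕ} {l : List ℕ} {P Q : ℕ → Prop} (hP : P p) (hQ : Q p)
    (hp : p ∈ l) (hle : ∀ k ∈ l, p ≤ k) :
    (∀ k ∈ l, Q k) ∨ ∃ k ∈ l, P k ∧ ∀ k' ∈ l, k' ≤ k → Q k' :=
  .inr ⟨p, hp, hP, fun k hk hkp => (hkp.antisymm (hle k hk)) ▸ hQ⟩

/-- Induction over positions from the end of the word. -/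
theorem backward_induction {n : ℕ} {P : ℕ → Prop}
    (ih : ∀ p ≤ n, (∀ q ≤ n, p < q → P q) → P p) : ∀ p ≤ n, P p := by
  intro p hp
  induction hd : n - p using Nat.strong_induction_on generalizing p with
  | _ d IH => exact ih p hp fun q hq hpq => IH (n - q) (by omega) q hq rfl

/-- Every formula in negation normal form is true where it occurs. -/
theorem Hintikka.sat {App : ℕ → Set (Formula S AP)} (H : Hintikka M w App) (hN : WellNested M w)
    (ψ : Formula S AP) : ∀ p, ψ.IsNNF → ψ ∈ App p → Sat M w p ψ := by
  induction ψ with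
  | struct a => exact fun p _ h => H.struct h
  | prop q => exact fun p _ h => H.prop h
  | neg φ ih =>
    rintro p (⟨a, rfl⟩ | ⟨q, rfl⟩) h
    · exact H.neg_struct h
    · exact H.neg_prop h
  | and α β ih1 ih2 =>
    exact fun p hn h => ⟨ih1 p hn.1 (H.and h).1, ih2 p hn.2 (H.and h).2⟩
  | or α β ih1 ih2 => exact fun p hn h => (H.or h).imp (ih1 p hn.1) (ih2 p hn.2)
  | next t α ih => exact fun p hn h => ⟨(H.next h).1, (H.next h).2.1, ih _ hn (H.next h).2.2⟩
  | wnext t α ih => exact fun p hn h h1 h2 => ih _ hn (H.wnext h h1 h2)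
  | cnext t α ih =>
    intro p hn h
    obtain ⟨j, h1, h2, h3⟩ := H.cnext h
    exact ⟨j, h1.lt, h1, h2, ih _ hn h3⟩
  | wcnext t α ih => exact fun p hn h j _ h1 h2 => ih _ hn (H.wcnext h h1 h2)
  | hnext t α ih =>
    intro p hn h
    obtain ⟨j, h1, h2⟩ := H.hnext h
    exact ⟨j, h1, ih _ hn h2⟩
  | whnext t α ih => exact fun p hn h j h1 => ih _ hn (H.whnext h h1)
  | cuntil t α β ih1 ih2 =>
    intro p hn h
    refine backward_induction (n := w.last)
      (P := fun p => .cuntil t α β ∈ App p → Sat M w p (.cuntil t α β)) ?_ p (H.le_last h) h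
    intro p hp IH h
    have step : ∀ b, α ∈ App p → .cuntil t α β ∈ App b →
        ((Chi M w p b ∧ t.Allows (w.rel M p b)) ∨ (b = p + 1 ∧ t.Allows (w.rel M p (p + 1)))) →
        Sat M w p (.cuntil t α β) := by
      intro b hα hb hpb
      have hlt : p < b := by
        rcases hpb with hpb | hpb
        · exact hpb.1.lt
        · omega
      obtain ⟨j, l, h1, h2, h3⟩ := IH b (H.le_last hb) hlt hb
      obtain ⟨l', h4, h5⟩ := h1.exists_cons hN hpb
      refine ⟨j, _, h4, h2, fun k hk hkj => ?_⟩
      rcases List.mem_cons.1 hk with rfl | hk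
      · exact ih1 _ hn.1 hα
      · exact h3 k (h5 k hk) hkj
    rcases H.cuntil h with hβ | ⟨hα, h'⟩ | ⟨hα, h'⟩
    · exact ⟨p, [p], .singleton hp, ih2 p hn.2 hβ, by simp⟩
    · exact step (p + 1) hα (H.next h').2.2 (.inr ⟨rfl, (H.next h').2.1⟩)
    · obtain ⟨b, h1, h2, h3⟩ := H.cnext h'
      exact step b hα h3 (.inl ⟨h1, h2⟩)
  | crelease t α β ih1 ih2 =>
    intro p hn h
    refine backward_induction (n := w.last)
      (P := fun p => .crelease t α β ∈ App p → Sat M w p (.crelease t α β)) ?_ p (H.le_last h) h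
    intro p hp IH h j l hl
    rcases H.crelease h with ⟨hα, hβ⟩ | ⟨hβ, h1, h2⟩
    · exact release_now (ih1 p hn.1 hα) (ih2 p hn.2 hβ) (List.mem_of_head? hl.2.1)
        fun k hk => (hl.bounds k hk).1
    · rcases hl.cases with rfl | ⟨b, r, rfl, hb, hr⟩
      · exact .inl (by simpa using ih2 p hn.2 hβ)
      · have hbA : .crelease t α β ∈ App b := by
          rcases hb with hb | ⟨-, rfl, hb⟩
          · exact H.wcnext h2 hb.1.2.1 hb.1.2.2
          · have := (hr.bounds _ (List.mem_of_head? hr.2.1)).2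
            have := hr.1
            exact H.wnext h1 (by omega) hb
        exact release_cons (ih2 p hn.2 hβ)
          (IH b (H.le_last hbA) hb.lt hbA j r hr)
  | huntil t α β ih1 ih2 =>
    intro p hn h
    refine backward_induction (n := w.last)
      (P := fun p => .huntil t α β ∈ App p → Sat M w p (.huntil t α β)) ?_ p (H.le_last h) h
    intro p hp IH h
    have step : α ∈ App p → .hnext t (.huntil t α β) ∈ App p → Sat M w p (.huntil t α β) := by
      intro hα h'
      obtain ⟨b, hpb, hb⟩ := H.hnext h'
      obtain ⟨j, l, h1, h2, h3⟩ := IH b (H.le_last hb) hpb.lt hb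
      refine ⟨j, _, h1.cons hN hpb, h2, fun k hk hkj => ?_⟩
      rcases List.mem_cons.1 hk with rfl | hk
      · exact ih1 _ hn.1 hα
      · exact h3 k hk hkj
    cases t with
    | up =>
      rcases H.huntil_up h with ⟨hα, h'⟩ | ⟨hβ, x, hx1, hx2⟩
      · exact step hα h'
      · exact ⟨p, [p], ⟨hp, rfl, rfl, x, hx1.lt, by simp [hx1, hx2], by simp⟩, ih2 p hn.2 hβ,
          by simp⟩
    | down =>
      rcases H.huntil_down h with ⟨hα, h'⟩ | ⟨hβ, x, hx1, hx2⟩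
      · exact step hα h'
      · exact ⟨p, [p], ⟨hp, rfl, rfl, x, hx1.lt, by simp [hx1, hx2], by simp⟩, ih2 p hn.2 hβ,
          by simp⟩
  | hrelease t α β ih1 ih2 =>
    intro p hn h
    refine backward_induction (n := w.last)
      (P := fun p => .hrelease t α β ∈ App p → Sat M w p (.hrelease t α β)) ?_ p (H.le_last h) h
    intro p hp IH h j l hl
    have hor : (α ∈ App p ∧ β ∈ App p) ∨ (β ∈ App p ∧ .whnext t (.hrelease t α β) ∈ App p) := by
      cases t with
      | up => exact H.hrelease_up h
      | down =>
        obtain ⟨-, hi, -, x, -, hx, -⟩ := hl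
        have := hx p (List.mem_of_head? hi)
        exact H.hrelease_down h this.1 this.2
    rcases hor with ⟨hα, hβ⟩ | ⟨hβ, h1⟩
    · exact release_now (ih1 p hn.1 hα) (ih2 p hn.2 hβ) (List.mem_of_head? hl.2.1)
        fun k hk => (hl.bounds k hk).1
    · rcases hl.cases with rfl | ⟨b, r, rfl, hb, hr⟩
      · exact .inl (by simpa using ih2 p hn.2 hβ)
      · have hbA := H.whnext h1 hb
        exact release_cons (ih2 p hn.2 hβ)
          (IH b (H.le_last hbA) hb.lt hbA j r hr)

end

/-! ### The pushdown stack along a branch -/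

section
variable {S AP : Type*} {M : OPM S} {φ : Formula S AP} {B : TabBranch S AP} {m : ℕ}

open Classical in
/-- The stack of the operator precedence automaton that the branch simulates, at the node `B k`. An
entry `(v, i)` stands for an unfinished chain: `v` is the push node that opened it, and `i` the last
push or shift node of it, whose symbol is compared with the next one. -/
noncomputable def conf (M : OPM S) (B : TabBranch S AP) : ℕ → List (ℕ × ℕ)
  | 0 => []
  | k + 1 =>
    if IsStep M B k then
      if (B k).HasType M .yields then (k, k) :: conf M B k
      else if (B k).HasType M .equal then
        match conf M B k with
        | [] => []
        | (v, _) :: r => (v, k) :: r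
      else (conf M B k).tail
    else conf M B k

theorem TabNode.HasType.unique {u : TabNode S AP} {r r' : PrecRel} (h : u.HasType M r)
    (h' : u.HasType M r') : r = r' := by
  obtain ⟨x, h1, h2⟩ := h
  obtain ⟨y, h3, h4⟩ := h'
  rw [h1, Set.singleton_eq_singleton_iff] at h3
  subst h3
  simpa [h2] using h4

theorem TabNode.IsPushShift.not_takes {u : TabNode S AP} (h : u.IsPushShift M) :
    ¬ u.HasType M .takes := by
  intro h'
  rcases h with h | h <;> simpa using h.unique h'

theorem conf_of_not_isStep {k : ℕ} (h : ¬ IsStep M B k) : conf M B (k + 1) = conf M B k := by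
  simp [conf, h]

theorem conf_push {k : ℕ} (h : IsStep M B k) (ht : (B k).HasType M .yields) :
    conf M B (k + 1) = (k, k) :: conf M B k := by
  simp [conf, h, ht]

theorem conf_shift {k : ℕ} (h : IsStep M B k) (ht : (B k).HasType M .equal) {v i : ℕ}
    {r : List (ℕ × ℕ)} (hk : conf M B k = (v, i) :: r) : conf M B (k + 1) = (v, k) :: r := by
  have : ¬ (B k).HasType M .yields := fun h' => by simpa using ht.unique h'
  simp [conf, h, ht, this, hk]

theorem conf_pop {k : ℕ} (h : IsStep M B k) (ht : (B k).HasType M .takes) :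
    conf M B (k + 1) = (conf M B k).tail := by
  have h1 : ¬ (B k).HasType M .yields := fun h' => by simpa using ht.unique h'
  have h2 : ¬ (B k).HasType M .equal := fun h' => by simpa using ht.unique h'
  simp [conf, h, h1, h2]

/-- What happens at a step node of the branch that has a child. -/
theorem IsAcceptedBranch.step_cases (H : IsAcceptedBranch M φ B m) {k : ℕ} (hk : k < m)
    (hs : IsStep M B k) :
    (B (k + 1)).prev = some k ∧
    (((B k).HasType M .yields ∧ (B (k + 1)).pos = (B k).pos + 1 ∧
        (B (k + 1)).label = nextArgs (B k) ∧ (B k).syms = {(B (k + 1)).smb} ∧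
        (B (k + 1)).stack = some k ∧
        ∃ c, (B (k + 1)).ctx = (if (B k).stack = none then none else c) ∧
          ((PrevPushShift M B (B k) ∧ c = (B k).prev) ∨
            ∃ s, (B k).prev = some s ∧ (B s).HasType M .takes ∧ c = (B s).ctx)) ∨
      ((B k).HasType M .equal ∧ (B (k + 1)).pos = (B k).pos + 1 ∧
        (B (k + 1)).label = nextArgs (B k) ∧ (B k).syms = {(B (k + 1)).smb} ∧
        (B k).stack ≠ none ∧ (B (k + 1)).stack = (B k).stack ∧ (B (k + 1)).ctx = (B k).ctx) ∨
      ((B k).HasType M .takes ∧ (B (k + 1)).pos = (B k).pos ∧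
        (B (k + 1)).label = (B k).label ∧ (B (k + 1)).hash = (B k).hash ∧
        ∃ v, (B k).stack = some v ∧ (B (k + 1)).smb = (B v).smb ∧
          (B (k + 1)).stack = (B v).stack ∧ (B (k + 1)).ctx = (B v).ctx)) := by
  have hc := H.child k hk
  generalize B (k + 1) = u at hc
  cases hc with
  | expand ψ Δ h1 h2 h3 => exact absurd h3 (hs.2.1 ψ h2 Δ)
  | add_struct a h1 h2 h3 => exact absurd h3 hs.2.2.ne_empty
  | add_hash h1 h2 h3 => exact absurd h3 hs.2.2.ne_empty
  | guess s G h1 h2 h3 => exact absurd (hs.1.symm.trans h1) (by simp)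
  | push_adj x h1 h2 h3 h4 => exact ⟨rfl, .inl ⟨h2, rfl, rfl, h3, rfl, _, rfl, .inl ⟨h4, rfl⟩⟩⟩
  | push_pop x s h1 h2 h3 h4 h5 =>
    exact ⟨rfl, .inl ⟨h2, rfl, rfl, h3, rfl, _, rfl, .inr ⟨s, h4, h5, rfl⟩⟩⟩
  | shift x h1 h2 h3 h4 => exact ⟨rfl, .inr (.inl ⟨h2, rfl, rfl, h3, h4, rfl, rfl⟩)⟩
  | pop v h1 h2 h3 => exact ⟨rfl, .inr (.inr ⟨h2, rfl, rfl, rfl, v, h3, rfl, rfl, rfl⟩)⟩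

/-- What happens at a node of the branch that is not a step node. -/
theorem IsAcceptedBranch.nonstep_cases (H : IsAcceptedBranch M φ B m) {k : ℕ} (hk : k < m)
    (hs : ¬ IsStep M B k) :
    ((B (k + 1)).smb = (B k).smb ∧ (B (k + 1)).stack = (B k).stack ∧
      (B (k + 1)).ctx = (B k).ctx ∧ (B (k + 1)).prev = (B k).prev ∧
      (B (k + 1)).pos = (B k).pos) ∧
    ((∃ ψ Δ, ψ ∈ (B k).label ∧ Expands M B (B k) ψ Δ ∧
        (B (k + 1)).label = ((B k).label \ {ψ}) ∪ Δ ∧ (B (k + 1)).hash = (B k).hash) ∨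
      (∃ a, (B (k + 1)).label = (B k).label ∪ {.struct a} ∧ (B (k + 1)).hash = (B k).hash) ∨
      ((B (k + 1)).label = (B k).label ∧ (B (k + 1)).hash = true) ∨
      (∃ s G, (B k).prev = some s ∧ G ⊆ guessArgs M B (B s) ∧
        (B (k + 1)).label = (B k).label ∪ G ∧ (B (k + 1)).hash = (B k).hash)) := by
  have hc := H.child k hk
  generalize B (k + 1) = u at hc
  cases hc with
  | expand ψ Δ h1 h2 h3 => exact ⟨by simp, .inl ⟨ψ, Δ, h2, h3, rfl, rfl⟩⟩
  | add_struct a h1 h2 h3 => exact ⟨by simp, .inr (.inl ⟨a, rfl, rfl⟩)⟩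
  | add_hash h1 h2 h3 => exact ⟨by simp, .inr (.inr (.inl ⟨rfl, rfl⟩))⟩
  | guess s G h1 h2 h3 => exact ⟨by simp, .inr (.inr (.inr ⟨s, G, h2, h3, rfl, rfl⟩))⟩
  | push_adj x h1 h2 h3 h4 => exact absurd h1 hs
  | push_pop x s h1 h2 h3 h4 h5 => exact absurd h1 hs
  | shift x h1 h2 h3 h4 => exact absurd h1 hs
  | pop v h1 h2 h3 => exact absurd h1 hs

/-- The fields of a node, expressed through the stack of the simulated automaton. -/
structure NodeInv (M : OPM S) (B : TabBranch S AP) (k : ℕ) : Prop where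
  stack : (B k).stack = (conf M B k).head?.map Prod.fst
  ctx : (B k).ctx = (conf M B k).tail.head?.map Prod.snd
  smb_nil : conf M B k = [] → (B k).smb = none
  smb_cons {v i r} : conf M B k = (v, i) :: r → (B i).syms = {(B k).smb}
  tail {v i r} : conf M B k = (v, i) :: r → r = conf M B v
  le {v i r} : conf M B k = (v, i) :: r → v ≤ i ∧ i < k
  push {v i r} : conf M B k = (v, i) :: r → IsStep M B v ∧ (B v).HasType M .yields
  top {v i r} : conf M B k = (v, i) :: r → IsStep M B i ∧
    (i = v ∨ ((B i).HasType M .equal ∧ (B i).stack = some v))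
  prev_none : (B k).prev = none → conf M B k = [] ∧ (B k).pos = 1 ∧ ∀ l < k, ¬ IsStep M B l
  prev_some {s} : (B k).prev = some s → s < k ∧ IsStep M B s ∧ conf M B k = conf M B (s + 1) ∧
    (B k).pos = (B (s + 1)).pos ∧ ∀ l, s < l → l < k → ¬ IsStep M B l

theorem IsAcceptedBranch.nodeInv (H : IsAcceptedBranch M φ B m) : ∀ k ≤ m, NodeInv M B k := by
  intro k
  induction k using Nat.strong_induction_on with
  | _ k IH =>
  intro hkm
  match k with
  | 0 =>
    have h0 := H.root
    constructor <;> simp [conf, h0, rootNode]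
  | k + 1 =>
    have hk : k < m := hkm
    have I := IH k (Nat.lt_succ_self k) hk.le
    by_cases hs : IsStep M B k
    · obtain ⟨hprev, hcase⟩ := H.step_cases hk hs
      have hp0 : (B (k + 1)).prev = none → conf M B (k + 1) = [] ∧ (B (k + 1)).pos = 1 ∧
          ∀ l < k + 1, ¬ IsStep M B l := by simp [hprev]
      have hp1 : ∀ {s}, (B (k + 1)).prev = some s → s < k + 1 ∧ IsStep M B s ∧
          conf M B (k + 1) = conf M B (s + 1) ∧ (B (k + 1)).pos = (B (s + 1)).pos ∧
          ∀ l, s < l → l < k + 1 → ¬ IsStep M B l := by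
        intro s h
        rw [hprev] at h
        obtain rfl := Option.some.inj h
        exact ⟨by simp, hs, rfl, rfl, fun l h1 h2 => by omega⟩
      rcases hcase with ⟨ht, -, -, hsm, hst, c, hctx, hc⟩ | ⟨ht, -, -, hsm, hne, hst, hctx⟩ |
        ⟨ht, -, -, -, v, hv, hsm, hst, hctx⟩
      · have e := conf_push hs ht
        refine ⟨by simp [e, hst], ?_, by simp [e], ?_, ?_, ?_, ?_, ?_, hp0, hp1⟩
        · rw [hctx, e, List.tail_cons, I.stack]
          cases hcf : conf M B k with
          | nil => simp
          | cons a r =>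
            obtain ⟨v, i⟩ := a
            simp only [List.head?_cons, Option.map_some, reduceCtorEq, if_false]
            rcases hc with ⟨hpp, rfl⟩ | ⟨s, hps, hts, rfl⟩
            · rcases hpp with hpp | ⟨s, hps, hts⟩
              · have := (I.prev_none hpp).1
                simp [hcf] at this
              · obtain ⟨h1, h2, h3, -, -⟩ := I.prev_some hps
                rw [hps]
                rcases hts with hts | hts
                · rw [hcf, conf_push h2 hts] at h3
                  simp_all
                · have Is := IH s (by omega) (by omega)
                  cases hcs : conf M B s with
                  | nil =>
                    have hny : ¬ (B s).HasType M .yields := fun h' => by simpa using hts.unique h'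
                    simp [conf, h2, hts, hny, hcs, hcf] at h3
                  | cons a r' =>
                    obtain ⟨v', i'⟩ := a
                    rw [hcf, conf_shift h2 hts hcs] at h3
                    simp_all
            · obtain ⟨h1, h2, h3, -, -⟩ := I.prev_some hps
              have Is := IH s (by omega) (by omega)
              rw [Is.ctx, ← conf_pop h2 hts, ← h3, hcf]
              rfl
        all_goals
          intro v i r h
          rw [e] at h
          simp only [List.cons.injEq, Prod.mk.injEq] at h
          obtain ⟨⟨rfl, rfl⟩, rfl⟩ := h
        · exact hsm
        · rfl
        · simp
        · exact ⟨hs, ht⟩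
        · exact ⟨hs, .inl rfl⟩
      · cases hcf : conf M B k with
        | nil => simp [I.stack, hcf] at hne
        | cons a r =>
          obtain ⟨v, i⟩ := a
          have e := conf_shift hs ht hcf
          have hst' : (B k).stack = some v := by simp [I.stack, hcf]
          refine ⟨by simp [e, hst, hst'], by simp [e, hctx, I.ctx, hcf], by simp [e],
            ?_, ?_, ?_, ?_, ?_, hp0, hp1⟩
          all_goals
            intro v' i' r' h
            rw [e] at h
            simp only [List.cons.injEq, Prod.mk.injEq] at h
            obtain ⟨⟨rfl, rfl⟩, rfl⟩ := h
          · exact hsm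
          · exact I.tail hcf
          · have := I.le hcf
            omega
          · exact I.push hcf
          · exact ⟨hs, .inr ⟨ht, hst'⟩⟩
      · have e := conf_pop hs ht
        cases hcf : conf M B k with
        | nil => simp [I.stack, hcf] at hv
        | cons a r =>
          obtain ⟨v', i⟩ := a
          have : v' = v := by simpa [I.stack, hcf] using hv
          subst this
          have hr := I.tail hcf
          have hlt := I.le hcf
          rw [hcf, List.tail_cons, hr] at e
          have J := IH v' (by omega) (by omega)
          refine ⟨by rw [e, hst, J.stack], by rw [e, hctx, J.ctx], ?_, ?_, ?_, ?_, ?_, ?_, hp0, hp1⟩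
          · rw [e, hsm]; exact J.smb_nil
          · intro v'' i' r' h; rw [hsm]; exact J.smb_cons (e ▸ h)
          · intro v'' i' r' h; exact J.tail (e ▸ h)
          · intro v'' i' r' h
            have := J.le (e ▸ h)
            omega
          · intro v'' i' r' h; exact J.push (e ▸ h)
          · intro v'' i' r' h; exact J.top (e ▸ h)
    · obtain ⟨⟨h1, h2, h3, h4, h5⟩, -⟩ := H.nonstep_cases hk hs
      have e := conf_of_not_isStep hs
      refine ⟨by rw [e, h2, I.stack], by rw [e, h3, I.ctx], ?_, ?_, ?_, ?_, ?_, ?_, ?_, ?_⟩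
      · rw [e, h1]; exact I.smb_nil
      · intro v'' i' r' h; rw [h1]; exact I.smb_cons (e ▸ h)
      · intro v'' i' r' h; exact I.tail (e ▸ h)
      · intro v'' i' r' h
        have := I.le (e ▸ h)
        omega
      · intro v'' i' r' h; exact I.push (e ▸ h)
      · intro v'' i' r' h; exact I.top (e ▸ h)
      · intro h
        rw [h4] at h
        obtain ⟨h6, h7, h8⟩ := I.prev_none h
        refine ⟨by rw [e, h6], by rw [h5, h7], fun l hl => ?_⟩
        rcases (Nat.lt_succ_iff_lt_or_eq.1 hl) with hl | rfl
        · exact h8 l hl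
        · exact hs
      · intro s h
        rw [h4] at h
        obtain ⟨h6, h7, h8, h9, h10⟩ := I.prev_some h
        refine ⟨by omega, h7, by rw [e, h8], by rw [h5, h9], fun l h' hl => ?_⟩
        rcases (Nat.lt_succ_iff_lt_or_eq.1 hl) with hl | rfl
        · exact h10 l h' hl
        · exact hs

end

section
variable {S AP : Type*} {M : OPM S} {φ : Formula S AP} {B : TabBranch S AP} {m : ℕ}

/-! ### Navigation between step nodes -/

theorem IsAcceptedBranch.syms_eq (H : IsAcceptedBranch M φ B m) {k : ℕ} (hk : k ≤ m)
    (hs : IsStep M B k) : ∃ x, (B k).syms = {x} := by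
  obtain ⟨x, hx⟩ := hs.2.2
  refine ⟨x, Set.eq_singleton_iff_unique_mem.2 ⟨hx, fun y hy => ?_⟩⟩
  have hr := H.not_rejected k hk hs
  match x, y with
  | none, none => rfl
  | none, some a => exact absurd (Rejected.end_struct a hx hy) hr
  | some a, none => exact absurd (Rejected.end_struct a hy hx) hr
  | some a, some b =>
    by_contra hne
    exact hr (.conflict a b (fun h => hne (by rw [h])) hx hy)

theorem IsAcceptedBranch.conf_last (H : IsAcceptedBranch M φ B m) : conf M B m = [] := by
  have h := (H.nodeInv m le_rfl).stack
  rw [H.accepting.2.2.2] at h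
  cases hc : conf M B m with
  | nil => rfl
  | cons a r => simp [hc] at h

theorem IsAcceptedBranch.syms_last (H : IsAcceptedBranch M φ B m) : (B m).syms = {none} := by
  ext x
  cases x with
  | none => simpa [TabNode.syms] using H.accepting.2.2.1
  | some a => simp [TabNode.syms, H.accepting.2.1]

theorem IsAcceptedBranch.hasType_last (H : IsAcceptedBranch M φ B m) :
    (B m).HasType M .equal :=
  ⟨none, H.syms_last, by rw [(H.nodeInv m le_rfl).smb_nil H.conf_last]; rfl⟩

theorem IsAcceptedBranch.exists_type (H : IsAcceptedBranch M φ B m) {k : ℕ} (hk : k ≤ m)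
    (hs : IsStep M B k) : ∃ r, (B k).HasType M r := by
  rcases hk.lt_or_eq with hk | rfl
  · rcases (H.step_cases hk hs).2 with h | h | h
    exacts [⟨_, h.1⟩, ⟨_, h.1⟩, ⟨_, h.1⟩]
  · exact ⟨_, H.hasType_last⟩

theorem IsAcceptedBranch.pushShift_or_takes (H : IsAcceptedBranch M φ B m) {k : ℕ} (hk : k ≤ m)
    (hs : IsStep M B k) : (B k).IsPushShift M ∨ (B k).HasType M .takes := by
  obtain ⟨r, hr⟩ := H.exists_type hk hs
  cases r with
  | yields => exact .inl (.inl hr)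
  | equal => exact .inl (.inr hr)
  | takes => exact .inr hr

theorem IsAcceptedBranch.lt_of_takes (H : IsAcceptedBranch M φ B m) {k : ℕ} (hk : k ≤ m)
    (ht : (B k).HasType M .takes) : k < m := by
  rcases hk.lt_or_eq with hk | rfl
  · exact hk
  · simpa using ht.unique H.hasType_last

theorem IsAcceptedBranch.pos_succ_of_pushShift (H : IsAcceptedBranch M φ B m) {k : ℕ} (hk : k < m)
    (hs : IsStep M B k) (ht : (B k).IsPushShift M) : (B (k + 1)).pos = (B k).pos + 1 := by
  rcases (H.step_cases hk hs).2 with h | h | h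
  · exact h.2.1
  · exact h.2.1
  · exact absurd h.1 ht.not_takes

theorem IsAcceptedBranch.pos_succ (H : IsAcceptedBranch M φ B m) {k : ℕ} (hk : k < m)
    (hn : ¬ (IsStep M B k ∧ (B k).IsPushShift M)) : (B (k + 1)).pos = (B k).pos := by
  by_cases hs : IsStep M B k
  · rcases (H.step_cases hk hs).2 with h | h | h
    · exact absurd ⟨hs, .inl h.1⟩ hn
    · exact absurd ⟨hs, .inr h.1⟩ hn
    · exact h.2.1
  · exact (H.nonstep_cases hk hs).1.2.2.2.2

theorem IsAcceptedBranch.pos_mono (H : IsAcceptedBranch M φ B m) {k l : ℕ} (hkl : k ≤ l)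
    (hl : l ≤ m) : (B k).pos ≤ (B l).pos := by
  induction l, hkl using Nat.le_induction with
  | base => exact le_rfl
  | succ l hkl ih =>
    refine (ih (by omega)).trans ?_
    by_cases h : IsStep M B l ∧ (B l).IsPushShift M
    · rw [H.pos_succ_of_pushShift hl h.1 h.2]
      omega
    · rw [H.pos_succ hl h]

theorem IsAcceptedBranch.one_le_pos (H : IsAcceptedBranch M φ B m) {k : ℕ} (hk : k ≤ m) :
    1 ≤ (B k).pos := by
  have := H.pos_mono (Nat.zero_le k) hk
  rwa [H.root] at this

theorem IsAcceptedBranch.lt_of_pos_lt (H : IsAcceptedBranch M φ B m) {k l : ℕ} (hk : k ≤ m)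
    (h : (B k).pos < (B l).pos) : k < l := by
  by_contra hlt
  have := H.pos_mono (not_lt.1 hlt) hk
  omega

theorem IsAcceptedBranch.pos_lt (H : IsAcceptedBranch M φ B m) {k l : ℕ} (hkl : k < l)
    (hl : l ≤ m) (hs : IsStep M B k) (ht : (B k).IsPushShift M) : (B k).pos < (B l).pos := by
  have h1 := H.pos_succ_of_pushShift (hkl.trans_le hl) hs ht
  have h2 := H.pos_mono (Nat.succ_le_of_lt hkl) hl
  simp only [Nat.succ_eq_add_one] at h2
  omega

theorem IsAcceptedBranch.exists_step_ge (H : IsAcceptedBranch M φ B m) {l : ℕ} (hl : l ≤ m) :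
    ∃ k, l ≤ k ∧ k ≤ m ∧ IsStep M B k ∧ (B k).prev = (B l).prev := by
  induction hd : m - l generalizing l with
  | zero =>
    obtain rfl : l = m := by omega
    exact ⟨l, le_rfl, le_rfl, H.accepting.1, rfl⟩
  | succ d ih =>
    by_cases hs : IsStep M B l
    · exact ⟨l, le_rfl, hl, hs, rfl⟩
    · have hlt : l < m := by omega
      obtain ⟨k, h1, h2, h3, h4⟩ := ih (l := l + 1) hlt (by omega)
      exact ⟨k, by omega, h2, h3, h4.trans (H.nonstep_cases hlt hs).1.2.2.2.1⟩

/-- Every step node but the leaf is followed by a next step node. -/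
theorem IsAcceptedBranch.exists_next_step (H : IsAcceptedBranch M φ B m) {s : ℕ} (hs : s < m)
    (hst : IsStep M B s) : ∃ k, s < k ∧ k ≤ m ∧ IsStep M B k ∧ (B k).prev = some s ∧
      conf M B k = conf M B (s + 1) ∧ (B k).pos = (B (s + 1)).pos := by
  obtain ⟨k, h1, h2, h3, h4⟩ := H.exists_step_ge (l := s + 1) hs
  rw [(H.step_cases hs hst).1] at h4
  have := (H.nodeInv k h2).prev_some h4
  exact ⟨k, h1, h2, h3, h4, this.2.2.1, this.2.2.2.1⟩

theorem IsAcceptedBranch.exists_first_step (H : IsAcceptedBranch M φ B m) :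
    ∃ k ≤ m, IsStep M B k ∧ (B k).prev = none ∧ conf M B k = [] ∧ (B k).pos = 1 := by
  obtain ⟨k, h1, h2, h3, h4⟩ := H.exists_step_ge (Nat.zero_le m)
  rw [H.root] at h4
  have := (H.nodeInv k h2).prev_none h4
  exact ⟨k, h2, h3, h4, this.1, this.2.1⟩

/-! ### The lifetime of stack entries -/

theorem IsAcceptedBranch.mem_conf (H : IsAcceptedBranch M φ B m) {k : ℕ} (hk : k ≤ m) {v i : ℕ}
    (h : (v, i) ∈ conf M B k) : v ≤ i ∧ i < k ∧ IsStep M B i ∧ (B i).IsPushShift M := by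
  induction k using Nat.strong_induction_on generalizing v i with
  | _ k IH =>
  have I := H.nodeInv k hk
  cases hc : conf M B k with
  | nil => simp [hc] at h
  | cons a r =>
    obtain ⟨v', i'⟩ := a
    have hle := I.le hc
    rw [hc] at h
    rcases List.mem_cons.1 h with h | h
    · obtain ⟨rfl, rfl⟩ := Prod.mk.inj h
      refine ⟨hle.1, hle.2, (I.top hc).1, ?_⟩
      rcases (I.top hc).2 with h | h
      · rw [h]; exact .inl (I.push hc).2
      · exact .inr h.1
    · rw [I.tail hc] at h
      have := IH v' (by omega) (by omega) h
      exact ⟨this.1, by omega, this.2.2⟩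

theorem IsAcceptedBranch.mem_conf_unique (H : IsAcceptedBranch M φ B m) {k : ℕ} (hk : k ≤ m)
    {v i i' : ℕ} (h : (v, i) ∈ conf M B k) (h' : (v, i') ∈ conf M B k) : i = i' := by
  induction k using Nat.strong_induction_on with
  | _ k IH =>
  have I := H.nodeInv k hk
  cases hc : conf M B k with
  | nil => simp [hc] at h
  | cons a r =>
    obtain ⟨v', j⟩ := a
    have hle := I.le hc
    rw [hc, I.tail hc] at h h'
    rcases List.mem_cons.1 h with h | h <;> rcases List.mem_cons.1 h' with h' | h'
    · simp_all
    · have := H.mem_conf (by omega) h'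
      simp at h
      omega
    · have := H.mem_conf (by omega) h
      simp at h'
      omega
    · exact IH v' (by omega) (by omega) h h'

/-- An entry stays on the stack from its push to its pop, while its second component grows. -/
theorem IsAcceptedBranch.exists_mem_conf (H : IsAcceptedBranch M φ B m) {k l : ℕ} (hk : k ≤ m)
    {v i : ℕ} (h : (v, i) ∈ conf M B k) (hvl : v < l) (hlk : l ≤ k) :
    ∃ i' ≤ i, (v, i') ∈ conf M B l := by
  induction k, hlk using Nat.le_induction generalizing i with
  | base => exact ⟨i, le_rfl, h⟩
  | succ k hlk ih =>
    have hkm : k < m := hk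
    by_cases hs : IsStep M B k
    · have I := H.nodeInv k hkm.le
      rcases (H.step_cases hkm hs).2 with ⟨ht, -⟩ | ⟨ht, -, -, -, hne, -⟩ | ⟨ht, -⟩
      · rw [conf_push hs ht] at h
        rcases List.mem_cons.1 h with h | h
        · simp at h
          omega
        · exact ih hkm.le h
      · cases hc : conf M B k with
        | nil => simp [I.stack, hc] at hne
        | cons a r =>
          obtain ⟨v', j⟩ := a
          rw [conf_shift hs ht hc] at h
          rcases List.mem_cons.1 h with h | h
          · obtain ⟨rfl, rfl⟩ := Prod.mk.inj h
            obtain ⟨i', h1, h2⟩ := ih hkm.le (i := j) (by simp [hc])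
            exact ⟨i', h1.trans (I.le hc).2.le, h2⟩
          · exact ih hkm.le (by simp [hc, h])
      · rw [conf_pop hs ht] at h
        exact ih hkm.le (List.mem_of_mem_tail h)
    · rw [conf_of_not_isStep hs] at h
      exact ih hkm.le h

/-- No entry is pushed a second time. -/
theorem IsAcceptedBranch.not_mem_conf (H : IsAcceptedBranch M φ B m) {s l v i i' : ℕ}
    {r : List (ℕ × ℕ)} (hs : IsStep M B s) (ht : (B s).HasType M .takes)
    (hc : conf M B s = (v, i) :: r) (hsl : s < l) (hl : l ≤ m) : (v, i') ∉ conf M B l := by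
  intro h
  have I := H.nodeInv s (by omega)
  have hle := I.le hc
  obtain ⟨i'', -, h2⟩ := H.exists_mem_conf hl h (l := s + 1) (by omega) hsl
  rw [conf_pop hs ht, hc, List.tail_cons, I.tail hc] at h2
  have := H.mem_conf (by omega) h2
  omega

/-- Among the nodes of one position only pops change the stack. -/
theorem IsAcceptedBranch.conf_suffix (H : IsAcceptedBranch M φ B m) {k l : ℕ} (hkl : k ≤ l)
    (hl : l ≤ m) (hp : (B k).pos = (B l).pos) : conf M B l <:+ conf M B k := by
  induction l, hkl using Nat.le_induction with
  | base => exact List.suffix_rfl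
  | succ l hkl ih =>
    have h1 := H.pos_mono hkl (Nat.le_of_succ_le hl)
    have h2 := H.pos_mono (Nat.le_succ l) hl
    simp only [Nat.succ_eq_add_one] at h2
    refine List.IsSuffix.trans ?_ (ih (by omega) (by omega))
    by_cases hs : IsStep M B l
    · rcases H.pushShift_or_takes (by omega) hs with ht | ht
      · have := H.pos_succ_of_pushShift hl hs ht
        omega
      · rw [conf_pop hs ht]
        exact List.tail_suffix _
    · rw [conf_of_not_isStep hs]

theorem IsAcceptedBranch.conf_top (H : IsAcceptedBranch M φ B m) {k : ℕ} (hk : k ≤ m) {v i : ℕ}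
    {r : List (ℕ × ℕ)} (h : conf M B k = (v, i) :: r) : conf M B (i + 1) = (v, i) :: r := by
  induction k using Nat.strong_induction_on generalizing v i r with
  | _ k IH =>
  match k with
  | 0 => simp [conf] at h
  | k + 1 =>
    have hkm : k < m := hk
    by_cases hs : IsStep M B k
    · have I := H.nodeInv k hkm.le
      rcases (H.step_cases hkm hs).2 with ⟨ht, -⟩ | ⟨ht, -, -, -, hne, -⟩ | ⟨ht, -⟩
      · rw [conf_push hs ht] at h
        simp only [List.cons.injEq, Prod.mk.injEq] at h
        obtain ⟨⟨rfl, rfl⟩, rfl⟩ := h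
        exact conf_push hs ht
      · cases hc : conf M B k with
        | nil => simp [I.stack, hc] at hne
        | cons a r =>
          obtain ⟨v', j⟩ := a
          rw [conf_shift hs ht hc] at h
          simp only [List.cons.injEq, Prod.mk.injEq] at h
          obtain ⟨⟨rfl, rfl⟩, rfl⟩ := h
          exact conf_shift hs ht hc
      · cases hc : conf M B k with
        | nil => simp [conf_pop hs ht, hc] at h
        | cons a r' =>
          obtain ⟨v', j⟩ := a
          have hle := I.le hc
          rw [conf_pop hs ht, hc, List.tail_cons, I.tail hc] at h
          exact IH v' (by omega) (by omega) h
    · rw [conf_of_not_isStep hs] at h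
      exact IH k (by omega) hkm.le h

/-! ### The node that reads a position -/

/-- `B k` is the push or shift node that reads position `p`; for the final `#` this is the leaf. -/
def IsReadNode (M : OPM S) (B : TabBranch S AP) (m p k : ℕ) : Prop :=
  k ≤ m ∧ IsStep M B k ∧ (B k).IsPushShift M ∧ (B k).pos = p

/-- The index of the push or shift node that reads position `p`. -/
noncomputable def readNode (M : OPM S) (B : TabBranch S AP) (m p : ℕ) : ℕ :=
  Classical.epsilon (IsReadNode M B m p)

theorem IsAcceptedBranch.isReadNode_unique (H : IsAcceptedBranch M φ B m) {p k l : ℕ}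
    (hk : IsReadNode M B m p k) (hl : IsReadNode M B m p l) : k = l := by
  rcases lt_trichotomy k l with h | h | h
  · have := H.pos_lt h hl.1 hk.2.1 hk.2.2.1
    have := hk.2.2.2
    have := hl.2.2.2
    omega
  · exact h
  · have := H.pos_lt h hk.1 hl.2.1 hl.2.2.1
    have := hk.2.2.2
    have := hl.2.2.2
    omega

theorem IsAcceptedBranch.isReadNode_last (H : IsAcceptedBranch M φ B m) :
    IsReadNode M B m (B m).pos m :=
  ⟨le_rfl, H.accepting.1, .inr H.hasType_last, rfl⟩

theorem IsAcceptedBranch.isReadNode (H : IsAcceptedBranch M φ B m) {p : ℕ} (h1 : 1 ≤ p)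
    (hp : p ≤ (B m).pos) : IsReadNode M B m p (readNode M B m p) := by
  refine Classical.epsilon_spec (p := IsReadNode M B m p) ?_
  have key : ∀ l ≤ m, p < (B l).pos → ∃ k, IsReadNode M B m p k := by
    intro l
    induction l with
    | zero =>
      intro _ h
      rw [H.root] at h
      simp only [rootNode] at h
      omega
    | succ l ih =>
      intro hl h
      by_cases hs : IsStep M B l ∧ (B l).IsPushShift M
      · rw [H.pos_succ_of_pushShift hl hs.1 hs.2] at h
        rcases (Nat.lt_succ_iff_lt_or_eq.1 h) with h | h
        · exact ih (by omega) h
        · exact ⟨l, by omega, hs.1, hs.2, h.symm⟩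
      · rw [H.pos_succ hl hs] at h
        exact ih (by omega) h
  rcases hp.lt_or_eq with hp | rfl
  · exact key m le_rfl hp
  · exact ⟨m, H.isReadNode_last⟩

theorem IsAcceptedBranch.readNode_pos (H : IsAcceptedBranch M φ B m) {k : ℕ} (hk : k ≤ m)
    (hs : IsStep M B k) (ht : (B k).IsPushShift M) : readNode M B m (B k).pos = k :=
  H.isReadNode_unique (H.isReadNode (H.one_le_pos hk) (H.pos_mono hk le_rfl)) ⟨hk, hs, ht, rfl⟩

theorem IsAcceptedBranch.readNode_lt (H : IsAcceptedBranch M φ B m) {p : ℕ} (h1 : 1 ≤ p)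
    (hp : p < (B m).pos) : readNode M B m p < m := by
  have h := H.isReadNode h1 hp.le
  exact H.lt_of_pos_lt h.1 (by rw [h.2.2.2]; exact hp)

theorem IsAcceptedBranch.le_readNode (H : IsAcceptedBranch M φ B m) {k : ℕ} (hk : k ≤ m) :
    k ≤ readNode M B m (B k).pos := by
  have h := H.isReadNode (H.one_le_pos hk) (H.pos_mono hk le_rfl)
  by_contra hlt
  have := H.pos_lt (not_le.1 hlt) hk h.2.1 h.2.2.1
  have := h.2.2.2
  omega

/-- The stack just after position `p` has been read. -/
noncomputable def frame (M : OPM S) (B : TabBranch S AP) (m p : ℕ) : List (ℕ × ℕ) :=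
  if p = 0 then [] else conf M B (readNode M B m p + 1)

/-- The position on top of a stack; an empty stack stands for the initial `#`. -/
def topPos (B : TabBranch S AP) : List (ℕ × ℕ) → ℕ
  | [] => 0
  | (_, i) :: _ => (B i).pos

theorem IsAcceptedBranch.frame_cons (H : IsAcceptedBranch M φ B m) {p : ℕ} (h1 : 1 ≤ p)
    (hp : p < (B m).pos) : ∃ v, frame M B m p = (v, readNode M B m p) :: conf M B v ∧
      v ≤ readNode M B m p ∧ IsStep M B v ∧ (B v).HasType M .yields ∧
      (v = readNode M B m p ∨ (B (readNode M B m p)).HasType M .equal ∧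
        (B (readNode M B m p)).stack = some v) := by
  have h := H.isReadNode h1 hp.le
  have hlt := H.readNode_lt h1 hp
  have I := H.nodeInv _ h.1
  have J := H.nodeInv _ (Nat.succ_le_of_lt hlt)
  simp only [Nat.succ_eq_add_one] at J
  have hex : ∃ v r, conf M B (readNode M B m p + 1) = (v, readNode M B m p) :: r := by
    rcases (H.step_cases hlt h.2.1).2 with ⟨ht, -⟩ | ⟨ht, -, -, -, hne, -⟩ | ⟨ht, -⟩
    · exact ⟨_, _, conf_push h.2.1 ht⟩
    · cases hc : conf M B (readNode M B m p) with
      | nil => simp [I.stack, hc] at hne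
      | cons a r => exact ⟨_, _, conf_shift h.2.1 ht hc⟩
    · exact absurd ht h.2.2.1.not_takes
  obtain ⟨v, r, hr⟩ := hex
  refine ⟨v, ?_, (J.le hr).1, (J.push hr).1, (J.push hr).2, (J.top hr).2.imp Eq.symm id⟩
  rw [frame, if_neg (by omega), hr, J.tail hr]

theorem IsAcceptedBranch.topPos_frame (H : IsAcceptedBranch M φ B m) {p : ℕ}
    (hp : p < (B m).pos) : topPos B (frame M B m p) = p := by
  rcases Nat.eq_zero_or_pos p with rfl | h1
  · simp [frame, topPos]
  · obtain ⟨v, hv, -⟩ := H.frame_cons h1 hp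
    rw [hv]
    exact (H.isReadNode h1 hp.le).2.2.2

theorem IsAcceptedBranch.frame_topPos (H : IsAcceptedBranch M φ B m) {k : ℕ} (hk : k ≤ m) :
    frame M B m (topPos B (conf M B k)) = conf M B k := by
  cases hc : conf M B k with
  | nil => simp [frame, topPos]
  | cons a r =>
    obtain ⟨v, i⟩ := a
    have h := H.mem_conf (v := v) (i := i) hk (by simp [hc])
    have h1 : 1 ≤ (B i).pos := H.one_le_pos (by omega)
    simp only [topPos, frame, H.readNode_pos (by omega) h.2.2.1 h.2.2.2]
    rw [if_neg (by omega), H.conf_top hk hc]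

/-- The first step node of a position starts from the stack of the previous position. -/
theorem IsAcceptedBranch.exists_first (H : IsAcceptedBranch M φ B m) {p : ℕ}
    (hp : p < (B m).pos) : ∃ k ≤ m, IsStep M B k ∧ (B k).pos = p + 1 ∧
      conf M B k = frame M B m p ∧ PrevPushShift M B (B k) ∧
      (1 ≤ p → (B k).prev = some (readNode M B m p) ∧ readNode M B m p < k) := by
  rcases Nat.eq_zero_or_pos p with rfl | h1
  · obtain ⟨k, h1, h2, h3, h4, h5⟩ := H.exists_first_step
    exact ⟨k, h1, h2, h5, by simp [h4, frame], .inl h3, by simp⟩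
  · have h := H.isReadNode h1 hp.le
    have hlt := H.readNode_lt h1 hp
    obtain ⟨k, h2, h3, h4, h5, h6, h7⟩ := H.exists_next_step hlt h.2.1
    refine ⟨k, h3, h4, ?_, ?_, .inr ⟨_, h5, h.2.2.1⟩, fun _ => ⟨h5, h2⟩⟩
    · rw [h7, H.pos_succ_of_pushShift hlt h.2.1 h.2.2.1, h.2.2.2]
    · rw [h6, frame, if_neg (by omega)]

/-! ### Formulas at the nodes of one position -/

/-- A formula that no expansion rule removes from a label. -/
def Formula.Inert : Formula S AP → Prop
  | .struct _ | .prop _ | .neg _ | .next _ _ | .wnext _ _ | .cnext _ _ | .wcnext _ _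
  | .hnext _ _ | .whnext _ _ => True
  | _ => False

theorem Expands.not_inert {u : TabNode S AP} {ψ : Formula S AP} {Δ : Set (Formula S AP)}
    (h : Expands M B u ψ Δ) : ¬ ψ.Inert := by
  cases h <;> simp [Formula.Inert]

/-- Within a position a formula can disappear from the label only by its expansion. -/
theorem IsAcceptedBranch.mem_label_or_expands (H : IsAcceptedBranch M φ B m) {l k : ℕ} (hlk : l ≤ k)
    (hk : k ≤ m) (hp : (B l).pos = (B k).pos) {ψ : Formula S AP} (h : ψ ∈ (B l).label) :
    ψ ∈ (B k).label ∨ ∃ j Δ, j < k ∧ (B j).pos = (B k).pos ∧ Expands M B (B j) ψ Δ ∧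
      (B (j + 1)).pos = (B k).pos ∧ Δ ⊆ (B (j + 1)).label := by
  induction k, hlk using Nat.le_induction with
  | base => exact .inl h
  | succ k hlk ih =>
    have h1 := H.pos_mono hlk (Nat.le_of_succ_le hk)
    have h2 := H.pos_mono (Nat.le_succ k) hk
    simp only [Nat.succ_eq_add_one] at h2
    rcases ih (by omega) (by omega) with h | ⟨j, Δ, h3, h4, h5, h6, h7⟩
    · by_cases hs : IsStep M B k
      · rcases (H.step_cases hk hs).2 with ⟨-, hpos, -⟩ | ⟨-, hpos, -⟩ | ⟨-, -, hl, -⟩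
        · omega
        · omega
        · exact .inl (hl ▸ h)
      · obtain ⟨⟨-, -, -, -, hpos⟩, hc⟩ := H.nonstep_cases hk hs
        rcases hc with ⟨ψ', Δ, h3, h4, h5, -⟩ | ⟨a, h3, -⟩ | ⟨h3, -⟩ | ⟨s, G, -, -, h3, -⟩
        · by_cases he : ψ = ψ'
          · subst he
            exact .inr ⟨k, Δ, by omega, hpos.symm, h4, rfl, by rw [h5]; exact Set.subset_union_right⟩
          · exact .inl (by rw [h5]; exact .inl ⟨h, he⟩)
        · exact .inl (by rw [h3]; exact .inl h)
        · exact .inl (by rw [h3]; exact h)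
        · exact .inl (by rw [h3]; exact .inl h)
    · exact .inr ⟨j, Δ, by omega, by omega, h5, by omega, h7⟩

theorem IsAcceptedBranch.inert_mem (H : IsAcceptedBranch M φ B m) {l k : ℕ} (hlk : l ≤ k)
    (hk : k ≤ m) (hp : (B l).pos = (B k).pos) {ψ : Formula S AP} (hi : ψ.Inert)
    (h : ψ ∈ (B l).label) : ψ ∈ (B k).label := by
  rcases H.mem_label_or_expands hlk hk hp h with h | ⟨j, Δ, -, -, h, -⟩
  · exact h
  · exact absurd hi h.not_inert

theorem IsAcceptedBranch.hash_of_hash (H : IsAcceptedBranch M φ B m) {l k : ℕ} (hlk : l ≤ k)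
    (hk : k ≤ m) (hp : (B l).pos = (B k).pos) (h : (B l).hash = true) : (B k).hash = true := by
  induction k, hlk using Nat.le_induction with
  | base => exact h
  | succ k hlk ih =>
    have h1 := H.pos_mono hlk (Nat.le_of_succ_le hk)
    have h2 := H.pos_mono (Nat.le_succ k) hk
    simp only [Nat.succ_eq_add_one] at h2
    have h := ih (by omega) (by omega)
    by_cases hs : IsStep M B k
    · rcases (H.step_cases hk hs).2 with ⟨-, hpos, -⟩ | ⟨-, hpos, -⟩ | ⟨-, -, -, hl, -⟩
      · omega
      · omega
      · rw [hl, h]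
    · obtain ⟨-, hc⟩ := H.nonstep_cases hk hs
      rcases hc with ⟨ψ', Δ, h3, h4, -, h5⟩ | ⟨a, -, h3⟩ | ⟨-, h3⟩ | ⟨s, G, -, -, -, h3⟩
      · rw [h5, h]
      · rw [h3, h]
      · exact h3
      · rw [h3, h]

theorem IsAcceptedBranch.syms_subset (H : IsAcceptedBranch M φ B m) {l k : ℕ} (hlk : l ≤ k)
    (hk : k ≤ m) (hp : (B l).pos = (B k).pos) : (B l).syms ⊆ (B k).syms := by
  intro x hx
  cases x with
  | none => exact H.hash_of_hash hlk hk hp hx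
  | some a => exact H.inert_mem hlk hk hp (ψ := .struct a) trivial hx

/-! ### The word of a branch -/

/-- `w` is the word whose positions are read along the branch, with the labels of the read nodes. -/
structure IsWordOf (M : OPM S) (B : TabBranch S AP) (m : ℕ) (w : OPWord S AP) : Prop where
  last : w.last = (B m).pos
  syms {p} : 1 ≤ p → p ≤ w.last → (B (readNode M B m p)).syms = {w.sym p}
  letter {p c} : w.letter p = some c → c.2 = {q | .prop q ∈ (B (readNode M B m p)).label}

/-- The symbol `#` is read only by the leaf. -/
theorem IsAcceptedBranch.exists_struct (H : IsAcceptedBranch M φ B m) {k : ℕ} (hk : k < m)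
    (hs : IsStep M B k) (ht : (B k).IsPushShift M) : ∃ a : S, (B k).syms = {some a} := by
  induction k using Nat.strong_induction_on with
  | _ k IH =>
  have I := H.nodeInv k hk.le
  obtain ⟨x, hx⟩ := H.syms_eq hk.le hs
  cases x with
  | some a => exact ⟨a, hx⟩
  | none =>
    exfalso
    rcases (H.step_cases hk hs).2 with ⟨h, -⟩ | ⟨h, -, -, -, hne, -⟩ | ⟨h, -⟩
    · obtain ⟨y, hy, hr⟩ := h
      rw [hx, Set.singleton_eq_singleton_iff] at hy
      subst hy
      cases hsm : (B k).smb <;> simp [hsm, OPM.rel] at hr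
    · obtain ⟨y, hy, hr⟩ := h
      rw [hx, Set.singleton_eq_singleton_iff] at hy
      subst hy
      cases hsm : (B k).smb with
      | some a => simp [hsm, OPM.rel] at hr
      | none =>
        cases hc : conf M B k with
        | nil => simp [I.stack, hc] at hne
        | cons a r =>
          obtain ⟨v, i⟩ := a
          have h := H.mem_conf (v := v) (i := i) hk.le (by simp [hc])
          obtain ⟨a, ha⟩ := IH i h.2.1 (by omega) h.2.2.1 h.2.2.2
          rw [I.smb_cons hc, hsm] at ha
          simp at ha
    · exact ht.not_takes h

theorem IsAcceptedBranch.exists_isWordOf (H : IsAcceptedBranch M φ B m) :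
    ∃ w : OPWord S AP, IsWordOf M B m w := by
  have h1m := H.one_le_pos le_rfl
  have hex : ∀ i : Fin ((B m).pos - 1), ∃ c : S × Set AP,
      (B (readNode M B m (i + 1))).syms = {some c.1} ∧
        c.2 = {q | .prop q ∈ (B (readNode M B m (i + 1))).label} := by
    intro i
    have hi := i.isLt
    have h := H.isReadNode (p := i + 1) (by omega) (by omega)
    obtain ⟨a, ha⟩ := H.exists_struct (H.readNode_lt (p := i + 1) (by omega) (by omega)) h.2.1 h.2.2.1
    exact ⟨(a, _), ha, rfl⟩
  choose c hc1 hc2 using hex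
  have hlast : OPWord.last (List.ofFn c) = (B m).pos := by
    simp only [OPWord.last, List.length_ofFn]
    omega
  refine ⟨List.ofFn c, hlast, ?_, ?_⟩
  · intro p h1 hp
    rw [hlast] at hp
    obtain ⟨i, rfl⟩ : ∃ i, p = i + 1 := ⟨p - 1, by omega⟩
    rcases hp.lt_or_eq with hp | hp
    · have := hc1 ⟨i, by omega⟩
      have hi : i < (B m).pos - 1 := by omega
      simpa [OPWord.sym, OPWord.letter, List.getElem?_ofFn, hi] using this
    · have hi : ¬ i < (B m).pos - 1 := by omega
      have hr : readNode M B m (i + 1) = m := by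
        rw [hp, H.readNode_pos le_rfl H.accepting.1 (.inr H.hasType_last)]
      rw [hr, H.syms_last]
      simp [OPWord.sym, OPWord.letter, hi]
  · intro p c' hc'
    match p with
    | 0 => simp [OPWord.letter] at hc'
    | i + 1 =>
      simp only [OPWord.letter, List.getElem?_ofFn] at hc'
      split_ifs at hc' with hi
      obtain rfl := Option.some.inj hc'
      exact hc2 ⟨i, hi⟩

end

section
variable {S AP : Type*} {M : OPM S} {φ : Formula S AP} {B : TabBranch S AP} {m : ℕ}
  {w : OPWord S AP}

/-! ### Chains and pop nodes -/

theorem IsWordOf.syms_step (W : IsWordOf M B m w) (H : IsAcceptedBranch M φ B m) {k : ℕ}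
    (hk : k ≤ m) (hs : IsStep M B k) : (B k).syms = {w.sym (B k).pos} := by
  have hp := H.pos_mono hk le_rfl
  have h1 := H.one_le_pos hk
  have h := H.isReadNode h1 hp
  obtain ⟨x, hx⟩ := H.syms_eq hk hs
  have hsub := H.syms_subset (H.le_readNode hk) h.1 h.2.2.2.symm
  rw [W.syms h1 (by rw [W.last]; exact hp), hx, Set.singleton_subset_singleton] at hsub
  rw [hx, hsub]

theorem IsWordOf.smb_eq (W : IsWordOf M B m w) (H : IsAcceptedBranch M φ B m) {k : ℕ}
    (hk : k ≤ m) : (B k).smb = w.sym (topPos B (conf M B k)) := by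
  have I := H.nodeInv k hk
  cases hc : conf M B k with
  | nil => rw [I.smb_nil hc]; rfl
  | cons a r =>
    obtain ⟨v, i⟩ := a
    have h := H.mem_conf (v := v) (i := i) hk (by simp [hc])
    have h1 := I.smb_cons hc
    rw [W.syms_step H (by omega) h.2.2.1, Set.singleton_eq_singleton_iff] at h1
    exact h1.symm

/-- The type of a step node is the precedence relation between the top of the stack and the
position of the node. -/
theorem IsWordOf.hasType_iff (W : IsWordOf M B m w) (H : IsAcceptedBranch M φ B m) {k : ℕ}
    (hk : k ≤ m) (hs : IsStep M B k) (r : PrecRel) :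
    (B k).HasType M r ↔ w.rel M (topPos B (conf M B k)) (B k).pos = some r := by
  rw [TabNode.HasType, W.syms_step H hk hs, W.smb_eq H hk, OPWord.rel]
  constructor
  · rintro ⟨x, h1, h2⟩
    rw [Set.singleton_eq_singleton_iff] at h1
    rwa [h1]
  · exact fun h => ⟨_, rfl, h⟩

/-- Every stack on the branch describes unfinished chains, and the position of a node is adjacent
to the top of the stack or joined to it by a chain. -/
theorem IsWordOf.chainPart_conf (W : IsWordOf M B m w) (H : IsAcceptedBranch M φ B m) {k : ℕ}
    (hk : k ≤ m) :
    ((B k).pos = topPos B (conf M B k) + 1 ∨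
      ChainPart M w true (topPos B (conf M B k)) (B k).pos) ∧
    ∀ v i r, (v, i) :: r <:+ conf M B k → ChainPart M w false (topPos B r) (B i).pos := by
  induction k with
  | zero => simp [H.root, rootNode, conf, topPos]
  | succ k ih =>
    have hkm : k < m := hk
    obtain ⟨ih1, ih2⟩ := ih hkm.le
    have I := H.nodeInv k hkm.le
    by_cases hs : IsStep M B k
    · rcases (H.step_cases hkm hs).2 with ⟨ht, hpos, -⟩ | ⟨ht, hpos, -, -, hne, -⟩ | ⟨ht, hpos, -⟩
      · have hrel := (W.hasType_iff H hkm.le hs _).1 ht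
        rw [conf_push hs ht, hpos]
        refine ⟨.inl rfl, fun v i r h => ?_⟩
        rw [List.suffix_cons_iff] at h
        rcases h with h | h
        · simp only [List.cons.injEq, Prod.mk.injEq] at h
          obtain ⟨⟨rfl, rfl⟩, rfl⟩ := h
          rcases ih1 with ih1 | ih1
          · rw [ih1] at hrel ⊢
            exact .open_adj _ hrel
          · exact .open_sub _ _ ih1 hrel
        · exact ih2 v i r h
      · have hrel := (W.hasType_iff H hkm.le hs _).1 ht
        cases hc : conf M B k with
        | nil => simp [I.stack, hc] at hne
        | cons a r' =>
          obtain ⟨v', i'⟩ := a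
          rw [hc] at hrel ih1 ih2
          rw [conf_shift hs ht hc, hpos]
          refine ⟨.inl rfl, fun v i r h => ?_⟩
          rw [List.suffix_cons_iff] at h
          rcases h with h | h
          · simp only [List.cons.injEq, Prod.mk.injEq] at h
            obtain ⟨⟨rfl, rfl⟩, rfl⟩ := h
            have hop := ih2 v i' r List.suffix_rfl
            simp only [topPos] at ih1 hrel
            rcases ih1 with ih1 | ih1
            · rw [ih1] at hrel ⊢
              exact .shift_adj _ _ hop hrel
            · exact .shift_sub _ _ _ hop ih1 hrel
          · exact ih2 v i r (h.trans (List.suffix_cons _ _))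
      · have hrel := (W.hasType_iff H hkm.le hs _).1 ht
        cases hc : conf M B k with
        | nil =>
          obtain ⟨v, hv, -⟩ := ((H.step_cases hkm hs).2.resolve_left
            (fun h => by simpa using ht.unique h.1)).resolve_left
            (fun h => by simpa using ht.unique h.1) |>.2.2.2.2
          simp [I.stack, hc] at hv
        | cons a r =>
          obtain ⟨v, i⟩ := a
          rw [hc] at hrel ih1 ih2
          rw [conf_pop hs ht, hc, hpos, List.tail_cons]
          refine ⟨.inr ?_, fun v i r' h => ih2 v i r' (h.trans (List.suffix_cons _ _))⟩
          have hop := ih2 v i r List.suffix_rfl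
          simp only [topPos] at ih1 hrel
          rcases ih1 with ih1 | ih1
          · rw [ih1] at hrel ⊢
            exact .close_adj _ _ hop hrel
          · exact .close_sub _ _ _ hop ih1 hrel
    · obtain ⟨⟨-, -, -, -, h5⟩, -⟩ := H.nonstep_cases hkm hs
      rw [conf_of_not_isStep hs, h5]
      exact ⟨ih1, ih2⟩

theorem IsAcceptedBranch.conf_of_takes (H : IsAcceptedBranch M φ B m) {k : ℕ} (hk : k ≤ m)
    (hs : IsStep M B k) (ht : (B k).HasType M .takes) :
    ∃ v i, conf M B k = (v, i) :: conf M B v := by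
  have I := H.nodeInv k hk
  rcases (H.step_cases (H.lt_of_takes hk ht) hs).2 with h | h | ⟨-, -, -, -, v, hv, -⟩
  · simpa using ht.unique h.1
  · simpa using ht.unique h.1
  · cases hc : conf M B k with
    | nil => simp [I.stack, hc] at hv
    | cons a r =>
      obtain ⟨v, i⟩ := a
      exact ⟨v, i, by rw [I.tail hc]⟩

theorem IsAcceptedBranch.conf_of_equal (H : IsAcceptedBranch M φ B m) {k : ℕ} (hk : k < m)
    (hs : IsStep M B k) (ht : (B k).HasType M .equal) :
    ∃ v i, conf M B k = (v, i) :: conf M B v := by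
  have I := H.nodeInv k hk.le
  rcases (H.step_cases hk hs).2 with h | ⟨-, -, -, -, hne, -⟩ | h
  · simpa using ht.unique h.1
  · cases hc : conf M B k with
    | nil => simp [I.stack, hc] at hne
    | cons a r =>
      obtain ⟨v, i⟩ := a
      exact ⟨v, i, by rw [I.tail hc]⟩
  · simpa using ht.unique h.1

/-- `B s` is a pop node at position `j` that closes a chain with left context `i`. -/
structure Closes (M : OPM S) (B : TabBranch S AP) (m i j s : ℕ) : Prop where
  lt : s < m
  step : IsStep M B s
  takes : (B s).HasType M .takes
  pos : (B s).pos = j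
  conf_eq : ∃ v x, conf M B s = (v, x) :: frame M B m i

theorem IsAcceptedBranch.closes (H : IsAcceptedBranch M φ B m) {s : ℕ} (hs : s ≤ m)
    (hst : IsStep M B s) (ht : (B s).HasType M .takes) :
    Closes M B m (topPos B (conf M B s).tail) (B s).pos s := by
  obtain ⟨v, i, hc⟩ := H.conf_of_takes hs hst ht
  have := (H.nodeInv s hs).le hc
  refine ⟨H.lt_of_takes hs ht, hst, ht, rfl, v, i, ?_⟩
  rw [hc, List.tail_cons, H.frame_topPos (by omega)]

theorem IsWordOf.chi_of_takes (W : IsWordOf M B m w) (H : IsAcceptedBranch M φ B m) {s : ℕ}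
    (hs : s ≤ m) (hst : IsStep M B s) (ht : (B s).HasType M .takes) :
    Chi M w (topPos B (conf M B s).tail) (B s).pos := by
  have hlt := H.lt_of_takes hs ht
  obtain ⟨h, -⟩ := W.chainPart_conf H (Nat.succ_le_of_lt hlt)
  obtain ⟨-, h2⟩ := W.chainPart_conf H hs
  obtain ⟨v, i, hc⟩ := H.conf_of_takes hs hst ht
  have hop := h2 v i _ (by rw [hc])
  have hpos : (B (s + 1)).pos = (B s).pos := H.pos_succ hlt fun h => h.2.not_takes ht
  simp only [Nat.succ_eq_add_one] at h
  rw [conf_pop hst ht, hpos] at h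
  refine ⟨by rw [W.last]; exact H.pos_mono hs le_rfl, ?_⟩
  -- The top of the stack lies strictly between the two contexts, so they are not adjacent.
  rcases h with h | h
  · have h3 := hop.lt
    rw [hc, List.tail_cons] at h
    have h4 := H.mem_conf (v := v) (i := i) hs (by simp [hc])
    have h5 := H.pos_lt h4.2.1 hs h4.2.2.1 h4.2.2.2
    omega
  · exact h

theorem Closes.chi (W : IsWordOf M B m w) (H : IsAcceptedBranch M φ B m) {i j s : ℕ}
    (h : Closes M B m i j s) (hi : i < w.last) : Chi M w i j := by
  have := W.chi_of_takes H h.lt.le h.step h.takes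
  obtain ⟨v, x, hc⟩ := h.conf_eq
  rwa [hc, List.tail_cons, H.topPos_frame (by rwa [← W.last]), h.pos] at this

/-- A chain of the word is closed by a pop node, and an unfinished chain is a stack entry. -/
theorem IsWordOf.closes_of_chainPart (W : IsWordOf M B m w) (H : IsAcceptedBranch M φ B m)
    {b : Bool} {i j : ℕ} (h : ChainPart M w b i j) :
    (b = false → j < w.last →
      ∃ v, frame M B m j = (v, readNode M B m j) :: frame M B m i) ∧
    (b = true → j ≤ w.last → ∃ s, Closes M B m i j s) := by
  -- In both cases of `ChainPart`, adjacency and subchain, a step node at the second position has the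
  -- stack of the first one; its type then follows from the precedence relation.
  have adj : ∀ i < w.last, ∃ k ≤ m, IsStep M B k ∧ (B k).pos = i + 1 ∧
      conf M B k = frame M B m i := fun i hi => by
    obtain ⟨k, h1, h2, h3, h4, -⟩ := H.exists_first (p := i) (by rwa [← W.last])
    exact ⟨k, h1, h2, h3, h4⟩
  have sub : ∀ i j, (∃ s, Closes M B m i j s) → ∃ k ≤ m, IsStep M B k ∧ (B k).pos = j ∧
      conf M B k = frame M B m i := by
    rintro i j ⟨s, hs⟩
    obtain ⟨v, x, hc⟩ := hs.conf_eq
    obtain ⟨k, h1, h2, h3, h4, h5, h6⟩ := H.exists_next_step hs.lt hs.step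
    refine ⟨k, h2, h3, ?_, ?_⟩
    · rw [h6, H.pos_succ hs.lt fun h => h.2.not_takes hs.takes, hs.pos]
    · rw [h5, conf_pop hs.step hs.takes, hc, List.tail_cons]
  have read : ∀ i j, i < w.last → (∃ k ≤ m, IsStep M B k ∧ (B k).pos = j ∧
      conf M B k = frame M B m i) → j < w.last →
      (w.rel M i j = some .yields →
        ∃ v, frame M B m j = (v, readNode M B m j) :: frame M B m i) ∧
      (w.rel M i j = some .equal → ∀ p v, frame M B m i = (v, readNode M B m i) :: frame M B m p →
        ∃ v, frame M B m j = (v, readNode M B m j) :: frame M B m p) := by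
    rintro i j hi ⟨k, h1, h2, h3, h4⟩ hj
    have ht := W.hasType_iff H h1 h2
    rw [h3, h4, H.topPos_frame (by rwa [← W.last])] at ht
    have hj0 : j ≠ 0 := by have := H.one_le_pos h1; omega
    have hread : ∀ r, (B k).HasType M r → r ≠ .takes → readNode M B m j = k := by
      intro r hr hne
      rw [← h3]
      refine H.readNode_pos h1 h2 ?_
      cases r
      exacts [.inl hr, .inr hr, absurd rfl hne]
    constructor
    · intro hr
      have hr := (ht _).2 hr
      have hk := hread _ hr (by simp)
      exact ⟨k, by rw [frame, if_neg hj0, hk, conf_push h2 hr, h4]⟩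
    · intro hr p v hv
      have hr := (ht _).2 hr
      have hk := hread _ hr (by simp)
      exact ⟨v, by rw [frame, if_neg hj0, hk, conf_shift h2 hr (h4.trans hv)]⟩
  have close : ∀ i j, i < w.last → (∃ k ≤ m, IsStep M B k ∧ (B k).pos = j ∧
      conf M B k = frame M B m i) → w.rel M i j = some .takes →
      ∀ p v, frame M B m i = (v, readNode M B m i) :: frame M B m p →
      ∃ s, Closes M B m p j s := by
    rintro i j hi ⟨k, h1, h2, h3, h4⟩ hr p v hv
    have ht := W.hasType_iff H h1 h2
    rw [h3, h4, H.topPos_frame (by rwa [← W.last])] at ht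
    have hr := (ht _).2 hr
    exact ⟨k, H.lt_of_takes h1 hr, h2, hr, h3, v, _, h4.trans hv⟩
  induction h with
  | open_adj i h =>
    exact ⟨fun _ hj => (read i (i + 1) (by omega) (adj i (by omega)) hj).1 h, by simp⟩
  | open_sub i k hik h ih =>
    have := hik.lt
    exact ⟨fun _ hj => (read i k (by omega) (sub i k (ih.2 rfl hj.le)) hj).1 h, by simp⟩
  | shift_adj i k hik h ih =>
    refine ⟨fun _ hj => ?_, by simp⟩
    obtain ⟨v, hv⟩ := ih.1 rfl (by omega)
    exact (read k (k + 1) (by omega) (adj k (by omega)) hj).2 h _ _ hv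
  | shift_sub i k l hik hkl h ih1 ih2 =>
    have := hkl.lt
    refine ⟨fun _ hj => ?_, by simp⟩
    obtain ⟨v, hv⟩ := ih1.1 rfl (by omega)
    exact (read k l (by omega) (sub k l (ih2.2 rfl hj.le)) hj).2 h _ _ hv
  | close_adj i k hik h ih =>
    refine ⟨by simp, fun _ hj => ?_⟩
    obtain ⟨v, hv⟩ := ih.1 rfl (by omega)
    exact close k (k + 1) (by omega) (adj k (by omega)) h _ _ hv
  | close_sub i k l hik hkl h ih1 ih2 =>
    have := hkl.lt
    refine ⟨by simp, fun _ hj => ?_⟩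
    obtain ⟨v, hv⟩ := ih1.1 rfl (by omega)
    exact close k l (by omega) (sub k l (ih2.2 rfl hj)) h _ _ hv

theorem Chi.exists_closes (W : IsWordOf M B m w) (H : IsAcceptedBranch M φ B m) {i j : ℕ}
    (h : Chi M w i j) : ∃ s, Closes M B m i j s :=
  (W.closes_of_chainPart H h.2).2 rfl h.1

theorem Chi.left_lt {i j : ℕ} (h : Chi M w i j) : i < w.last := h.lt.trans_le h.1

/-- The step node after the pop that closes a chain compares the two contexts of the chain. -/
theorem Closes.exists_next (W : IsWordOf M B m w) (H : IsAcceptedBranch M φ B m) {i j s : ℕ}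
    (h : Closes M B m i j s) (hi : i < w.last) : ∃ k, s < k ∧ k ≤ m ∧ IsStep M B k ∧
      (B k).prev = some s ∧ conf M B k = frame M B m i ∧ (B k).pos = j ∧
      ∀ r, (B k).HasType M r ↔ w.rel M i j = some r := by
  obtain ⟨v, x, hc⟩ := h.conf_eq
  obtain ⟨k, h1, h2, h3, h4, h5, h6⟩ := H.exists_next_step h.lt h.step
  rw [conf_pop h.step h.takes, hc, List.tail_cons] at h5
  rw [H.pos_succ h.lt fun h' => h'.2.not_takes h.takes, h.pos] at h6
  refine ⟨k, h1, h2, h3, h4, h5, h6, fun r => ?_⟩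
  rw [W.hasType_iff H h2 h3, h5, h6, H.topPos_frame (by rwa [← W.last])]

theorem IsWordOf.compatible (W : IsWordOf M B m w) (H : IsAcceptedBranch M φ B m) :
    Compatible M w := by
  constructor
  · intro i hi
    rw [W.last] at hi
    obtain ⟨k, h1, h2, h3, h4, -⟩ := H.exists_first hi
    obtain ⟨r, hr⟩ := H.exists_type h1 h2
    rw [W.hasType_iff H h1 h2, h3, h4, H.topPos_frame hi] at hr
    simp [hr]
  · intro i j h
    obtain ⟨s, hs⟩ := h.exists_closes W H
    obtain ⟨k, -, h2, h3, -, -, -, h7⟩ := hs.exists_next W H h.left_lt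
    obtain ⟨r, hr⟩ := H.exists_type h2 h3
    simp [(h7 r).1 hr]

theorem IsWordOf.readNode_lt_iff (W : IsWordOf M B m w) (H : IsAcceptedBranch M φ B m) {p q : ℕ}
    (hp1 : 1 ≤ p) (hp : p ≤ w.last) (hq1 : 1 ≤ q) (hq : q ≤ w.last) :
    readNode M B m p < readNode M B m q ↔ p < q := by
  rw [W.last] at hp hq
  have h1 := H.isReadNode hp1 hp
  have h2 := H.isReadNode hq1 hq
  constructor
  · intro h
    have := H.pos_lt h h2.1 h1.2.1 h1.2.2.1
    rwa [h1.2.2.2, h2.2.2.2] at this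
  · intro h
    exact H.lt_of_pos_lt h1.1 (by rwa [h1.2.2.2, h2.2.2.2])

/-- The entries of the stack left by position `p` belong to positions up to `p`. -/
theorem IsAcceptedBranch.mem_frame_le (H : IsAcceptedBranch M φ B m) {p v x : ℕ}
    (hp : p < (B m).pos) (h : (v, x) ∈ frame M B m p) : 1 ≤ p ∧ x ≤ readNode M B m p := by
  rcases Nat.eq_zero_or_pos p with rfl | h1
  · simp [frame] at h
  · rw [frame, if_neg (by omega)] at h
    have := H.mem_conf (Nat.succ_le_of_lt (H.readNode_lt h1 hp)) h
    exact ⟨h1, by omega⟩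

theorem IsAcceptedBranch.mem_frame_self (H : IsAcceptedBranch M φ B m) {p : ℕ} (h1 : 1 ≤ p)
    (hp : p < (B m).pos) : ∃ v ≤ readNode M B m p, (v, readNode M B m p) ∈ frame M B m p := by
  obtain ⟨v, hv, hle, -⟩ := H.frame_cons h1 hp
  exact ⟨v, hle, by simp [hv]⟩

theorem IsAcceptedBranch.suffix_frame (H : IsAcceptedBranch M φ B m) {i j s l : ℕ}
    (h : Closes M B m i j s) (hsl : s < l) (hl : l ≤ m) (hp : (B l).pos = j) :
    conf M B l <:+ frame M B m i := by
  obtain ⟨v, x, hc⟩ := h.conf_eq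
  have := H.conf_suffix (Nat.succ_le_of_lt hsl) hl (by
    simp only [Nat.succ_eq_add_one]
    rw [H.pos_succ h.lt fun h' => h'.2.not_takes h.takes, h.pos, hp])
  simpa [conf_pop h.step h.takes, hc] using this

/-- The chains that end in one position are closed from the innermost to the outermost. -/
theorem IsWordOf.closes_lt (W : IsWordOf M B m w) (H : IsAcceptedBranch M φ B m) {p q j s s' : ℕ}
    (h : Closes M B m p j s) (h' : Closes M B m q j s') (hpq : p < q) (hq : q < w.last) :
    s' < s := by
  rw [W.last] at hq
  rcases lt_trichotomy s s' with hlt | rfl | hlt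
  · obtain ⟨v, x, hc⟩ := h'.conf_eq
    have hsuf := H.suffix_frame h hlt h'.lt.le h'.pos
    obtain ⟨v', -, hm⟩ := H.mem_frame_self (p := q) (by omega) hq
    have := H.mem_frame_le (p := p) (by omega) (hsuf.subset (a := (v', readNode M B m q))
      (by rw [hc]; exact List.mem_cons_of_mem _ hm))
    have := (W.readNode_lt_iff H (q := q) this.1 (by rw [W.last]; omega) (by omega)
      (by rw [W.last]; omega)).2 hpq
    omega
  · obtain ⟨v, x, hc⟩ := h.conf_eq
    obtain ⟨v', x', hc'⟩ := h'.conf_eq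
    have := (List.cons.inj (hc.symm.trans hc')).2
    have := congrArg (topPos B) this
    rw [H.topPos_frame (by omega), H.topPos_frame hq] at this
    omega
  · exact hlt

theorem IsWordOf.wellNested (W : IsWordOf M B m w) (H : IsAcceptedBranch M φ B m) :
    WellNested M w where
  no_crossing := by
    intro p a h h' hph hpa hah hah'
    by_contra hlt
    obtain ⟨s, hs⟩ := hph.exists_closes W H
    obtain ⟨s', hs'⟩ := hah'.exists_closes W H
    have hp := hph.left_lt
    have ha := hah'.left_lt
    have hl := W.last
    have hss : s < s' := H.lt_of_pos_lt hs.lt.le (by rw [hs.pos, hs'.pos]; omega)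
    have hr := H.isReadNode (p := a) (by omega) (by omega)
    have has : readNode M B m a < s := H.lt_of_pos_lt hr.1 (by rw [hs.pos, hr.2.2.2]; omega)
    obtain ⟨v, hv, hmem⟩ := H.mem_frame_self (p := a) (by omega) (by omega)
    obtain ⟨y, x, hc'⟩ := hs'.conf_eq
    obtain ⟨z, -, hz⟩ := H.exists_mem_conf (i := readNode M B m a) (l := s + 1) (v := v) hs'.lt.le
      (by simp [hc', hmem]) (by omega) (by omega)
    -- The entry of position `a` is on the stack before and after the chain from `p` to `h` is
    -- closed, but all entries that survive are older than `a`.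
    have hz1 : z ≤ readNode M B m p ∧ 1 ≤ p := by
      obtain ⟨y, x, hc⟩ := hs.conf_eq
      rw [conf_pop hs.step hs.takes, hc, List.tail_cons] at hz
      exact (H.mem_frame_le (by omega) hz).symm
    obtain ⟨i', hi', hi2⟩ := H.exists_mem_conf (l := readNode M B m a + 1)
      (Nat.succ_le_of_lt hs.lt) hz (by omega) (by omega)
    rw [frame, if_neg (by omega)] at hmem
    have := H.mem_conf_unique (k := readNode M B m a + 1) (has.trans hs.lt) hmem hi2
    have := (W.readNode_lt_iff H hz1.2 hp.le (by omega) ha.le).2 hpa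
    omega
  yields_of_lt := by
    intro h k j hk hj hkj
    obtain ⟨s, hs⟩ := hk.exists_closes W H
    obtain ⟨s', hs'⟩ := hj.exists_closes W H
    obtain ⟨K, h1, h2, h3, h4, h5, h6, h7⟩ := hs.exists_next W H hk.left_lt
    have hKs : K < s' := H.lt_of_pos_lt h2 (by rw [h6, hs'.pos]; exact hkj)
    obtain ⟨y, x, hc'⟩ := hs'.conf_eq
    have hs'm := hs'.lt
    obtain ⟨r, hr⟩ := H.exists_type h2 h3
    cases r with
    | yields => exact (h7 _).1 hr
    | takes =>
      obtain ⟨v, i, hc⟩ := H.conf_of_takes h2 h3 hr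
      refine absurd ?_ (H.not_mem_conf (i' := i) h3 hr hc hKs hs'.lt.le)
      rw [hc', ← h5, hc]
      simp
    | equal =>
      obtain ⟨v, i, hc⟩ := H.conf_of_equal (by omega) h3 hr
      have hle := (H.nodeInv K h2).le hc
      obtain ⟨i', h8, h9⟩ := H.exists_mem_conf (l := K + 1) (v := v) (i := i) hs'.lt.le
        (by rw [hc', ← h5, hc]; simp) (by omega) hKs
      have := H.mem_conf_unique (k := K + 1) (i' := K) (by omega) h9
        (by rw [conf_shift h3 hr hc]; simp)
      omega
  takes_of_lt := by
    intro p k h hp hk hpk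
    obtain ⟨s, hs⟩ := hp.exists_closes W H
    obtain ⟨s', hs'⟩ := hk.exists_closes W H
    have hlt := W.closes_lt H hs hs' hpk hk.left_lt
    obtain ⟨K, h1, h2, h3, h4, h5, h6, h7⟩ := hs'.exists_next W H hk.left_lt
    rw [← h7]
    refine (H.pushShift_or_takes h2 h3).resolve_left fun hps => ?_
    rcases lt_trichotomy K s with hKs | rfl | hKs
    · have := H.pos_lt hKs hs.lt.le h3 hps
      rw [h6, hs.pos] at this
      omega
    · exact hps.not_takes hs.takes
    · exact ((H.nodeInv K h2).prev_some h4).2.2.2.2 s hlt hKs hs.step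

end

section
variable {S AP : Type*} {M : OPM S} {φ : Formula S AP} {B : TabBranch S AP} {m : ℕ}
  {w : OPWord S AP}

/-! ### The labelling of the word by the branch -/

/-- The formulas that appear in the labels of the nodes for position `p`. -/
def branchLabelling (M : OPM S) (B : TabBranch S AP) (m p : ℕ) : Set (Formula S AP) :=
  {ψ | 1 ≤ p ∧ p ≤ (B m).pos ∧ ψ ∈ Appearing B (readNode M B m p)}

theorem IsAcceptedBranch.labelling_of_appearing (H : IsAcceptedBranch M φ B m) {k p : ℕ}
    (hk : k ≤ m) (hp : (B k).pos = p) {ψ : Formula S AP} (h : ψ ∈ Appearing B k) :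
    ψ ∈ branchLabelling M B m p := by
  subst hp
  have h1 := H.one_le_pos hk
  have h2 := H.pos_mono hk le_rfl
  obtain ⟨l, hl, hpos, hψ⟩ := h
  have hle := H.le_readNode hk
  exact ⟨h1, h2, l, by omega, by rw [hpos, (H.isReadNode h1 h2).2.2.2], hψ⟩

theorem IsAcceptedBranch.labelling_of_label (H : IsAcceptedBranch M φ B m) {k p : ℕ}
    (hk : k ≤ m) (hp : (B k).pos = p) {ψ : Formula S AP} (h : ψ ∈ (B k).label) :
    ψ ∈ branchLabelling M B m p :=
  H.labelling_of_appearing hk hp ⟨k, le_rfl, rfl, h⟩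

theorem IsAcceptedBranch.readNode_last (H : IsAcceptedBranch M φ B m) :
    readNode M B m (B m).pos = m :=
  H.readNode_pos le_rfl H.accepting.1 (.inr H.hasType_last)

/-- The leaf has an empty label, so that inert formulas do not occur in the last position. -/
theorem IsAcceptedBranch.label_of_inert (H : IsAcceptedBranch M φ B m) {p : ℕ}
    {ψ : Formula S AP} (h : ψ ∈ branchLabelling M B m p) (hi : ψ.Inert) :
    1 ≤ p ∧ p < (B m).pos ∧ ψ ∈ (B (readNode M B m p)).label := by
  obtain ⟨h1, h2, l, hl, hpos, hψ⟩ := h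
  have hmem := H.inert_mem hl (H.isReadNode h1 h2).1 hpos hi hψ
  refine ⟨h1, lt_of_le_of_ne h2 ?_, hmem⟩
  rintro rfl
  rw [H.readNode_last, H.accepting.2.1] at hmem
  exact hmem

/-- A formula to which an expansion rule applies at the read node has been expanded before. -/
theorem IsAcceptedBranch.exists_expands (H : IsAcceptedBranch M φ B m) {p : ℕ}
    {ψ : Formula S AP} (h : ψ ∈ branchLabelling M B m p)
    (he : ∃ Δ, Expands M B (B (readNode M B m p)) ψ Δ) :
    ∃ j Δ, j ≤ m ∧ (B j).pos = p ∧ Expands M B (B j) ψ Δ ∧ Δ ⊆ branchLabelling M B m p := by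
  obtain ⟨h1, h2, l, hl, hpos, hψ⟩ := h
  have hr := H.isReadNode h1 h2
  rcases H.mem_label_or_expands hl hr.1 hpos hψ with h | ⟨j, Δ, h3, h4, h5, h6, h7⟩
  · obtain ⟨Δ, hΔ⟩ := he
    exact absurd hΔ (hr.2.1.2.1 ψ h Δ)
  · have := hr.1
    have := hr.2.2.2
    exact ⟨j, Δ, by omega, by omega, h5,
      fun α hα => H.labelling_of_label (k := j + 1) (by omega) (by omega) (h7 hα)⟩

/-! ### Pointers and precedence relations in terms of positions -/

theorem IsWordOf.relAt_iff (W : IsWordOf M B m w) (H : IsAcceptedBranch M φ B m) {s k : ℕ}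
    (hs : s ≤ m) (hst : IsStep M B s) (hk : k ≤ m) (hkt : IsStep M B k) (r : PrecRel) :
    RelAt M B (some s) r (B k) ↔ w.rel M (B s).pos (B k).pos = some r := by
  simp only [RelAt, symsAt, W.syms_step H hs hst, W.syms_step H hk hkt,
    Set.singleton_eq_singleton_iff]
  constructor
  · rintro ⟨x, y, rfl, rfl, h⟩
    exact h
  · exact fun h => ⟨_, _, rfl, rfl, h⟩

theorem IsWordOf.dirRelAt_iff (W : IsWordOf M B m w) (H : IsAcceptedBranch M φ B m) {s k : ℕ}
    (hs : s ≤ m) (hst : IsStep M B s) (hk : k ≤ m) (hkt : IsStep M B k) (t : Dir) :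
    DirRelAt M B (some s) t (B k) ↔ t.Allows (w.rel M (B s).pos (B k).pos) := by
  rw [DirRelAt, W.relAt_iff H hs hst hk hkt, W.relAt_iff H hs hst hk hkt, Dir.Allows]

theorem Closes.relAt_ctx (W : IsWordOf M B m w) (H : IsAcceptedBranch M φ B m) {i j s : ℕ}
    (h : Closes M B m i j s) (hi : i < (B m).pos) (r : PrecRel) :
    RelAt M B (B s).ctx r (B s) ↔ w.rel M i j = some r := by
  obtain ⟨v, x, hc⟩ := h.conf_eq
  have hctx : (B s).ctx = (frame M B m i).head?.map Prod.snd := by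
    rw [(H.nodeInv s h.lt.le).ctx, hc, List.tail_cons]
  rcases Nat.eq_zero_or_pos i with rfl | h1
  · rw [frame, if_pos rfl] at hctx
    rw [hctx, RelAt, W.syms_step H h.lt.le h.step, h.pos]
    simp only [symsAt, List.head?_nil, Option.map_none, Set.singleton_eq_singleton_iff]
    constructor
    · rintro ⟨x, y, rfl, rfl, h⟩
      exact h
    · exact fun h => ⟨_, _, rfl, rfl, h⟩
  · obtain ⟨v', hv, -⟩ := H.frame_cons h1 hi
    have hr := H.isReadNode h1 hi.le
    rw [hctx, hv]
    simp only [List.head?_cons, Option.map_some]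
    rw [W.relAt_iff H hr.1 hr.2.1 h.lt.le h.step, hr.2.2.2, h.pos]

theorem Closes.ctx_eq (H : IsAcceptedBranch M φ B m) {i j s : ℕ}
    (h : Closes M B m i j s) (h1 : 1 ≤ i) (hi : i < (B m).pos) :
    (B s).ctx = some (readNode M B m i) := by
  obtain ⟨v, x, hc⟩ := h.conf_eq
  obtain ⟨v', hv, -⟩ := H.frame_cons h1 hi
  rw [(H.nodeInv s h.lt.le).ctx, hc, List.tail_cons, hv]
  rfl

/-- The data of the chain closed by a pop node just before the step node `B k`. -/
theorem IsWordOf.closes_prev (W : IsWordOf M B m w) (H : IsAcceptedBranch M φ B m) {k s : ℕ}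
    (hk : k ≤ m) (hkt : IsStep M B k) (hp : (B k).prev = some s) (ht : (B s).HasType M .takes) :
    ∃ h, Closes M B m h (B k).pos s ∧ Chi M w h (B k).pos ∧ h < (B m).pos ∧
      conf M B k = frame M B m h ∧ ∀ r, (B k).HasType M r ↔ w.rel M h (B k).pos = some r := by
  obtain ⟨h1, h2, h3, h4, -⟩ := (H.nodeInv k hk).prev_some hp
  have hs : s < m := by omega
  have hc := H.closes hs.le h2 ht
  have hchi := W.chi_of_takes H hs.le h2 ht
  rw [H.pos_succ hs fun h => h.2.not_takes ht] at h4
  rw [← h4] at hc hchi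
  have hlt : topPos B (conf M B s).tail < (B m).pos := by rw [← W.last]; exact hchi.left_lt
  have hconf : conf M B k = frame M B m (topPos B (conf M B s).tail) := by
    rw [← conf_pop h2 ht, H.frame_topPos hs, h3]
  refine ⟨_, hc, hchi, hlt, hconf, fun r => ?_⟩
  rw [W.hasType_iff H hk hkt, hconf, H.topPos_frame hlt]

/-- Every stack entry is popped eventually. -/
theorem IsAcceptedBranch.exists_pop (H : IsAcceptedBranch M φ B m) {l v x : ℕ} (hl : l ≤ m)
    (h : (v, x) ∈ conf M B l) : ∃ k y, l ≤ k ∧ k < m ∧ IsStep M B k ∧ (B k).HasType M .takes ∧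
      conf M B k = (v, y) :: conf M B v ∧ (B k).stack = some v := by
  induction hd : m - l generalizing l x with
  | zero =>
    obtain rfl : l = m := by omega
    simp [H.conf_last] at h
  | succ d ih =>
    have hlm : l < m := by omega
    have next : (∃ y, (v, y) ∈ conf M B (l + 1)) → ∃ k y, l ≤ k ∧ k < m ∧ IsStep M B k ∧
        (B k).HasType M .takes ∧ conf M B k = (v, y) :: conf M B v ∧ (B k).stack = some v := by
      rintro ⟨y, hy⟩
      obtain ⟨k, z, h1, h2⟩ := ih hlm hy (by omega)
      exact ⟨k, z, by omega, h2⟩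
    by_cases hs : IsStep M B l
    · have I := H.nodeInv l hl
      obtain ⟨r, hr⟩ := H.exists_type hl hs
      cases r with
      | yields => exact next ⟨x, by simp [conf_push hs hr, h]⟩
      | equal =>
        obtain ⟨v', i, hc⟩ := H.conf_of_equal hlm hs hr
        rw [hc] at h
        rcases List.mem_cons.1 h with h | h
        · obtain ⟨rfl, rfl⟩ := Prod.mk.inj h
          exact next ⟨l, by simp [conf_shift hs hr hc]⟩
        · exact next ⟨x, by simp [conf_shift hs hr hc, h]⟩
      | takes =>
        obtain ⟨v', i, hc⟩ := H.conf_of_takes hl hs hr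
        rw [hc] at h
        rcases List.mem_cons.1 h with h | h
        · obtain ⟨rfl, rfl⟩ := Prod.mk.inj h
          exact ⟨l, _, le_rfl, hlm, hs, hr, hc, by simp [I.stack, hc]⟩
        · exact next ⟨x, by simp [conf_pop hs hr, hc, h]⟩
    · exact next ⟨x, by rwa [conf_of_not_isStep hs]⟩

theorem IsAcceptedBranch.pos_eq_of_no_read (H : IsAcceptedBranch M φ B m) {k l : ℕ} (hkl : k ≤ l)
    (hl : l ≤ m) (h : ∀ j, k ≤ j → j < l → IsStep M B j → ¬ (B j).IsPushShift M) :
    (B l).pos = (B k).pos := by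
  induction l, hkl using Nat.le_induction with
  | base => rfl
  | succ l hkl ih =>
    rw [H.pos_succ hl fun h' => h l hkl (by omega) h'.1 h'.2]
    exact ih (by omega) fun j h1 h2 => h j h1 (by omega)

theorem IsAcceptedBranch.readNode_of_conf (H : IsAcceptedBranch M φ B m) {s p : ℕ} (hs : s < m)
    (hst : IsStep M B s) (ht : (B s).IsPushShift M) (hp : p < (B m).pos)
    (h : conf M B (s + 1) = frame M B m p) : s = readNode M B m p := by
  have h1 := H.one_le_pos hs.le
  have h2 := H.pos_lt hs le_rfl hst ht
  have : frame M B m (B s).pos = conf M B (s + 1) := by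
    rw [frame, if_neg (by omega), H.readNode_pos hs.le hst ht]
  have := congrArg (topPos B) (this.trans h)
  rw [H.topPos_frame h2, H.topPos_frame hp] at this
  rw [← this, H.readNode_pos hs.le hst ht]

theorem IsAcceptedBranch.frame_injective (H : IsAcceptedBranch M φ B m) {p q : ℕ}
    (hp : p < (B m).pos) (hq : q < (B m).pos) (h : frame M B m p = frame M B m q) : p = q := by
  have := congrArg (topPos B) h
  rwa [H.topPos_frame hp, H.topPos_frame hq] at this

/-- The last time that position `p` is on top of the stack at a step node, the node is not a push
node. It comes directly after the read node of `p`, or after the pop node that closes the longest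
chain with left context `p`. -/
theorem IsWordOf.exists_last_visit (W : IsWordOf M B m w) (H : IsAcceptedBranch M φ B m) {p : ℕ}
    (h1 : 1 ≤ p) (hp : p < (B m).pos) : ∃ K ≤ m, IsStep M B K ∧
      ((B K).HasType M .takes ∨ (B K).HasType M .equal) ∧
      ((B K).prev = some (readNode M B m p) ∨
        ∃ s, (B K).prev = some s ∧ Closes M B m p (B K).pos s ∧ Chi M w p (B K).pos ∧
          ∀ r, (B K).HasType M r ↔ w.rel M p (B K).pos = some r) := by
  let X := {K | K ≤ m ∧ IsStep M B K ∧ conf M B K = frame M B m p}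
  have hne : X.Nonempty := by
    obtain ⟨k, h1, h2, -, h3, -⟩ := H.exists_first hp
    exact ⟨k, h1, h2, h3⟩
  have hbdd : BddAbove X := ⟨m, fun x hx => hx.1⟩
  obtain ⟨hK, hs, hc⟩ : sSup X ∈ X := Nat.sSup_mem hne hbdd
  have hmax : ∀ x ∈ X, x ≤ sSup X := fun x hx => le_csSup hbdd hx
  generalize sSup X = K at *
  obtain ⟨v, hv, -⟩ := H.frame_cons h1 hp
  refine ⟨K, hK, hs, ?_, ?_⟩
  · obtain ⟨r, hr⟩ := H.exists_type hK hs
    cases r with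
    | takes => exact .inl hr
    | equal => exact .inr hr
    | yields =>
      exfalso
      have hKm : K < m := by
        rcases hK.lt_or_eq with h | rfl
        · exact h
        · simpa using hr.unique H.hasType_last
      obtain ⟨k, y, h2, h3, h4, h5, h6, -⟩ :=
        H.exists_pop (l := K + 1) (v := K) (x := K) hKm (by simp [conf_push hs hr])
      obtain ⟨k', h7, h8, h9, -, h10, -⟩ := H.exists_next_step h3 h4
      have := hmax k' ⟨h8, h9, by rw [h10, conf_pop h4 h5, h6, List.tail_cons, hc]⟩
      omega
  · cases hprev : (B K).prev with
    | none =>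
      have := ((H.nodeInv K hK).prev_none hprev).1
      rw [hc, hv] at this
      simp at this
    | some s =>
      obtain ⟨h2, h3, h4, h5, -⟩ := (H.nodeInv K hK).prev_some hprev
      rcases H.pushShift_or_takes (by omega) h3 with ht | ht
      · left
        rw [H.readNode_of_conf (by omega) h3 ht hp (h4.symm.trans hc)]
      · obtain ⟨h, h6, h7, h8, h9, h10⟩ := W.closes_prev H hK hs hprev ht
        obtain rfl := H.frame_injective h8 hp (h9.symm.trans hc)
        exact .inr ⟨s, rfl, h6, h7, h10⟩

/-! ### Next and chain next operators -/

theorem IsWordOf.next (W : IsWordOf M B m w) (H : IsAcceptedBranch M φ B m) {p : ℕ} {t : Dir}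
    {α : Formula S AP} (h : .next t α ∈ branchLabelling M B m p) :
    p < w.last ∧ t.Allows (w.rel M p (p + 1)) ∧ α ∈ branchLabelling M B m (p + 1) := by
  obtain ⟨h1, hp, hmem⟩ := H.label_of_inert h trivial
  have hr := H.isReadNode h1 hp.le
  have hlt := H.readNode_lt h1 hp
  refine ⟨by rwa [W.last], ?_, ?_⟩
  · obtain ⟨k, h2, h3, h4, h5, -, h6⟩ := H.exists_first hp
    obtain ⟨h6, -⟩ := h6 h1
    have hrel := W.relAt_iff H hr.1 hr.2.1 h2 h3
    rw [hr.2.2.2, h4] at hrel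
    obtain ⟨r, ht⟩ := H.exists_type h2 h3
    have hrr := (W.hasType_iff H h2 h3 r).1 ht
    rw [h4, h5, H.topPos_frame hp] at hrr
    have hrej := H.not_rejected k h2 h3
    cases t <;> cases r
    · exact .inl hrr
    · exact .inr hrr
    · exact absurd (.next_down _ α h6 hr.2.2.1 ((hrel _).2 hrr) hmem) hrej
    · exact absurd (.next_up _ α h6 hr.2.2.1 ((hrel _).2 hrr) hmem) hrej
    · exact .inr hrr
    · exact .inl hrr
  · have hpos := H.pos_succ_of_pushShift hlt hr.2.1 hr.2.2.1
    rw [hr.2.2.2] at hpos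
    refine H.labelling_of_label (Nat.succ_le_of_lt hlt) hpos ?_
    rcases (H.step_cases hlt hr.2.1).2 with h | h | h
    · rw [Nat.succ_eq_add_one, h.2.2.1]; exact ⟨t, hmem⟩
    · rw [Nat.succ_eq_add_one, h.2.2.1]; exact ⟨t, hmem⟩
    · exact absurd h.1 hr.2.2.1.not_takes

theorem IsWordOf.wnext (W : IsWordOf M B m w) (H : IsAcceptedBranch M φ B m) {p : ℕ} {t : Dir}
    {α : Formula S AP} (h : .wnext t α ∈ branchLabelling M B m p)
    (ht : t.Allows (w.rel M p (p + 1))) : α ∈ branchLabelling M B m (p + 1) := by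
  obtain ⟨h1, hp, hmem⟩ := H.label_of_inert h trivial
  have hr := H.isReadNode h1 hp.le
  obtain ⟨k, h2, h3, h4, h5, -, h6⟩ := H.exists_first hp
  obtain ⟨h6, -⟩ := h6 h1
  refine H.labelling_of_appearing h2 h4 ?_
  by_contra hα
  refine H.not_rejected k h2 h3 (.wnext _ t α h6 hr.2.2.1 ?_ hmem hα)
  rwa [W.dirRelAt_iff H hr.1 hr.2.1 h2 h3, hr.2.2.2, h4]

theorem IsWordOf.cnext (W : IsWordOf M B m w) (H : IsAcceptedBranch M φ B m) {p : ℕ} {t : Dir}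
    {α : Formula S AP} (h : .cnext t α ∈ branchLabelling M B m p) :
    ∃ j, Chi M w p j ∧ t.Allows (w.rel M p j) ∧ α ∈ branchLabelling M B m j := by
  obtain ⟨h1, hp, hmem⟩ := H.label_of_inert h trivial
  have hr := H.isReadNode h1 hp.le
  have hlt := H.readNode_lt h1 hp
  obtain ⟨v, hv, -, -, -, hvi⟩ := H.frame_cons h1 hp
  rw [frame, if_neg (by omega)] at hv
  obtain ⟨k, y, h2, h3, h4, h5, h6, h7⟩ :=
    H.exists_pop (l := readNode M B m p + 1) (v := v) (x := readNode M B m p) hlt (by simp [hv])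
  have hful : Fulfilled M B m t α (readNode M B m p) := by
    by_contra hnf
    refine H.not_rejected k h3.le h4 (.cnext _ t α h5 h2 hr.2.1 ?_ hmem hnf)
    rcases hvi with rfl | ⟨he, hst⟩
    · exact .inl h7
    · exact .inr ⟨he, by rw [hst, h7]⟩
  obtain ⟨s, q, -, hsq, hqm, hs, hst, hctx, hdir, hq, -, hno, hα⟩ := hful
  have hsm : s < m := by omega
  rw [W.dirRelAt_iff H hr.1 hr.2.1 hsm.le hs, hr.2.2.2] at hdir
  have hchi := W.chi_of_takes H hsm.le hs hst
  have htop : topPos B (conf M B s).tail = p := by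
    rw [(H.nodeInv s hsm.le).ctx] at hctx
    cases hc : (conf M B s).tail with
    | nil => simp [hc] at hctx
    | cons a r =>
      have : a.2 = readNode M B m p := by simpa [hc] using hctx
      simp only [topPos, this, hr.2.2.2]
  rw [htop] at hchi
  refine ⟨_, hchi, hdir, H.labelling_of_appearing hqm ?_ hα⟩
  refine H.pos_eq_of_no_read hsq.le hqm fun j h1 h2 h3 h4 => ?_
  rcases h1.lt_or_eq with h1 | rfl
  · exact hno j h1 h2 h3 h4
  · exact h4.not_takes hst

theorem IsWordOf.wcnext (W : IsWordOf M B m w) (H : IsAcceptedBranch M φ B m) {p j : ℕ} {t : Dir}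
    {α : Formula S AP} (h : .wcnext t α ∈ branchLabelling M B m p) (hj : Chi M w p j)
    (ht : t.Allows (w.rel M p j)) : α ∈ branchLabelling M B m j := by
  obtain ⟨h1, hp, hmem⟩ := H.label_of_inert h trivial
  obtain ⟨s, hs⟩ := hj.exists_closes W H
  obtain ⟨k, -, h2, h3, h4, -, h6, h7⟩ := hs.exists_next W H hj.left_lt
  have hctx := hs.ctx_eq H h1 hp
  have hmem' : .wcnext t α ∈ labelAt B (B s).ctx := by rw [hctx]; exact hmem
  refine H.labelling_of_appearing h2 h6 ?_
  by_contra hα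
  have hrej := H.not_rejected k h2 h3
  rcases ht with ht | ht
  · cases t
    · exact hrej (.wcnext_push s α ((h7 _).2 ht) h4 hs.takes hmem' hα)
    · exact hrej (.wcnext_pop s α ((h7 _).2 ht) h4 hs.takes hmem' hα)
  · exact hrej (.wcnext_shift s t α ((h7 _).2 ht) h4 hs.takes hmem' hα)

/-! ### Upward hierarchical operators -/

theorem IsAcceptedBranch.prev_of_not_prevPushShift (H : IsAcceptedBranch M φ B m) {k : ℕ}
    (hk : k ≤ m) (h : ¬ PrevPushShift M B (B k)) :
    ∃ s, (B k).prev = some s ∧ (B s).HasType M .takes := by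
  cases hp : (B k).prev with
  | none => exact absurd (.inl hp) h
  | some s =>
    obtain ⟨h1, h2, -⟩ := (H.nodeInv k hk).prev_some hp
    exact ⟨s, rfl, (H.pushShift_or_takes (by omega) h2).resolve_left fun h' =>
      h (.inr ⟨s, hp, h'⟩)⟩

theorem IsWordOf.hnext_up (W : IsWordOf M B m w) (H : IsAcceptedBranch M φ B m) {p : ℕ}
    {α : Formula S AP} (h : .hnext .up α ∈ branchLabelling M B m p) :
    ∃ j, HierNext M w .up p j ∧ α ∈ branchLabelling M B m j := by
  obtain ⟨h1, hp, hmem⟩ := H.label_of_inert h trivial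
  have hr := H.isReadNode h1 hp.le
  have hlt := H.readNode_lt h1 hp
  obtain ⟨i, hi⟩ : ∃ i, i = readNode M B m p := ⟨_, rfl⟩
  rw [← hi] at hmem hr hlt
  have hrej := H.not_rejected i hr.1 hr.2.1
  have hpush : (B i).HasType M .yields :=
    hr.2.2.1.resolve_right fun he => hrej (.hu_next_shift α he hmem)
  obtain ⟨s, hs1, hs2⟩ := H.prev_of_not_prevPushShift hr.1
    fun hpp => hrej (.hu_next_adj α hpush hpp hmem)
  obtain ⟨h, hc, hchi, hh, hconf, hty⟩ := W.closes_prev H hr.1 hr.2.1 hs1 hs2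
  have hrel := (hty _).1 hpush
  rw [hr.2.2.2] at hchi hrel
  -- The chain of `h` that is opened at `i` ends in the hierarchical successor.
  obtain ⟨k, y, h2, h3, h4, h5, h6, h7⟩ :=
    H.exists_pop (l := i + 1) (v := i) (x := i) hlt (by simp [conf_push hr.2.1 hpush])
  have hck : Closes M B m h (B k).pos k := ⟨h3, h4, h5, rfl, i, y, by rw [h6, hconf]⟩
  have hhw : h < w.last := by rwa [W.last]
  have hmem' : .hnext .up α ∈ labelAt B (B k).stack := by rw [h7]; exact hmem
  have hrelk : w.rel M h (B k).pos = some .yields := by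
    rw [← hck.relAt_ctx W H hh]
    by_contra hn
    exact H.not_rejected k h3.le h4 (.hu_next_pop α h5 hmem' hn)
  obtain ⟨K, -, h8, h9, h10, -, h12, h13⟩ := hck.exists_next W H hhw
  refine ⟨(B k).pos, ⟨h, hchi.lt, hchi, hrel, ⟨?_, hck.chi W H hhw, hrelk⟩, ?_⟩,
    H.labelling_of_appearing h8 h12 ?_⟩
  · have := H.pos_lt (k := i) h2 h3.le hr.2.1 hr.2.2.1
    rwa [hr.2.2.2] at this
  · rintro k' ⟨hpk, hk', -⟩
    by_contra hlt'
    obtain ⟨s', hs'⟩ := hk'.exists_closes W H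
    obtain ⟨v', x', hc'⟩ := hs'.conf_eq
    have his' : i < s' := H.lt_of_pos_lt hr.1 (by rw [hr.2.2.2, hs'.pos]; exact hpk)
    have hs'k : s' < k := H.lt_of_pos_lt hs'.lt.le (by rw [hs'.pos]; omega)
    obtain ⟨z, -, hz⟩ := H.exists_mem_conf (l := s') (v := i) (i := y) h3.le (by simp [h6])
      his' hs'k.le
    rw [hc', ← hconf] at hz
    rcases List.mem_cons.1 hz with hz | hz
    · obtain ⟨rfl, rfl⟩ := Prod.mk.inj hz
      exact H.not_mem_conf (i' := y) hs'.step hs'.takes hc' hs'k h3.le (by simp [h6])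
    · have := H.mem_conf hr.1 hz
      omega
  · by_contra hα
    exact H.not_rejected K h8 h9 (.hu_next_push k α ((h13 _).2 hrelk) h10 h5 hmem' hα)

theorem IsWordOf.whnext_up (W : IsWordOf M B m w) (H : IsAcceptedBranch M φ B m) {p j : ℕ}
    {α : Formula S AP} (h : .whnext .up α ∈ branchLabelling M B m p)
    (hj : HierNext M w .up p j) : α ∈ branchLabelling M B m j := by
  obtain ⟨h1, hp, hmem⟩ := H.label_of_inert h trivial
  have hr := H.isReadNode h1 hp.le
  obtain ⟨i, hi⟩ : ∃ i, i = readNode M B m p := ⟨_, rfl⟩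
  rw [← hi] at hmem hr
  obtain ⟨h, -, hhp, hhp', ⟨hpj, hhj, hhj'⟩, hmin⟩ := hj
  have hh : h < (B m).pos := by rw [← W.last]; exact hhp.left_lt
  -- Position `p` is pushed directly after a pop with left context `h`.
  obtain ⟨s0, hs0⟩ := hhp.exists_closes W H
  obtain ⟨i', -, h2, h3, h4, h5, h6, h7⟩ := hs0.exists_next W H hhp.left_lt
  have hpush := (h7 _).2 hhp'
  obtain rfl : i' = i := H.isReadNode_unique ⟨h2, h3, .inl hpush, h6⟩ hr
  obtain ⟨s, hs⟩ := hhj.exists_closes W H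
  obtain ⟨k, -, g2, g3, g4, g5, g6, g7⟩ := hs.exists_next W H hhj.left_lt
  obtain ⟨v, x, hc⟩ := hs.conf_eq
  have I := H.nodeInv s hs.lt.le
  have hv := I.tail hc
  have hle := I.le hc
  have hvs := I.push hc
  have hstack : (B s).stack = some v := by simp [I.stack, hc]
  have his : i' < s := H.lt_of_pos_lt h2 (by rw [h6, hs.pos]; exact hpj)
  have hvi : v = i' := by
    rcases lt_trichotomy v i' with hlt | heq | hlt
    · obtain ⟨z, -, hz⟩ := H.exists_mem_conf (l := i') (v := v) (i := x) hs.lt.le (by simp [hc])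
        hlt his.le
      rw [h5, hv] at hz
      have := H.mem_conf (by omega) hz
      omega
    · exact heq
    · -- Otherwise `v` is a smaller candidate for the hierarchical successor.
      exfalso
      have hvm : v ≤ m := by have := hs.lt; omega
      have hpv := H.pos_lt hlt hvm h3 (.inl hpush)
      rw [h6] at hpv
      have hvj := H.pos_lt (l := s) (by omega) hs.lt.le hvs.1 (.inl hvs.2)
      rw [hs.pos] at hvj
      cases hprev : (B v).prev with
      | none =>
        have := ((H.nodeInv v hvm).prev_none hprev).2.1
        omega
      | some u =>
        obtain ⟨u1, u2, u3, u4, -⟩ := (H.nodeInv v hvm).prev_some hprev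
        rcases H.pushShift_or_takes (by omega) u2 with hu | hu
        · have hur := H.readNode_of_conf (by omega) u2 hu hh (u3.symm.trans hv.symm)
          have h0 : h ≠ 0 := by
            rintro rfl
            rw [← hv, frame, if_pos rfl] at u3
            have hum : u < m := by omega
            rcases hu with hu | hu
            · simp [conf_push u2 hu] at u3
            · obtain ⟨_, _, e⟩ := H.conf_of_equal hum u2 hu
              simp [conf_shift u2 hu e] at u3
          have := (H.isReadNode (p := h) (by omega) hh.le).2.2.2
          rw [← hur] at this
          rw [H.pos_succ_of_pushShift (by omega) u2 hu, this] at u4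
          have := hhp.lt
          omega
        · obtain ⟨h', e1, e2, e3, e4, e5⟩ := W.closes_prev H hvm hvs.1 hprev hu
          obtain rfl := H.frame_injective e3 hh (e4.symm.trans hv.symm)
          have := hmin ⟨hpv, e2, (e5 _).1 hvs.2⟩
          omega
  subst hvi
  refine H.labelling_of_appearing g2 g6 ?_
  by_contra hα
  exact H.not_rejected k g2 g3 (.hu_wnext s v α ((g7 _).2 hhj') g4 hs.takes hstack hpush
    ⟨s0, h4, hs0.takes⟩ hmem hα)

/-! ### Downward hierarchical operators -/

/-- If a pop node `B s` closes a chain with left context `p`, then the pop just before it closes a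
chain with the same right context inside the former one, and its left context takes precedence on
the right context because the next step `B s` is a pop. -/
theorem IsWordOf.closes_prev_of_closes (W : IsWordOf M B m w) (H : IsAcceptedBranch M φ B m)
    {p j s s' : ℕ} (h1 : 1 ≤ p) (hp : p < (B m).pos) (hs : Closes M B m p j s)
    (hprev : (B s).prev = some s') (ht : (B s').HasType M .takes) :
    ∃ q, p < q ∧ q < (B m).pos ∧ Closes M B m q j s' ∧ Chi M w q j ∧
      w.rel M q j = some .takes := by
  obtain ⟨q, e1, e2, e3, e4, e5⟩ := W.closes_prev H hs.lt.le hs.step hprev ht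
  obtain ⟨v, x, hc⟩ := hs.conf_eq
  have I := H.nodeInv s hs.lt.le
  have hx := H.mem_conf (v := v) (i := x) hs.lt.le (by simp [hc])
  have htop := congrArg (topPos B) e4
  rw [H.topPos_frame e3, hc] at htop
  obtain ⟨v0, -, hv0⟩ := H.mem_frame_self h1 hp
  rw [I.tail hc] at hv0
  have hsm := hs.lt
  have hlt := (H.mem_conf (by omega) hv0).2.1
  have hr := H.isReadNode h1 hp.le
  have := H.pos_lt (k := readNode M B m p) (l := x) (by omega) (by omega) hr.2.1 hr.2.2.1
  simp only [topPos] at htop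
  rw [hr.2.2.2, htop] at this
  rw [hs.pos] at e1 e2
  have e5 := (e5 _).1 hs.takes
  rw [hs.pos] at e5
  exact ⟨q, this, e3, e1, e2, e5⟩

/-- The symbol below a popped chain is that of its left context. -/
theorem Closes.smb_stack (W : IsWordOf M B m w) (H : IsAcceptedBranch M φ B m) {i j s : ℕ}
    (h : Closes M B m i j s) (hi : i < (B m).pos) :
    ∃ v, (B s).stack = some v ∧ (B v).smb = w.sym i ∧ (B s).syms = {w.sym j} := by
  obtain ⟨v, x, hc⟩ := h.conf_eq
  have I := H.nodeInv s h.lt.le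
  have hle := I.le hc
  have hsm := h.lt
  refine ⟨v, by simp [I.stack, hc], ?_, ?_⟩
  · rw [W.smb_eq H (by omega), ← I.tail hc, H.topPos_frame hi]
  · rw [W.syms_step H h.lt.le h.step, h.pos]

theorem IsWordOf.hnext_down (W : IsWordOf M B m w) (H : IsAcceptedBranch M φ B m) {p : ℕ}
    {α : Formula S AP} (h : .hnext .down α ∈ branchLabelling M B m p) :
    ∃ j, HierNext M w .down p j ∧ α ∈ branchLabelling M B m j := by
  obtain ⟨h1, hp, hmem⟩ := H.label_of_inert h trivial
  have hr := H.isReadNode h1 hp.le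
  obtain ⟨K, hK, hKs, hKt, hK' | ⟨s, hprev, hs, hchi, hty⟩⟩ := W.exists_last_visit H h1 hp
  · exact absurd (.hd_next_adj _ α hKt hK' hr.2.2.1 hmem) (H.not_rejected K hK hKs)
  have hmem' : .hnext .down α ∈ labelAt B (B s).ctx := by rw [hs.ctx_eq H h1 hp]; exact hmem
  have hrej := H.not_rejected s hs.lt.le hs.step
  obtain ⟨v, hv1, hv2, hv3⟩ := hs.smb_stack W H hp
  have hrel : w.rel M p (B K).pos = some .takes := by
    rcases hKt with hKt | hKt
    · exact (hty _).1 hKt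
    · refine absurd (.hd_next_equal v _ α hs.takes hmem' hv1 hv3 ?_) hrej
      rw [hv2]
      exact (hty _).1 hKt
  obtain ⟨s2, hs2, hs2t⟩ := H.prev_of_not_prevPushShift hs.lt.le
    fun hpp => hrej (.hd_next_first α hs.takes hpp hmem')
  obtain ⟨q, hpq, hq, hqc, hqchi, hqrel⟩ := W.closes_prev_of_closes H h1 hp hs hs2 hs2t
  refine ⟨q, ⟨(B K).pos, hchi.lt, hchi, hrel, ⟨hpq, hqchi, hqrel⟩, ?_⟩, ?_⟩
  · rintro k ⟨hpk, hk, -⟩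
    by_contra hkq
    obtain ⟨s', hs'⟩ := hk.exists_closes W H
    have g1 := W.closes_lt H hs' hqc (by omega) (by rwa [W.last])
    have g2 := W.closes_lt H hs hs' hpk hk.left_lt
    exact ((H.nodeInv s hs.lt.le).prev_some hs2).2.2.2.2 s' g1 g2 hs'.step
  · have hrq := H.isReadNode (p := q) (by omega) hq.le
    refine H.labelling_of_appearing hrq.1 hrq.2.2.2 ?_
    by_contra hα
    exact hrej (.hd_next_pop s2 α hs.takes hs2 hs2t hmem' (by
      rw [hqc.ctx_eq H (by omega) hq]; exact hα))

theorem IsWordOf.whnext_down (W : IsWordOf M B m w) (H : IsAcceptedBranch M φ B m) {p j : ℕ}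
    {α : Formula S AP} (h : .whnext .down α ∈ branchLabelling M B m p)
    (hj : HierNext M w .down p j) : α ∈ branchLabelling M B m j := by
  obtain ⟨h1, hp, hmem⟩ := H.label_of_inert h trivial
  obtain ⟨h, -, hph, hrel, ⟨hpj, hjh, -⟩, hmin⟩ := hj
  obtain ⟨s, hs⟩ := hph.exists_closes W H
  obtain ⟨s', hs'⟩ := hjh.exists_closes W H
  have hlt := W.closes_lt H hs hs' hpj hjh.left_lt
  have I := H.nodeInv s hs.lt.le
  have hmem' : .whnext .down α ∈ labelAt B (B s).ctx := by rw [hs.ctx_eq H h1 hp]; exact hmem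
  obtain ⟨v, hv1, hv2, hv3⟩ := hs.smb_stack W H hp
  cases hprev : (B s).prev with
  | none => exact absurd hs'.step ((I.prev_none hprev).2.2 s' hlt)
  | some s2 =>
    obtain ⟨g1, g2, -, -, g5⟩ := I.prev_some hprev
    have hle : s' ≤ s2 := by
      by_contra hlt2
      exact g5 s' (by omega) hlt hs'.step
    have hsm := hs.lt
    have ht2 : (B s2).HasType M .takes := by
      refine (H.pushShift_or_takes (by omega) g2).resolve_left fun hps => ?_
      have e1 := H.pos_lt g1 hsm.le g2 hps
      have e2 := H.pos_mono hle (by omega)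
      rw [hs.pos] at e1
      rw [hs'.pos] at e2
      omega
    obtain ⟨q, hpq, hq, hqc, hqchi, hqrel⟩ := W.closes_prev_of_closes H h1 hp hs hprev ht2
    have hjq : j ≤ q := hmin ⟨hpq, hqchi, hqrel⟩
    obtain rfl : j = q := by
      by_contra hne
      have := W.closes_lt H hs' hqc (by omega) (by rwa [W.last])
      omega
    have hrq := H.isReadNode (p := j) (by omega) hq.le
    refine H.labelling_of_appearing hrq.1 hrq.2.2.2 ?_
    by_contra hα
    refine H.not_rejected s hsm.le hs.step (.hd_wnext s2 v _ α hs.takes hprev ht2 hmem' hv1 hv3 ?_ ?_)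
    · rw [hv2]
      exact hrel
    · rw [hqc.ctx_eq H (by omega) hq]
      exact hα

/-- A position with a downward hierarchical until is the left context of a chain on whose right
context it takes precedence, so that its hierarchical paths exist. -/
theorem IsWordOf.exists_takes_of_huntil_down (W : IsWordOf M B m w) (H : IsAcceptedBranch M φ B m)
    {p : ℕ} {α β : Formula S AP} (h : .huntil .down α β ∈ branchLabelling M B m p) :
    ∃ h, Chi M w p h ∧ w.rel M p h = some .takes := by
  obtain ⟨h1, hp, hA⟩ := h
  have hp : p < (B m).pos := by
    refine lt_of_le_of_ne hp ?_
    rintro rfl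
    rw [H.readNode_last] at hA
    exact H.not_rejected m le_rfl H.accepting.1 (.end_hd_until α β H.accepting.2.2.1 hA)
  have hr := H.isReadNode h1 hp.le
  obtain ⟨K, hK, hKs, hKt, hK' | ⟨s, hprev, hs, hchi, hty⟩⟩ := W.exists_last_visit H h1 hp
  · exact absurd (.hd_until_adj _ α β hKt hK' hr.2.2.1 hA) (H.not_rejected K hK hKs)
  refine ⟨_, hchi, (hty _).1 (hKt.resolve_right fun he => ?_)⟩
  exact H.not_rejected K hK hKs (.hd_until_chain s α β (.inr he) hprev hs.takes
    (by rw [hs.ctx_eq H h1 hp]; exact hA))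

theorem IsWordOf.hrelease_down (W : IsWordOf M B m w) (H : IsAcceptedBranch M φ B m)
    {p h : ℕ} {α β : Formula S AP} (hA : .hrelease .down α β ∈ branchLabelling M B m p)
    (hchi : Chi M w p h) (hrel : w.rel M p h = some .takes) :
    (α ∈ branchLabelling M B m p ∧ β ∈ branchLabelling M B m p) ∨
      (β ∈ branchLabelling M B m p ∧
        .whnext .down (.hrelease .down α β) ∈ branchLabelling M B m p) := by
  obtain ⟨h1, hp, hA⟩ := hA
  have hlt : p < (B m).pos := by rw [← W.last]; exact hchi.left_lt
  obtain ⟨s, hs⟩ := hchi.exists_closes W H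
  obtain ⟨k, -, h2, h3, h4, -, -, h7⟩ := hs.exists_next W H hchi.left_lt
  have hctx : AppearingAt B (B s).ctx = Appearing B (readNode M B m p) := by
    rw [hs.ctx_eq H h1 hlt]; rfl
  by_contra hn
  rw [not_or] at hn
  refine H.not_rejected k h2 h3 (.hd_release s α β ((h7 _).2 hrel) h4 hs.takes ?_ ?_ ?_) <;>
    rw [hctx]
  · exact hA
  · exact fun h => hn.2 ⟨⟨h1, hp, h.1⟩, h1, hp, h.2⟩
  · exact fun h => hn.1 ⟨⟨h1, hp, h.1⟩, h1, hp, h.2⟩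

/-! ### Soundness -/

/-- The labelling read off an accepted branch is a Hintikka labelling. -/
theorem IsWordOf.hintikka (W : IsWordOf M B m w) (H : IsAcceptedBranch M φ B m) :
    Hintikka M w (branchLabelling M B m) where
  le_last h := by rw [W.last]; exact h.2.1
  struct {p a} h := by
    obtain ⟨h1, hp, hmem⟩ := H.label_of_inert h trivial
    have : some a ∈ (B (readNode M B m p)).syms := hmem
    rw [W.syms h1 (by rw [W.last]; exact hp.le)] at this
    exact this.symm
  prop {p q} h := by
    obtain ⟨h1, hp, hmem⟩ := H.label_of_inert h trivial
    obtain ⟨i, rfl⟩ : ∃ i, p = i + 1 := ⟨p - 1, by omega⟩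
    have hl : i < w.length := by
      have := W.last
      simp only [OPWord.last] at this
      omega
    have hc : w.letter (i + 1) = some w[i] := by simp [OPWord.letter, hl]
    exact ⟨_, hc, by rw [W.letter hc]; exact hmem⟩
  neg_struct {p a} h hs := by
    obtain ⟨h1, hp, hmem⟩ := H.label_of_inert h trivial
    have hr := H.isReadNode h1 hp.le
    have : some a ∈ (B (readNode M B m p)).syms := by
      rw [W.syms h1 (by rw [W.last]; exact hp.le), hs]; rfl
    exact H.not_rejected _ hr.1 hr.2.1 (.contradiction (.struct a) this hmem)
  neg_prop {p q} h hs := by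
    obtain ⟨h1, hp, hmem⟩ := H.label_of_inert h trivial
    have hr := H.isReadNode h1 hp.le
    obtain ⟨c, hc, hq⟩ := hs
    rw [W.letter hc] at hq
    exact H.not_rejected _ hr.1 hr.2.1 (.contradiction (.prop q) hq hmem)
  and {p α β} h := by
    obtain ⟨j, Δ, -, -, he, hΔ⟩ := H.exists_expands h ⟨_, .and α β⟩
    cases he
    exact ⟨hΔ (by simp), hΔ (by simp)⟩
  or {p α β} h := by
    obtain ⟨j, Δ, -, -, he, hΔ⟩ := H.exists_expands h ⟨_, .or_left α β⟩
    cases he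
    · exact .inl (hΔ (by simp))
    · exact .inr (hΔ (by simp))
  next h := W.next H h
  wnext h _ ht := W.wnext H h ht
  cnext h := W.cnext H h
  wcnext h hj ht := W.wcnext H h hj ht
  hnext {p t α} h := by
    cases t
    · exact W.hnext_down H h
    · exact W.hnext_up H h
  whnext {p t α j} h hj := by
    cases t
    · exact W.whnext_down H h hj
    · exact W.whnext_up H h hj
  cuntil {p t α β} h := by
    obtain ⟨j, Δ, -, -, he, hΔ⟩ := H.exists_expands h ⟨_, .cuntil_now t α β⟩
    cases he
    · exact .inl (hΔ (by simp))
    · exact .inr (.inl ⟨hΔ (by simp), hΔ (by simp)⟩)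
    · exact .inr (.inr ⟨hΔ (by simp), hΔ (by simp)⟩)
  crelease {p t α β} h := by
    obtain ⟨j, Δ, -, -, he, hΔ⟩ := H.exists_expands h ⟨_, .crelease_now t α β⟩
    cases he
    · exact .inl ⟨hΔ (by simp), hΔ (by simp)⟩
    · exact .inr ⟨hΔ (by simp), hΔ (by simp), hΔ (by simp)⟩
  huntil_up {p α β} h := by
    obtain ⟨j, Δ, hj, hpos, he, hΔ⟩ := H.exists_expands h ⟨_, .huntil_next .up α β⟩
    cases he with
    | huntil_next => exact .inl ⟨hΔ (by simp), hΔ (by simp)⟩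
    | hu_until_now _ _ s hprev ht hrel =>
      refine .inr ⟨hΔ (by simp), ?_⟩
      obtain ⟨h1, h2, -, h3, -⟩ := (H.nodeInv j hj).prev_some hprev
      have hs : s < m := by omega
      rw [H.pos_succ hs fun h => h.2.not_takes ht, hpos] at h3
      have hchi := W.chi_of_takes H hs.le h2 ht
      rw [(H.closes hs.le h2 ht).relAt_ctx W H (by rw [← W.last]; exact hchi.left_lt)] at hrel
      rw [← h3] at hchi hrel
      exact ⟨_, hchi, hrel⟩
  huntil_down {p α β} h := by
    obtain ⟨j, Δ, hj, hpos, he, hΔ⟩ := H.exists_expands h ⟨_, .huntil_next .down α β⟩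
    cases he with
    | huntil_next => exact .inl ⟨hΔ (by simp), hΔ (by simp)⟩
    | hd_until_now => exact .inr ⟨hΔ (by simp), W.exists_takes_of_huntil_down H h⟩
  hrelease_up {p α β} h := by
    obtain ⟨j, Δ, -, -, he, hΔ⟩ := H.exists_expands h ⟨_, .hu_release_now α β⟩
    cases he
    · exact .inl ⟨hΔ (by simp), hΔ (by simp)⟩
    · exact .inr ⟨hΔ (by simp), hΔ (by simp)⟩
  hrelease_down hA hchi hrel := W.hrelease_down H hA hchi hrel

end

theorem mainTheorem1 {S AP : Type*} (M : OPM S) (φ : Formula S AP)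
    (h : HasAcceptedBranch M φ) : Satisfiable M φ := by
  obtain ⟨B, m, H⟩ := h
  obtain ⟨w, W⟩ := H.exists_isWordOf
  have hroot : φ.nnf ∈ branchLabelling M B m 1 :=
    H.labelling_of_label (Nat.zero_le m) (by rw [H.root]; rfl) (by rw [H.root]; rfl)
  exact ⟨w, W.compatible H, (sat_of_nnfAux φ 1).1
    ((W.hintikka H).sat (W.wellNested H) φ.nnf 1 φ.isNNF_nnf hroot)⟩
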